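/- Let $M$ be a smooth (Hausdorff, second countable, finite-dimensional, boundaryless) manifold, let $\alpha\in(1/2,1]$, let $Z:[0,T]\to\mathbb R^d$ be $\alpha$-Hölder continuous, and let $x\mapsto X(x)\in\mathcal L(\mathbb R^d,T_xM)$ be a smooth assignment of $d$ vector fields on $M$. An $\alpha$-Hölder path $x:[0,\tau]\to M$ is a solution of a (possibly time dependent) Young differential equation $dx_t=W_t(x_t)\,dZ_t$, $W_t(x)\in\mathcal L(\mathbb R^d,T_xM)$, if for all $f\in C^\infty(M;\mathbb R)$ and $t\in[0,\tau]$ $$f(x_t)=f(x_0)+\int_0^t Df(x_s)W_s(x_s)\,dZ_s ,$$ where the integral exists in the sense of Young, i.e. as a limit of Riemann–Stieltjes sums. Let $\eta_t$ be the (maximal, possibly only local) solution flow of $dx_t=X(x_t)\,dZ_t$, i.e. $t\mapsto\eta_t(x_0)$ is the maximal solution starting at $x_0$, and let $D_t\subseteq M$ be the set of initial conditions whose solution lives up to and including time $t$. Then, for every $t\in[0,T]$, $D_t$ and $\eta_t(D_t)$ are open and $\eta_t$ is injective on $D_t$, differentiable there with invertible derivative, so that $\eta_t^{-1}:\eta_t(D_t)\to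 D_t$ is defined; each $x\in M$ belongs to $\eta_t(D_t)$ for all sufficiently small $t\in[0,T]$, and if $M$ is compact then $D_t=\eta_t(D_t)=M$ for all $t\in[0,T]$. Moreover, $\eta_t^{-1}$ is the solution map of the Young differential equation $$dz_t=-\big(D\eta_t(z_t)\big)^{-1}X(\eta_t(z_t))\,dZ_t,$$ where $(D\eta_t(z))^{-1}:T_{\eta_t(z)}M\to T_zM$ denotes the inverse of the derivative of $\eta_t$ at $z$. That is: let $x\in M$, $\tau\in[0,T]$, and let $z:[0,\tau]\to M$ be such that $z_s\in D_s$ for all $s\in[0,\tau]$. Then $z_s=\eta_s^{-1}(x)$ for all $s\in[0,\tau]$ if and only if $z$ is a solution of this equation on $[0,\tau]$ with $z_0=x$. -/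

import Mathlib

open Set Filter Topology
open scoped Manifold ContDiff NNReal

namespace YoungFlow

/-- `HasYoungIntegral Y Z a b J`: the Young (Riemann-Stieltjes) integral `∫_a^b Y_s dZ_s` of the
covector-valued path `Y` against the path `Z` in `ℝ^d` exists and is equal to `J`, i.e. the sums
`∑ i, Y_{ξ i} (Z_{t (i+1)} - Z_{t i})` over the tagged partitions `a = t 0 ≤ ⋯ ≤ t n = b` converge
to `J` when the mesh tends to `0`. -/
def HasYoungIntegral {d : ℕ} (Y : ℝ → (EuclideanSpace ℝ (Fin d) →L[ℝ] ℝ))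
    (Z : ℝ → EuclideanSpace ℝ (Fin d)) (a b J : ℝ) : Prop :=
  ∀ ε : ℝ, 0 < ε → ∃ δ : ℝ, 0 < δ ∧ ∀ (n : ℕ) (t ξ : ℕ → ℝ), t 0 = a → t n = b →
    (∀ i < n, ξ i ∈ Icc (t i) (t (i + 1)) ∧ t (i + 1) - t i < δ) →
      |∑ i ∈ Finset.range n, Y (ξ i) (Z (t (i + 1)) - Z (t i)) - J| < ε

section Manifold

variable {m d : ℕ} {M : Type*} [TopologicalSpace M]
  [ChartedSpace (EuclideanSpace ℝ (Fin m)) M]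

/-- A path `x : [0, τ] → M` in a manifold is `α`-Hölder: it is continuous, and it is `α`-Hölder
in charts near every time. (As `[0, τ]` is compact, this is Hölder continuity with respect to the
distance of any Riemannian metric.) Only the values of `x` on `[0, τ]` matter. -/
def IsHolderPath (α : ℝ≥0) (τ : ℝ) (x : ℝ → M) : Prop :=
  ContinuousOn x (Icc 0 τ) ∧
    ∀ t₀ ∈ Icc 0 τ, ∃ C : ℝ≥0, ∃ U ∈ 𝓝[Icc 0 τ] t₀,
      HolderOnWith C α (fun t => extChartAt (𝓡 m) (x t₀) (x t)) U

/-- The assignment `x ↦ X x ∈ L(ℝ^d, T_x M)` is smooth: all the vector fields `x ↦ X x v` are. -/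
def IsSmoothFields [IsManifold (𝓡 m) ∞ M]
    (X : (x : M) → (EuclideanSpace ℝ (Fin d) →L[ℝ] TangentSpace (𝓡 m) x)) : Prop :=
  ∀ v : EuclideanSpace ℝ (Fin d),
    ContMDiff (𝓡 m) (𝓡 m).tangent ∞ (fun x : M => (⟨x, X x v⟩ : TangentBundle (𝓡 m) M))

/-- The path `x : [0, τ] → M` is a solution on `[0, τ]` of the (possibly time dependent) Young
differential equation `dx_t = W_t(x_t) dZ_t`: it is `α`-Hölder and, for every test function
`f ∈ C^∞(M; ℝ)` and every `t ∈ [0, τ]`, `f (x_t) = f (x_0) + ∫_0^t Df(x_s) W_s(x_s) dZ_s`. -/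
def IsYoungSolution (α : ℝ≥0) (Z : ℝ → EuclideanSpace ℝ (Fin d))
    (W : ℝ → (x : M) → (EuclideanSpace ℝ (Fin d) →L[ℝ] TangentSpace (𝓡 m) x))
    (τ : ℝ) (x : ℝ → M) : Prop :=
  IsHolderPath (m := m) α τ x ∧
    ∀ f : M → ℝ, ContMDiff (𝓡 m) 𝓘(ℝ, ℝ) ∞ f → ∀ t ∈ Icc 0 τ,
      HasYoungIntegral (fun s => (mfderiv (𝓡 m) 𝓘(ℝ, ℝ) f (x s)).comp (W s (x s))) Z 0 t
        (f (x t) - f (x 0))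

/-- The set of initial conditions whose maximal solution of `dx_t = X(x_t) dZ_t` lives at least up
to (and including) time `t`. -/
def flowDomain (α : ℝ≥0) (Z : ℝ → EuclideanSpace ℝ (Fin d))
    (X : (x : M) → (EuclideanSpace ℝ (Fin d) →L[ℝ] TangentSpace (𝓡 m) x)) (t : ℝ) : Set M :=
  {x₀ | ∃ y : ℝ → M, IsYoungSolution α Z (fun _ => X) t y ∧ y 0 = x₀}

/-- `η` is the (maximal, possibly only local) solution flow of `dx_t = X(x_t) dZ_t`,
`t ∈ [0, T]`: if the solution starting at `x₀` lives up to time `t`, then it is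
`s ↦ η s x₀` on `[0, t]`. The value of `η t` off `flowDomain α Z X t` is irrelevant. -/
def IsSolutionFlow (α : ℝ≥0) (T : ℝ) (Z : ℝ → EuclideanSpace ℝ (Fin d))
    (X : (x : M) → (EuclideanSpace ℝ (Fin d) →L[ℝ] TangentSpace (𝓡 m) x))
    (η : ℝ → M → M) : Prop :=
  ∀ t ∈ Icc 0 T, ∀ x₀ ∈ flowDomain α Z X t,
    IsYoungSolution α Z (fun _ => X) t (fun s => η s x₀) ∧ η 0 x₀ = x₀

/-- The time dependent coefficient `z ↦ -(Dη_t(z))⁻¹ X(η_t(z))` of the equation of the inverse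
flow, where `(Dη_t(z))⁻¹ : T_{η_t(z)} M → T_z M` is the inverse of the derivative of `η_t`
at `z`. -/
noncomputable def inverseField
    (X : (x : M) → (EuclideanSpace ℝ (Fin d) →L[ℝ] TangentSpace (𝓡 m) x))
    (η : ℝ → M → M) (t : ℝ) (z : M) :
    EuclideanSpace ℝ (Fin d) →L[ℝ] TangentSpace (𝓡 m) z :=
  -((mfderiv (𝓡 m) (𝓡 m) (η t) z).inverse.comp (X (η t z)))

end Manifold

end YoungFlow

/-! Because `α > 1/2`, the equation `dx = W dZ` is equivalent to a first order expansion: in charts,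
`x_t - x_s` equals `W_s(x_s)(Z_t - Z_s)` up to `O(|t - s| ^ (2α))`, with Hölder coefficients. Errors
of order `2α > 1` vanish when summed over fine partitions, so such an expansion produces the Young
integral (`hasYoungIntegral_of_hasExpansion`), is implied by it
(`hasExpansion_of_hasYoungIntegral`), and determines the path.

Local theory. In a chart, `X` is cut off to a compactly supported field `V`. The dyadic Euler
schemes of `V` converge: halving an interval doubles the number of errors but shrinks each by `2 ^
(-2α) < 1/2`. The limit `Φ t s` is defined for both orders of `s, t` and satisfies the cocycle law.
The same construction for the system of a point and a tangent vector shows that `Φ t s` is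
differentiable with Lipschitz derivative (`exists_roughFlow`). That regularity is what the Young
chain rule needs: its Taylor remainder is quadratic, hence of order `2α` along Hölder paths.

On `M`, these local flows become flow boxes. Uniqueness, and the openness and differentiability
statements about `η_t`, are propagated along a solution by connectedness of the time interval
(`iff_of_locally_const`), since each holds on one side of a short box step if and only if it holds
on the other.

Inverse flow. Near a time `t₀`, in charts, `η_s = Φ s t₀ ∘ η_{t₀}`. Put `u_s = η_{t₀}(z_s)`. If `z`
solves the inverse equation, then the increment of `Φ s t₀ (u_s)` is the sum of a contribution `V
dZ` from time and a contribution `DΦ du = -V dZ` from the point, up to order `2α`; hence `η_s(z_s)`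
is locally constant (`RoughFlow.eventually_flow_eq`). Conversely, if `η_s(z_s)` is constant, then
`u_s = Φ t₀ s c`; the cocycle law gives the expansion of this path in `s`
(`RoughFlow.hasExpansion_of_flow_eq`), and undoing `η_{t₀}` gives that of `z`
(`HasExpansion.of_comp`). -/

namespace YoungFlow

/-! ### Dyadic Euler schemes: estimates uniform in the number of halvings. -/

section Sewing

variable {E : Type*} [NormedAddCommGroup E]

/-- A time-increment-indexed family of displacement fields `v t s : E → E`, additive in time,
of size `D |t - s| ^ a` in `C^{1,1}`. -/
structure AdditiveField (a D : ℝ) (v : ℝ → ℝ → E → E) : Prop where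
  add : ∀ s u t y, v t s y = v t u y + v u s y
  norm_le : ∀ t s y, ‖v t s y‖ ≤ D * |t - s| ^ a
  lip : ∀ t s y y', ‖v t s y - v t s y'‖ ≤ D * |t - s| ^ a * ‖y - y'‖
  lip₂ : ∀ t s y y' g, ‖(v t s (y + g) - v t s y) - (v t s (y' + g) - v t s y')‖ ≤
    D * |t - s| ^ a * ‖g‖ * ‖y - y'‖
  cont : Continuous fun p : ℝ × ℝ × E => v p.1 p.2.1 p.2.2

/-- The Euler scheme along the `2 ^ n` dyadic subintervals of `[s, t]`. -/
noncomputable def dyadicFlow (v : ℝ → ℝ → E → E) : ℕ → ℝ → ℝ → E → E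
  | 0 => fun t s y => y + v t s y
  | n + 1 => fun t s y => dyadicFlow v n t ((s + t) / 2) (dyadicFlow v n ((s + t) / 2) s y)

/-- Constants for which dyadic Euler schemes of fields of size `D` converge on intervals of length
at most `h`. -/
structure StepSize (a D K ρ h : ℝ) : Prop where
  half_lt : 1 / 2 < a
  D_nonneg : 0 ≤ D
  K_nonneg : 0 ≤ K
  h_pos : 0 < h
  ρ_lt : ρ < 1
  K_h : K * h ^ a ≤ 1
  contr : (1 / 2 : ℝ) ^ (2 * a) * (2 + (D + 1) * h ^ a) ≤ ρ
  K_big : 2 * D * (D + 1) ≤ K * (1 - ρ)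

/-- As `2a > 1`, twice `(1/2) ^ (2a)` is below `1`, and `ρ` is taken halfway between the two. Then
`K` makes `K_big` an equality, and finally `h` is taken small. The extra demand on `c` will control
the growth of tangent vectors. -/
theorem exists_stepSize {a D : ℝ} (ha : 1 / 2 < a) (hD : 0 ≤ D) (c : ℝ) :
    ∃ K ρ h, StepSize a D K ρ h ∧ c * h ^ a ≤ 1 := by
  have hq : (1 / 2 : ℝ) ^ (2 * a) < 1 / 2 := by
    calc (1 / 2 : ℝ) ^ (2 * a) < (1 / 2 : ℝ) ^ (1 : ℝ) :=
          Real.rpow_lt_rpow_of_exponent_gt (by norm_num) (by norm_num) (by linarith)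
      _ = 1 / 2 := Real.rpow_one _
  set q := (1 / 2 : ℝ) ^ (2 * a) with hqdef
  set ρ := (2 * q + 1) / 2 with hρ
  have hρ1 : ρ < 1 := by rw [hρ]; linarith
  set K := 2 * D * (D + 1) / (1 - ρ) with hK
  have hlim : Tendsto (fun h : ℝ => h ^ a) (𝓝[>] 0) (𝓝 0) := by
    have h0 : ContinuousAt (fun h : ℝ => h ^ a) 0 :=
      Real.continuousAt_rpow_const _ _ (Or.inr (by linarith))
    have := h0.tendsto
    rw [Real.zero_rpow (by linarith)] at this
    exact this.mono_left nhdsWithin_le_nhds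
  have e1 : ∀ᶠ h : ℝ in 𝓝[>] 0, K * h ^ a < 1 := by
    have := hlim.const_mul K
    rw [mul_zero] at this
    exact this.eventually_lt_const one_pos
  have e2 : ∀ᶠ h : ℝ in 𝓝[>] 0, c * h ^ a < 1 := by
    have := hlim.const_mul c
    rw [mul_zero] at this
    exact this.eventually_lt_const one_pos
  have e3 : ∀ᶠ h : ℝ in 𝓝[>] 0, q * (2 + (D + 1) * h ^ a) < ρ := by
    have := ((hlim.const_mul (D + 1)).const_add 2).const_mul q
    rw [mul_zero, add_zero] at this
    exact this.eventually_lt_const (by rw [hρ]; linarith)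
  obtain ⟨h, h1, h2, h3, h4⟩ := (e1.and (e2.and (e3.and self_mem_nhdsWithin))).exists
  refine ⟨K, ρ, h, ⟨ha, hD, ?_, h4, hρ1, h1.le, h3.le, ?_⟩, h2.le⟩
  · have : 0 < 1 - ρ := by linarith
    positivity
  · rw [hK, div_mul_cancel₀]; linarith

theorem rpow_two_mul' {w a : ℝ} (hw : 0 ≤ w) (ha : 0 < a) : w ^ (2 * a) = w ^ a * w ^ a := by
  rw [two_mul, Real.rpow_add_of_nonneg hw ha.le ha.le]

theorem half_rpow {w a : ℝ} (hw : 0 ≤ w) :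
    (w / 2) ^ a = (1 / 2 : ℝ) ^ a * w ^ a := by
  rw [← Real.mul_rpow (by norm_num) hw]; congr 1; ring

theorem abs_sub_mid (s t : ℝ) : |t - (s + t) / 2| = |t - s| / 2 := by
  rw [show t - (s + t) / 2 = (t - s) / 2 by ring, abs_div, abs_two]

theorem abs_mid_sub (s t : ℝ) : |(s + t) / 2 - s| = |t - s| / 2 := by
  rw [show (s + t) / 2 - s = (t - s) / 2 by ring, abs_div, abs_two]

namespace StepSize

variable {a D K ρ h : ℝ} (H : StepSize a D K ρ h)
include H

theorem a_pos : 0 < a := by linarith [H.half_lt]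

theorem ρ_nonneg : 0 ≤ ρ := by
  have := H.D_nonneg
  have := H.h_pos
  exact le_trans (by positivity) H.contr

theorem rpow_le {w : ℝ} (hw : 0 ≤ w) (hwh : w ≤ h) : w ^ a ≤ h ^ a :=
  Real.rpow_le_rpow hw hwh H.a_pos.le

theorem K_rpow_le {w : ℝ} (hw : 0 ≤ w) (hwh : w ≤ h) : K * w ^ (2 * a) ≤ w ^ a := by
  rw [rpow_two_mul' hw H.a_pos, ← mul_assoc]
  have h1 : K * w ^ a ≤ 1 :=
    (mul_le_mul_of_nonneg_left (H.rpow_le hw hwh) H.K_nonneg).trans H.K_h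
  have : 0 ≤ w ^ a := Real.rpow_nonneg hw a
  nlinarith

/-- A bound that contracts under halving of the interval. -/
theorem half_contr {w : ℝ} (hw : 0 ≤ w) {C : ℝ} (hC : 0 ≤ C) :
    (2 + (D + 1) * h ^ a) * (C * (w / 2) ^ (2 * a)) ≤ ρ * C * w ^ (2 * a) := by
  rw [half_rpow hw]
  have h0 : 0 ≤ w ^ (2 * a) := Real.rpow_nonneg hw _
  calc _ = ((1 / 2 : ℝ) ^ (2 * a) * (2 + (D + 1) * h ^ a)) * (C * w ^ (2 * a)) := by ring
    _ ≤ ρ * (C * w ^ (2 * a)) := mul_le_mul_of_nonneg_right H.contr (by positivity)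
    _ = _ := by ring

variable {v : ℝ → ℝ → E → E} (hv : AdditiveField a D v)
include hv

theorem norm_sub_self_le {s t : ℝ} (hst : |t - s| ≤ h) {y z : E}
    (hz : ‖z - y - v t s y‖ ≤ K * |t - s| ^ (2 * a)) : ‖z - y‖ ≤ (D + 1) * |t - s| ^ a := by
  have h1 := H.K_rpow_le (abs_nonneg (t - s)) hst
  have h2 := hv.norm_le t s y
  calc ‖z - y‖ = ‖(z - y - v t s y) + v t s y‖ := by simp
    _ ≤ _ := norm_add_le _ _
    _ ≤ _ := by linarith

theorem norm_sub_sub_le {s t : ℝ} (hst : |t - s| ≤ h) {y y' z z' : E}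
    (hz : ‖(z - y - v t s y) - (z' - y' - v t s y')‖ ≤ K * |t - s| ^ (2 * a) * ‖y - y'‖) :
    ‖(z - y) - (z' - y')‖ ≤ (D + 1) * |t - s| ^ a * ‖y - y'‖ := by
  have h1 := H.K_rpow_le (abs_nonneg (t - s)) hst
  have h2 := hv.lip t s y y'
  calc ‖(z - y) - (z' - y')‖
      = ‖((z - y - v t s y) - (z' - y' - v t s y')) + (v t s y - v t s y')‖ := by congr 1; abel
    _ ≤ _ := norm_add_le _ _
    _ ≤ K * |t - s| ^ (2 * a) * ‖y - y'‖ + D * |t - s| ^ a * ‖y - y'‖ := add_le_add hz h2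
    _ ≤ |t - s| ^ a * ‖y - y'‖ + D * |t - s| ^ a * ‖y - y'‖ := by gcongr
    _ = _ := by ring

theorem norm_lip_le {s t : ℝ} (hst : |t - s| ≤ h) {y y' z z' : E}
    (hz : ‖(z - y - v t s y) - (z' - y' - v t s y')‖ ≤ K * |t - s| ^ (2 * a) * ‖y - y'‖) :
    ‖z - z'‖ ≤ (1 + (D + 1) * h ^ a) * ‖y - y'‖ := by
  have h1 := H.norm_sub_sub_le hv hst hz
  have h2 := H.rpow_le (abs_nonneg _) hst
  have := H.D_nonneg
  calc ‖z - z'‖ = ‖(y - y') + ((z - y) - (z' - y'))‖ := by congr 1; abel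
    _ ≤ _ := norm_add_le _ _
    _ ≤ ‖y - y'‖ + (D + 1) * h ^ a * ‖y - y'‖ := by
        refine add_le_add le_rfl (h1.trans ?_); gcongr
    _ = _ := by ring

/-- The point is that `K` does not depend on `n`. The errors of the two halves use up the share `ρ`
of `K |t - s| ^ (2a)`; evaluating the second increment at the displaced point `x` instead of `y`
costs `D (D + 1) (|t - s| / 2) ^ (2a)`, which fits in the share `1 - ρ` by `K_big`. -/
theorem norm_dyadicFlow_sub_le (n : ℕ) : ∀ {s t : ℝ}, |t - s| ≤ h → ∀ y,
    ‖dyadicFlow v n t s y - y - v t s y‖ ≤ K * |t - s| ^ (2 * a) := by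
  induction n with
  | zero =>
    intro s t _ y
    have := H.K_nonneg
    simp only [dyadicFlow, add_sub_cancel_left, sub_self, norm_zero]
    positivity
  | succ n ih =>
    intro s t hst y
    have hw := abs_nonneg (t - s)
    have e1 := abs_mid_sub s t
    have e2 := abs_sub_mid s t
    have l1 : |(s + t) / 2 - s| ≤ h := by rw [e1]; linarith
    have l2 : |t - (s + t) / 2| ≤ h := by rw [e2]; linarith
    simp only [dyadicFlow]
    set m := (s + t) / 2
    set x := dyadicFlow v n m s y
    set w := |t - s|
    have b1 := ih l1 y
    have b2 := ih l2 x
    have b3 := H.norm_sub_self_le hv l1 b1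
    have b4 := hv.lip t m x y
    rw [e1] at b1 b3
    rw [e2] at b2 b4
    have hD := H.D_nonneg
    have hq : 0 ≤ (w / 2) ^ a := Real.rpow_nonneg (by linarith) a
    calc ‖dyadicFlow v n t m x - y - v t s y‖
        = ‖(dyadicFlow v n t m x - x - v t m x) + (x - y - v m s y) + (v t m x - v t m y)‖ := by
          rw [hv.add s m t y]; congr 1; abel
      _ ≤ _ := norm_add₃_le
      _ ≤ K * (w / 2) ^ (2 * a) + K * (w / 2) ^ (2 * a) +
          D * (w / 2) ^ a * ((D + 1) * (w / 2) ^ a) := by gcongr; exact b4.trans (by gcongr)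
      _ = 2 * (K * (w / 2) ^ (2 * a)) + D * (D + 1) * ((1 / 2 : ℝ) ^ (2 * a) * w ^ (2 * a)) := by
          rw [← half_rpow hw, rpow_two_mul' (w := w / 2) (by linarith) H.a_pos]; ring
      _ ≤ (2 + (D + 1) * h ^ a) * (K * (w / 2) ^ (2 * a)) +
          2 * D * (D + 1) * (1 * w ^ (2 * a)) := by
          have := H.h_pos
          have := H.K_nonneg
          gcongr
          · have : 0 ≤ (D + 1) * h ^ a := by positivity
            linarith
          · nlinarith
          · exact Real.rpow_le_one (by norm_num) (by norm_num) (by linarith [H.a_pos])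
      _ ≤ ρ * K * w ^ (2 * a) + K * (1 - ρ) * w ^ (2 * a) := by
          rw [one_mul]
          exact add_le_add (H.half_contr hw H.K_nonneg)
            (mul_le_mul_of_nonneg_right H.K_big (Real.rpow_nonneg hw _))
      _ = _ := by ring

/-- The Lipschitz version of the previous estimate, by the same induction. It makes the schemes
Lipschitz uniformly in `n`, which is needed to compare compositions. -/
theorem norm_dyadicFlow_sub_sub_le (n : ℕ) : ∀ {s t : ℝ}, |t - s| ≤ h → ∀ y y',
    ‖(dyadicFlow v n t s y - y - v t s y) - (dyadicFlow v n t s y' - y' - v t s y')‖ ≤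
      K * |t - s| ^ (2 * a) * ‖y - y'‖ := by
  induction n with
  | zero =>
    intro s t _ y y'
    have := H.K_nonneg
    simp only [dyadicFlow, add_sub_cancel_left, sub_self, norm_zero]
    positivity
  | succ n ih =>
    intro s t hst y y'
    have hw := abs_nonneg (t - s)
    have e1 := abs_mid_sub s t
    have e2 := abs_sub_mid s t
    have l1 : |(s + t) / 2 - s| ≤ h := by rw [e1]; linarith
    have l2 : |t - (s + t) / 2| ≤ h := by rw [e2]; linarith
    simp only [dyadicFlow]
    set m := (s + t) / 2
    set x := dyadicFlow v n m s y
    set x' := dyadicFlow v n m s y'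
    set w := |t - s|
    have b1 := ih l1 y y'
    have b2 := ih l2 x x'
    have b3 := H.norm_sub_self_le hv l1 (H.norm_dyadicFlow_sub_le hv n l1 y)
    have b4 := H.norm_sub_sub_le hv l1 b1
    have b5 := H.norm_lip_le hv l1 b1
    -- Second differences need the same displacement at both base points, so `y' + (x - y)` is
    -- inserted between `y'` and `x'`. The two resulting terms explain the factor `2` in `K_big`.
    have b6 := hv.lip₂ t m y y' (x - y)
    have b7 := hv.lip t m (y' + (x - y)) (y' + (x' - y'))
    rw [add_sub_cancel] at b6
    rw [add_sub_cancel, show y' + (x - y) - x' = (x - y) - (x' - y') by abel] at b7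
    rw [e1] at b1 b3 b4
    rw [e2] at b2 b6 b7
    have hD := H.D_nonneg
    have hK := H.K_nonneg
    have hh := H.h_pos
    have hN := norm_nonneg (y - y')
    have hq : 0 ≤ (w / 2) ^ a := Real.rpow_nonneg (by linarith) a
    have hq2 : 0 ≤ (w / 2) ^ (2 * a) := Real.rpow_nonneg (by linarith) _
    calc ‖(dyadicFlow v n t m x - y - v t s y) - (dyadicFlow v n t m x' - y' - v t s y')‖
        = ‖((dyadicFlow v n t m x - x - v t m x) - (dyadicFlow v n t m x' - x' - v t m x')) +
            ((x - y - v m s y) - (x' - y' - v m s y')) +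
            (((v t m x - v t m y) - (v t m (y' + (x - y)) - v t m y')) +
              (v t m (y' + (x - y)) - v t m x'))‖ := by
          rw [hv.add s m t y, hv.add s m t y']; congr 1; abel
      _ ≤ _ := norm_add₃_le
      _ ≤ K * (w / 2) ^ (2 * a) * ((1 + (D + 1) * h ^ a) * ‖y - y'‖) +
          K * (w / 2) ^ (2 * a) * ‖y - y'‖ +
          (D * (w / 2) ^ a * ((D + 1) * (w / 2) ^ a) * ‖y - y'‖ +
            D * (w / 2) ^ a * ((D + 1) * (w / 2) ^ a * ‖y - y'‖)) := by
          refine add_le_add (add_le_add (b2.trans (by gcongr)) b1) ((norm_add_le _ _).trans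
            (add_le_add (b6.trans (by gcongr)) (b7.trans (by gcongr))))
      _ = ((2 + (D + 1) * h ^ a) * (K * (w / 2) ^ (2 * a)) +
          2 * D * (D + 1) * ((1 / 2 : ℝ) ^ (2 * a) * w ^ (2 * a))) * ‖y - y'‖ := by
          rw [← half_rpow hw, rpow_two_mul' (w := w / 2) (by linarith) H.a_pos]; ring
      _ ≤ (ρ * K * w ^ (2 * a) + K * (1 - ρ) * (1 * w ^ (2 * a))) * ‖y - y'‖ := by
          refine mul_le_mul_of_nonneg_right (add_le_add (H.half_contr hw hK) ?_) hN
          refine mul_le_mul H.K_big ?_ (by positivity) (mul_nonneg hK (by linarith [H.ρ_lt]))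
          gcongr
          exact Real.rpow_le_one (by norm_num) (by norm_num) (by linarith [H.a_pos])
      _ = _ := by ring

/-- The gap between consecutive schemes on an interval is composed of the gaps one level lower on
its two halves, one of them amplified by the Lipschitz constant; `contr` turns this into a factor
`ρ` per level. -/
theorem norm_dyadicFlow_succ_sub_le (n : ℕ) : ∀ {s t : ℝ}, |t - s| ≤ h → ∀ y,
    ‖dyadicFlow v (n + 1) t s y - dyadicFlow v n t s y‖ ≤ ρ ^ n * K * |t - s| ^ (2 * a) := by
  induction n with
  | zero =>
    intro s t hst y
    have := H.norm_dyadicFlow_sub_le hv 1 hst y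
    rw [sub_sub] at this
    simpa [dyadicFlow] using this
  | succ n ih =>
    intro s t hst y
    have hw := abs_nonneg (t - s)
    have e1 := abs_mid_sub s t
    have e2 := abs_sub_mid s t
    have l1 : |(s + t) / 2 - s| ≤ h := by rw [e1]; linarith
    have l2 : |t - (s + t) / 2| ≤ h := by rw [e2]; linarith
    rw [dyadicFlow.eq_2 v (n + 1), dyadicFlow.eq_2 v n]
    set m := (s + t) / 2
    have b1 := ih l1 y
    have b2 := ih l2 (dyadicFlow v (n + 1) m s y)
    have b3 := H.norm_lip_le hv l2 (H.norm_dyadicFlow_sub_sub_le hv n l2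
      (dyadicFlow v (n + 1) m s y) (dyadicFlow v n m s y))
    rw [e1] at b1
    rw [e2] at b2
    have hD := H.D_nonneg
    have hh := H.h_pos
    calc _ ≤ _ := norm_sub_le_norm_sub_add_norm_sub _
            (dyadicFlow v n t m (dyadicFlow v (n + 1) m s y)) _
      _ ≤ ρ ^ n * K * (|t - s| / 2) ^ (2 * a) +
          (1 + (D + 1) * h ^ a) * (ρ ^ n * K * (|t - s| / 2) ^ (2 * a)) :=
          add_le_add b2 (b3.trans (by gcongr))
      _ = (2 + (D + 1) * h ^ a) * (ρ ^ n * K * (|t - s| / 2) ^ (2 * a)) := by ring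
      _ ≤ ρ * (ρ ^ n * K) * |t - s| ^ (2 * a) :=
          H.half_contr hw (mul_nonneg (pow_nonneg H.ρ_nonneg _) H.K_nonneg)
      _ = _ := by ring

end StepSize

end Sewing

end YoungFlow

namespace YoungFlow

/-! ### The limit flow: cocycle law, inverses, uniqueness. -/

section SewingLimit

variable {E : Type*} [NormedAddCommGroup E]

/-- The uniform limit `Φ` of the dyadic Euler schemes of `v`, on time intervals of length at
most `h`. -/
structure DyadicLimit (a D K ρ h : ℝ) (v Φ : ℝ → ℝ → E → E) : Prop extends
    StepSize a D K ρ h, AdditiveField a D v where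
  near : ∀ {s t}, |t - s| ≤ h → ∀ y, ‖Φ t s y - y - v t s y‖ ≤ K * |t - s| ^ (2 * a)
  near₂ : ∀ {s t}, |t - s| ≤ h → ∀ y y',
    ‖(Φ t s y - y - v t s y) - (Φ t s y' - y' - v t s y')‖ ≤ K * |t - s| ^ (2 * a) * ‖y - y'‖
  mid : ∀ {s t}, |t - s| ≤ h → ∀ y, Φ t s y = Φ t ((s + t) / 2) (Φ ((s + t) / 2) s y)
  contOn : ContinuousOn (fun p : ℝ × ℝ × E => Φ p.1 p.2.1 p.2.2) {p | |p.1 - p.2.1| ≤ h}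
  approx : ∀ {s t}, |t - s| ≤ h → ∀ n y,
    ‖dyadicFlow v n t s y - Φ t s y‖ ≤ K * h ^ (2 * a) * ρ ^ n / (1 - ρ)

theorem continuous_dyadicFlow {v : ℝ → ℝ → E → E}
    (hv : Continuous fun p : ℝ × ℝ × E => v p.1 p.2.1 p.2.2) (n : ℕ) :
    Continuous fun p : ℝ × ℝ × E => dyadicFlow v n p.1 p.2.1 p.2.2 := by
  induction n with
  | zero => exact (continuous_snd.comp continuous_snd).add hv
  | succ n ih =>
    have h1 : Continuous fun p : ℝ × ℝ × E =>
        dyadicFlow v n ((p.2.1 + p.1) / 2) p.2.1 p.2.2 :=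
      ih.comp (f := fun p : ℝ × ℝ × E => ((p.2.1 + p.1) / 2, p.2.1, p.2.2)) (by fun_prop)
    exact ih.comp (f := fun p : ℝ × ℝ × E => (p.1, (p.2.1 + p.1) / 2,
      dyadicFlow v n ((p.2.1 + p.1) / 2) p.2.1 p.2.2)) (by fun_prop)

theorem exists_dyadicLimit [CompleteSpace E] {a D K ρ h : ℝ} {v : ℝ → ℝ → E → E}
    (H : StepSize a D K ρ h) (hv : AdditiveField a D v) :
    ∃ Φ, DyadicLimit a D K ρ h v Φ := by
  have hgeo : ∀ {s t}, |t - s| ≤ h → ∀ y n,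
      dist (dyadicFlow v n t s y) (dyadicFlow v (n + 1) t s y) ≤ K * h ^ (2 * a) * ρ ^ n := by
    intro s t hst y n
    rw [dist_comm, dist_eq_norm]
    refine (H.norm_dyadicFlow_succ_sub_le hv n hst y).trans ?_
    have := Real.rpow_le_rpow (abs_nonneg _) hst (by linarith [H.a_pos] : (0 : ℝ) ≤ 2 * a)
    have := pow_nonneg H.ρ_nonneg n
    have := H.K_nonneg
    calc _ ≤ ρ ^ n * K * h ^ (2 * a) := by gcongr
      _ = _ := by ring
  have hex : ∀ t s y, ∃ z, |t - s| ≤ h → Tendsto (fun n => dyadicFlow v n t s y) atTop (𝓝 z) := by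
    intro t s y
    by_cases hst : |t - s| ≤ h
    · obtain ⟨z, hz⟩ := cauchySeq_tendsto_of_complete
        (cauchySeq_of_le_geometric ρ _ H.ρ_lt (hgeo hst y))
      exact ⟨z, fun _ => hz⟩
    · exact ⟨0, fun h => absurd h hst⟩
  choose Φ hΦ using hex
  have happ : ∀ {s t}, |t - s| ≤ h → ∀ n y,
      ‖dyadicFlow v n t s y - Φ t s y‖ ≤ K * h ^ (2 * a) * ρ ^ n / (1 - ρ) := by
    intro s t hst n y
    rw [← dist_eq_norm]
    exact dist_le_of_le_geometric_of_tendsto ρ _ H.ρ_lt (hgeo hst y) (hΦ t s y hst) n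
  have hM : Tendsto (fun n : ℕ => K * h ^ (2 * a) * ρ ^ n / (1 - ρ)) atTop (𝓝 0) := by
    have := ((tendsto_pow_atTop_nhds_zero_of_lt_one H.ρ_nonneg H.ρ_lt).const_mul
      (K * h ^ (2 * a))).div_const (1 - ρ)
    simpa using this
  refine ⟨Φ, { H, hv with near := ?_, near₂ := ?_, mid := ?_, contOn := ?_, approx := happ }⟩
  · intro s t hst y
    exact le_of_tendsto (((hΦ t s y hst).sub_const _).sub_const _).norm
      (Eventually.of_forall fun n => H.norm_dyadicFlow_sub_le hv n hst y)
  · intro s t hst y y'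
    exact le_of_tendsto ((((hΦ t s y hst).sub_const _).sub_const _).sub
      (((hΦ t s y' hst).sub_const _).sub_const _)).norm
      (Eventually.of_forall fun n => H.norm_dyadicFlow_sub_sub_le hv n hst y y')
  · intro s t hst y
    have l1 : |(s + t) / 2 - s| ≤ h := by rw [abs_mid_sub]; linarith [abs_nonneg (t - s)]
    have l2 : |t - (s + t) / 2| ≤ h := by rw [abs_sub_mid]; linarith [abs_nonneg (t - s)]
    refine tendsto_nhds_unique (((tendsto_add_atTop_iff_nat 1).2 (hΦ t s y hst))) ?_
    set m := (s + t) / 2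
    have h1 : Tendsto (fun n => dyadicFlow v n t m (Φ m s y)) atTop (𝓝 (Φ t m (Φ m s y))) :=
      hΦ _ _ _ l2
    have h2 : Tendsto (fun n => dyadicFlow v n t m (dyadicFlow v n m s y) -
        dyadicFlow v n t m (Φ m s y)) atTop (𝓝 0) := by
      refine squeeze_zero_norm (fun n => H.norm_lip_le hv l2
        (H.norm_dyadicFlow_sub_sub_le hv n l2 _ _)) ?_
      have := ((hΦ m s y l1).sub_const (Φ m s y)).norm.const_mul (1 + (D + 1) * h ^ a)
      simpa using this
    have h3 := h2.add h1
    simp only [sub_add_cancel, zero_add] at h3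
    exact h3
  · refine TendstoUniformlyOn.continuousOn
      (F := fun n p => dyadicFlow v n p.1 p.2.1 p.2.2) (p := atTop) ?_
      (Eventually.of_forall fun n => (continuous_dyadicFlow hv.cont n).continuousOn).frequently
    rw [Metric.tendstoUniformlyOn_iff]
    intro ε hε
    filter_upwards [hM.eventually_lt_const hε] with n hn p hp
    rw [dist_comm, dist_eq_norm]
    exact (happ hp n _).trans_lt hn

/-- The uniqueness half of sewing. An error of order `2a` that at worst adds up over the two halves,
with one Lipschitz factor, gains a factor `ρ` at each bisection and hence vanishes. The constant `C`
is arbitrary, so crude bounds suffice in the applications; all the identities for `Φ` below rest on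
this. -/
theorem StepSize.nonpos_of_midpoint {a D K ρ h : ℝ} (H : StepSize a D K ρ h) {ι : Type*}
    {S : ℝ → ℝ → Prop} {e : ℝ → ℝ → ι → ℝ} {C : ℝ} (hC : 0 ≤ C)
    (hS : ∀ {s t}, S s t → S s ((s + t) / 2) ∧ S ((s + t) / 2) t)
    (hb : ∀ {s t}, S s t → ∀ y, e s t y ≤ C * |t - s| ^ (2 * a))
    (hm : ∀ {s t}, S s t → ∀ c, 0 ≤ c → (∀ y, e s ((s + t) / 2) y ≤ c) →
      (∀ y, e ((s + t) / 2) t y ≤ c) → ∀ y, e s t y ≤ (2 + (D + 1) * h ^ a) * c)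
    {s t : ℝ} (hst : S s t) (y : ι) : e s t y ≤ 0 := by
  have key : ∀ n : ℕ, ∀ {s t}, S s t → ∀ y, e s t y ≤ ρ ^ n * C * |t - s| ^ (2 * a) := by
    intro n
    induction n with
    | zero => intro s t hst y; simpa using hb hst y
    | succ n ih =>
      intro s t hst y
      have hn : 0 ≤ ρ ^ n * C := mul_nonneg (pow_nonneg H.ρ_nonneg n) hC
      have h1 := ih (hS hst).1
      have h2 := ih (hS hst).2
      rw [abs_mid_sub] at h1
      rw [abs_sub_mid] at h2
      refine (hm hst _ (mul_nonneg hn (Real.rpow_nonneg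
        (by linarith [abs_nonneg (t - s)]) _)) h1 h2 y).trans ?_
      refine (H.half_contr (abs_nonneg _) hn).trans (le_of_eq ?_)
      ring
  refine ge_of_tendsto (x := atTop) ?_ (Eventually.of_forall fun n => key n hst y)
  have := ((tendsto_pow_atTop_nhds_zero_of_lt_one H.ρ_nonneg H.ρ_lt).mul_const C).mul_const
    (|t - s| ^ (2 * a))
  simpa using this

/-- The composition of `k` flow maps over consecutive time steps of length `w`. -/
noncomputable def equalSteps (Φ : ℝ → ℝ → E → E) (s w : ℝ) : ℕ → E → E
  | 0 => id
  | k + 1 => fun y => Φ (s + (k + 1) * w) (s + k * w) (equalSteps Φ s w k y)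

omit [NormedAddCommGroup E] in
theorem equalSteps_add (Φ : ℝ → ℝ → E → E) (s w : ℝ) (p q : ℕ) (y : E) :
    equalSteps Φ s w (p + q) y = equalSteps Φ (s + p * w) w q (equalSteps Φ s w p y) := by
  induction q with
  | zero => rfl
  | succ q ih =>
    rw [← add_assoc]
    simp only [equalSteps]
    rw [ih]
    congr 1 <;> push_cast <;> ring

namespace DyadicLimit

variable {a D K ρ h : ℝ} {v Φ : ℝ → ℝ → E → E} (H : DyadicLimit a D K ρ h v Φ)
include H

theorem norm_lip {s t : ℝ} (hst : |t - s| ≤ h) (y y' : E) :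
    ‖Φ t s y - Φ t s y'‖ ≤ (1 + (D + 1) * h ^ a) * ‖y - y'‖ :=
  H.toStepSize.norm_lip_le H.toAdditiveField hst (H.near₂ hst y y')

theorem norm_sub_self {s t : ℝ} (hst : |t - s| ≤ h) (y : E) :
    ‖Φ t s y - y‖ ≤ (D + 1) * |t - s| ^ a :=
  H.toStepSize.norm_sub_self_le H.toAdditiveField hst (H.near hst y)

theorem self (s : ℝ) (y : E) : Φ s s y = y := by
  have := H.norm_sub_self (s := s) (t := s) (by simpa using H.h_pos.le) y
  rw [sub_self, abs_zero, Real.zero_rpow H.a_pos.ne', mul_zero] at this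
  exact sub_eq_zero.1 (norm_le_zero_iff.1 this)

theorem equalSteps_double {w : ℝ} (hw : |w| ≤ h) (s : ℝ) (k : ℕ) (y : E) :
    equalSteps Φ s (w / 2) (2 * k) y = equalSteps Φ s w k y := by
  induction k with
  | zero => rfl
  | succ k ih =>
    rw [show 2 * (k + 1) = 2 * k + 1 + 1 by ring]
    simp only [equalSteps]
    rw [ih, H.mid (s := s + k * w) (t := s + (k + 1) * w) (by ring_nf; simpa using hw)]
    congr 1 <;> [skip; skip; congr 1] <;> push_cast <;> ring

/-- The constant grows with `k`, which is harmless: it only serves as the a priori bound in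
`nonpos_of_midpoint`. -/
theorem exists_norm_equalSteps_sub_le (k : ℕ) : ∃ C, 0 ≤ C ∧ ∀ s w, |w| ≤ h → ∀ y,
    ‖equalSteps Φ s w k y - y - v (s + k * w) s y‖ ≤ C * |w| ^ (2 * a) := by
  induction k with
  | zero =>
    refine ⟨0, le_rfl, fun s w _ y => ?_⟩
    have := H.norm_le s s y
    rw [sub_self, abs_zero, Real.zero_rpow H.a_pos.ne', mul_zero] at this
    simpa [equalSteps] using this
  | succ k ih =>
    obtain ⟨C, hC, hk⟩ := ih
    have hD := H.D_nonneg
    have hh := H.h_pos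
    have hK := H.K_nonneg
    refine ⟨K + C + D * (C * h ^ a + D * (k : ℝ) ^ a), by positivity, fun s w hw y => ?_⟩
    set x := equalSteps Φ s w k y with hx
    have e1 : s + (k + 1) * w - (s + k * w) = w := by ring
    have b1 := hk s w hw y
    have b2 := H.near (s := s + k * w) (t := s + (k + 1) * w) (by rwa [e1]) x
    have b3 := H.lip (s + (k + 1) * w) (s + k * w) x y
    have b4 := H.norm_le (s + k * w) s y
    rw [e1] at b2 b3
    rw [add_sub_cancel_left, abs_mul, Nat.abs_cast,
      Real.mul_rpow (Nat.cast_nonneg _) (abs_nonneg _)] at b4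
    have hwa : 0 ≤ |w| ^ a := Real.rpow_nonneg (abs_nonneg _) _
    have b5 : ‖x - y‖ ≤ (C * h ^ a + D * (k : ℝ) ^ a) * |w| ^ a := by
      calc ‖x - y‖ = ‖(x - y - v (s + k * w) s y) + v (s + k * w) s y‖ := by simp
        _ ≤ _ := norm_add_le _ _
        _ ≤ C * |w| ^ (2 * a) + D * ((k : ℝ) ^ a * |w| ^ a) := add_le_add b1 b4
        _ ≤ C * (h ^ a * |w| ^ a) + D * ((k : ℝ) ^ a * |w| ^ a) := by
            rw [rpow_two_mul' (abs_nonneg w) H.a_pos]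
            have := H.rpow_le (abs_nonneg w) hw
            gcongr
        _ = _ := by ring
    have e2 : ((k + 1 : ℕ) : ℝ) = k + 1 := by push_cast; ring
    rw [e2]
    calc ‖equalSteps Φ s w (k + 1) y - y - v (s + (k + 1) * w) s y‖
        = ‖(Φ (s + (k + 1) * w) (s + k * w) x - x - v (s + (k + 1) * w) (s + k * w) x) +
          (x - y - v (s + k * w) s y) +
          (v (s + (k + 1) * w) (s + k * w) x - v (s + (k + 1) * w) (s + k * w) y)‖ := by
          rw [H.add s (s + k * w) (s + (k + 1) * w) y]
          simp only [equalSteps, ← hx]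
          congr 1; abel
      _ ≤ _ := norm_add₃_le
      _ ≤ K * |w| ^ (2 * a) + C * |w| ^ (2 * a) +
          D * |w| ^ a * ((C * h ^ a + D * (k : ℝ) ^ a) * |w| ^ a) := by
          refine add_le_add (add_le_add b2 b1) (b3.trans (by gcongr))
      _ = _ := by rw [rpow_two_mul' (abs_nonneg w) H.a_pos]; ring

/-- By construction `Φ` only splits at midpoints. Halving each of the `k` steps gives `2k` steps,
that is `k` steps on each half of `[s, t]`, so the discrepancy with `Φ t s` satisfies the midpoint
inequality. -/
theorem equalSteps_eq_of_pos {k : ℕ} (hk : 0 < k) {s t : ℝ} (hst : |t - s| ≤ h) (y : E) :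
    equalSteps Φ s ((t - s) / k) k y = Φ t s y := by
  obtain ⟨C, hC, hCk⟩ := H.exists_norm_equalSteps_sub_le k
  have hk1 : (1 : ℝ) ≤ k := by exact_mod_cast hk
  have hk0 : (k : ℝ) ≠ 0 := by positivity
  have hdiv : ∀ w : ℝ, |w / k| ≤ |w| := fun w => by
    rw [abs_div, Nat.abs_cast]; exact div_le_self (abs_nonneg _) hk1
  refine sub_eq_zero.1 (norm_le_zero_iff.1 (H.toStepSize.nonpos_of_midpoint (ι := E)
    (S := fun s t => |t - s| ≤ h)
    (e := fun s t y => ‖equalSteps Φ s ((t - s) / k) k y - Φ t s y‖)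
    (C := C + K) (add_nonneg hC H.K_nonneg) ?_ ?_ ?_ hst y))
  · intro s t hst
    rw [abs_mid_sub, abs_sub_mid]
    constructor <;> linarith [abs_nonneg (t - s)]
  · intro s t hst y
    have b1 := hCk s ((t - s) / k) ((hdiv _).trans hst) y
    have b2 := H.near hst y
    rw [show s + k * ((t - s) / k) = t by field_simp; ring] at b1
    have b3 : |(t - s) / k| ^ (2 * a) ≤ |t - s| ^ (2 * a) :=
      Real.rpow_le_rpow (abs_nonneg _) (hdiv _) (by linarith [H.a_pos])
    calc ‖equalSteps Φ s ((t - s) / k) k y - Φ t s y‖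
        = ‖(equalSteps Φ s ((t - s) / k) k y - y - v t s y) - (Φ t s y - y - v t s y)‖ := by
          congr 1; abel
      _ ≤ _ := norm_sub_le _ _
      _ ≤ C * |t - s| ^ (2 * a) + K * |t - s| ^ (2 * a) :=
          add_le_add (b1.trans (by gcongr)) b2
      _ = _ := by ring
  · intro s t hst c hc h1 h2 y
    have l1 : |(s + t) / 2 - s| ≤ h := by rw [abs_mid_sub]; linarith [abs_nonneg (t - s)]
    have l2 : |t - (s + t) / 2| ≤ h := by rw [abs_sub_mid]; linarith [abs_nonneg (t - s)]
    rw [← H.equalSteps_double ((hdiv _).trans hst), two_mul, equalSteps_add, H.mid hst]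
    rw [show s + k * ((t - s) / k / 2) = (s + t) / 2 by field_simp; ring,
      show (t - s) / k / 2 = ((s + t) / 2 - s) / k by ring]
    set x := equalSteps Φ s (((s + t) / 2 - s) / k) k y with hx
    have b1 := h1 y
    rw [← hx] at b1
    have b2 := h2 x
    rw [show t - (s + t) / 2 = (s + t) / 2 - s by ring] at b2
    have b3 := H.norm_lip l2 x (Φ ((s + t) / 2) s y)
    have hD := H.D_nonneg
    have hh := H.h_pos
    calc _ ≤ _ := norm_sub_le_norm_sub_add_norm_sub _ (Φ t ((s + t) / 2) x) _
      _ ≤ c + (1 + (D + 1) * h ^ a) * c := add_le_add b2 (b3.trans (by gcongr))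
      _ = _ := by ring

theorem equalSteps_eq {k : ℕ} {s w : ℝ} (hw : |k * w| ≤ h) (y : E) :
    equalSteps Φ s w k y = Φ (s + k * w) s y := by
  rcases Nat.eq_zero_or_pos k with rfl | hk
  · simp [equalSteps, H.self]
  · have hk0 : (k : ℝ) ≠ 0 := by positivity
    rw [← H.equalSteps_eq_of_pos hk (by rwa [add_sub_cancel_left]), add_sub_cancel_left,
      mul_div_cancel_left₀ _ hk0]

/-- If `u` divides the interval in a ratio `p / k`, both sides are the composition of the same `k`
equal steps. The general ratio `x` is the limit of `⌊x k⌋ / k`, and `Φ` is continuous. -/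
theorem comp_of_mem_uIcc {s u t : ℝ} (hst : |t - s| ≤ h) (hu : u ∈ uIcc s t) (y : E) :
    Φ t u (Φ u s y) = Φ t s y := by
  rw [← segment_eq_uIcc, segment_eq_image'] at hu
  obtain ⟨x, ⟨hx0, hx1⟩, rfl⟩ := hu
  have hr : ∀ k : ℕ, 0 < k → (⌊x * k⌋₊ : ℝ) / k ∈ Icc (0 : ℝ) 1 := by
    intro k hk
    have hk0 : (0 : ℝ) < k := by positivity
    refine ⟨by positivity, ?_⟩
    rw [div_le_one hk0]
    calc (⌊x * k⌋₊ : ℝ) ≤ x * k := Nat.floor_le (by positivity)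
      _ ≤ 1 * k := by gcongr
      _ = k := one_mul _
  have hlen : ∀ r ∈ Icc (0 : ℝ) 1, |s + r * (t - s) - s| ≤ h ∧ |t - (s + r * (t - s))| ≤ h := by
    intro r hr
    rw [add_sub_cancel_left, show t - (s + r * (t - s)) = (1 - r) * (t - s) by ring,
      abs_mul, abs_mul, abs_of_nonneg hr.1, abs_of_nonneg (by linarith [hr.2] : (0 : ℝ) ≤ 1 - r)]
    have := abs_nonneg (t - s)
    constructor <;> nlinarith [hr.1, hr.2]
  have hlim : Tendsto (fun k : ℕ => s + ((⌊x * k⌋₊ : ℝ) / k) * (t - s)) atTop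
      (𝓝 (s + x * (t - s))) :=
    (((tendsto_nat_floor_mul_div_atTop hx0).comp tendsto_natCast_atTop_atTop).mul_const
      (t - s)).const_add s
  have hcont : Tendsto (fun k : ℕ => Φ t (s + ((⌊x * k⌋₊ : ℝ) / k) * (t - s))
      (Φ (s + ((⌊x * k⌋₊ : ℝ) / k) * (t - s)) s y)) atTop
      (𝓝 (Φ t (s + x * (t - s)) (Φ (s + x * (t - s)) s y))) := by
    have h1 : Tendsto (fun k : ℕ => Φ (s + ((⌊x * k⌋₊ : ℝ) / k) * (t - s)) s y) atTop
        (𝓝 (Φ (s + x * (t - s)) s y)) := by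
      refine (H.contOn (s + x * (t - s), s, y) (hlen x ⟨hx0, hx1⟩).1).tendsto.comp
        (tendsto_nhdsWithin_iff.2 ⟨hlim.prodMk_nhds (tendsto_const_nhds.prodMk_nhds
          tendsto_const_nhds), ?_⟩)
      filter_upwards [eventually_gt_atTop 0] with k hk using (hlen _ (hr k hk)).1
    refine (H.contOn (t, s + x * (t - s), Φ (s + x * (t - s)) s y)
      (hlen x ⟨hx0, hx1⟩).2).tendsto.comp
      (tendsto_nhdsWithin_iff.2 ⟨tendsto_const_nhds.prodMk_nhds (hlim.prodMk_nhds h1), ?_⟩)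
    filter_upwards [eventually_gt_atTop 0] with k hk using (hlen _ (hr k hk)).2
  refine tendsto_nhds_unique hcont (tendsto_const_nhds.congr' ?_)
  filter_upwards [eventually_gt_atTop 0] with k hk
  have hk0 : (k : ℝ) ≠ 0 := by positivity
  obtain ⟨q, hq⟩ : ∃ q, k = ⌊x * k⌋₊ + q := by
    refine Nat.exists_eq_add_of_le (Nat.floor_le_of_le ?_)
    calc x * k ≤ 1 * k := by gcongr
      _ = k := one_mul _
  have hq' : (k : ℝ) = ⌊x * k⌋₊ + q := by exact_mod_cast hq
  set p := ⌊x * k⌋₊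
  set w := (t - s) / k with hw
  have e1 : s + (p : ℝ) / k * (t - s) = s + p * w := by rw [hw]; ring
  have e2 : t = s + p * w + q * w := by
    rw [add_assoc, ← add_mul, ← hq', hw, mul_div_cancel₀ _ hk0]; ring
  have hl := hlen _ (hr k hk)
  rw [e1] at hl ⊢
  have e3 := H.equalSteps_eq (s := s) (w := w) (k := p) (by simpa using hl.1) y
  rw [← e3]
  have e4 := H.equalSteps_eq (s := s + p * w) (w := w) (k := q)
    (by rw [← add_sub_cancel_left (s + p * w) (q * w), ← e2]; exact hl.2) (equalSteps Φ s w p y)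
  rw [← e2] at e4
  rw [← e4, ← equalSteps_add, ← hq, hw, H.equalSteps_eq_of_pos hk hst]

/-- Since `v s t = -v t s`, going forth and back has an error of order `2a`. By `mid`, the round
trip over an interval is the round trip over its second half nested inside that over the first,
hence the midpoint inequality. -/
theorem leftInverse {s t : ℝ} (hst : |t - s| ≤ h) (y : E) : Φ s t (Φ t s y) = y := by
  have hD := H.D_nonneg
  have hh := H.h_pos
  have hK := H.K_nonneg
  refine sub_eq_zero.1 (norm_le_zero_iff.1 (H.toStepSize.nonpos_of_midpoint (ι := E)
    (S := fun s t => |t - s| ≤ h) (e := fun s t y => ‖Φ s t (Φ t s y) - y‖)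
    (C := 2 * K + D * (D + 1)) (by positivity) ?_ ?_ ?_ hst y))
  · intro s t hst
    rw [abs_mid_sub, abs_sub_mid]
    constructor <;> linarith [abs_nonneg (t - s)]
  · intro s t hst y
    set x := Φ t s y with hx
    have hst' : |s - t| ≤ h := by rwa [abs_sub_comm]
    have b1 := H.near hst y
    have b2 := H.near hst' x
    have b3 := H.lip s t x y
    have b4 := H.norm_sub_self hst y
    rw [← hx] at b1 b4
    rw [abs_sub_comm s t] at b2 b3
    have hz : v s t y = - v t s y := by
      have h1 := H.add s t s y
      have h2 := H.norm_le s s y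
      rw [sub_self, abs_zero, Real.zero_rpow H.a_pos.ne', mul_zero] at h2
      rw [norm_le_zero_iff.1 h2] at h1
      exact eq_neg_of_add_eq_zero_left h1.symm
    calc ‖Φ s t x - y‖
        = ‖(Φ s t x - x - v s t x) + (x - y - v t s y) + (v s t x - v s t y)‖ := by
          rw [hz]; congr 1; abel
      _ ≤ _ := norm_add₃_le
      _ ≤ K * |t - s| ^ (2 * a) + K * |t - s| ^ (2 * a) +
          D * |t - s| ^ a * ((D + 1) * |t - s| ^ a) :=
          add_le_add (add_le_add b2 b1) (b3.trans (by gcongr))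
      _ = _ := by rw [rpow_two_mul' (abs_nonneg _) H.a_pos]; ring
  · intro s t hst c hc h1 h2 y
    have l1 : |s - (s + t) / 2| ≤ h := by
      rw [abs_sub_comm, abs_mid_sub]; linarith [abs_nonneg (t - s)]
    have hst' : |s - t| ≤ h := by rwa [abs_sub_comm]
    rw [H.mid hst y, H.mid hst', add_comm t s]
    set m := (s + t) / 2
    set x := Φ m s y
    have b := H.norm_lip l1 (Φ m t (Φ t m x)) x
    calc _ ≤ _ := norm_sub_le_norm_sub_add_norm_sub _ (Φ s m x) _
      _ ≤ (1 + (D + 1) * h ^ a) * c + c :=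
          add_le_add (b.trans (mul_le_mul_of_nonneg_left (h2 x) (by positivity))) (h1 y)
      _ = _ := by ring

/-- One of the three times lies between the other two; the cases where it is not `u` reduce to the
one where it is by inverting a factor. -/
theorem comp {s u t : ℝ} (hst : |t - s| ≤ h) (hsu : |u - s| ≤ h) (hut : |t - u| ≤ h) (y : E) :
    Φ t u (Φ u s y) = Φ t s y := by
  by_cases h1 : u ∈ uIcc s t
  · exact H.comp_of_mem_uIcc hst h1 y
  by_cases h2 : t ∈ uIcc s u
  · rw [← H.comp_of_mem_uIcc hsu h2 y, H.leftInverse (by rwa [abs_sub_comm])]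
  · have h3 : s ∈ uIcc u t := by
      rw [mem_uIcc] at *
      push Not at *
      rcases le_total s u with h | h <;> rcases le_total s t with h' | h'
      · rcases le_total u t with h'' | h''
        · exact absurd h'' (not_le.2 (h1.1 h))
        · exact absurd h'' (not_le.2 (h2.1 h'))
      · exact Or.inr ⟨h', h⟩
      · exact Or.inl ⟨h, h'⟩
      · rcases le_total u t with h'' | h''
        · exact absurd h' (not_le.2 (h2.2 h''))
        · exact absurd h (not_le.2 (h1.2 h''))
    rw [← H.comp_of_mem_uIcc hut h3, H.leftInverse hsu]

/-- A path on an interval that follows the flow up to an error of order `> 1` follows it. -/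
theorem eq_of_norm_sub_le {I : Set ℝ} (hI : OrdConnected I) {x : ℝ → E} {C : ℝ} (hC : 0 ≤ C)
    (hx : ∀ s ∈ I, ∀ t ∈ I, ‖x t - Φ t s (x s)‖ ≤ C * |t - s| ^ (2 * a))
    {s t : ℝ} (hs : s ∈ I) (ht : t ∈ I) (hst : |t - s| ≤ h) : x t = Φ t s (x s) := by
  refine sub_eq_zero.1 (norm_le_zero_iff.1 (H.toStepSize.nonpos_of_midpoint (ι := Unit)
    (S := fun s t => s ∈ I ∧ t ∈ I ∧ |t - s| ≤ h) (e := fun s t _ => ‖x t - Φ t s (x s)‖)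
    hC ?_ ?_ ?_ ⟨hs, ht, hst⟩ ()))
  · rintro s t ⟨hs, ht, hst⟩
    have hm : (s + t) / 2 ∈ I := hI.uIcc_subset hs ht (by
      rw [mem_uIcc]
      rcases le_total s t with h | h
      · left; constructor <;> linarith
      · right; constructor <;> linarith)
    rw [abs_mid_sub, abs_sub_mid]
    exact ⟨⟨hs, hm, by linarith [abs_nonneg (t - s)]⟩, hm, ht, by linarith [abs_nonneg (t - s)]⟩
  · rintro s t ⟨hs, ht, -⟩ -
    exact hx s hs t ht
  · rintro s t ⟨hs, ht, hst⟩ c hc h1 h2 -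
    have l2 : |t - (s + t) / 2| ≤ h := by rw [abs_sub_mid]; linarith [abs_nonneg (t - s)]
    rw [H.mid hst]
    set m := (s + t) / 2
    have b := H.norm_lip l2 (x m) (Φ m s (x s))
    have hD := H.D_nonneg
    have hh := H.h_pos
    calc _ ≤ _ := norm_sub_le_norm_sub_add_norm_sub _ (Φ t m (x m)) _
      _ ≤ c + (1 + (D + 1) * h ^ a) * c :=
          add_le_add (h2 ()) (b.trans (mul_le_mul_of_nonneg_left (h1 ()) (by positivity)))
      _ = _ := by ring

end DyadicLimit

end SewingLimit

end YoungFlow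

namespace YoungFlow

/-! ### The flow of a compactly supported field and its derivative in the initial point. -/

section RoughFlow

variable {E F G : Type*} [NormedAddCommGroup E] [NormedSpace ℝ E]
  [NormedAddCommGroup F] [NormedSpace ℝ F] [NormedAddCommGroup G] [NormedSpace ℝ G]

/-- `W` is bounded by `B` in `C^{1,1}`, expressed by differences. -/
structure C11Bounded (B : ℝ) (W : E → G) : Prop where
  norm_le : ∀ y, ‖W y‖ ≤ B
  lip : ∀ y y', ‖W y - W y'‖ ≤ B * ‖y - y'‖
  lip₂ : ∀ y y' g, ‖(W (y + g) - W y) - (W (y' + g) - W y')‖ ≤ B * ‖g‖ * ‖y - y'‖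

omit [NormedSpace ℝ E] [NormedSpace ℝ G] in
theorem C11Bounded.mono {B B' : ℝ} {W : E → G} (h : C11Bounded B W) (hB : B ≤ B') :
    C11Bounded B' W where
  norm_le y := (h.norm_le y).trans hB
  lip y y' := (h.lip y y').trans (by gcongr)
  lip₂ y y' g := (h.lip₂ y y' g).trans (by gcongr)

omit [NormedSpace ℝ E] [NormedSpace ℝ G] in
theorem C11Bounded.nonneg {B : ℝ} {W : E → G} (h : C11Bounded B W) : 0 ≤ B :=
  (norm_nonneg _).trans (h.norm_le 0)

theorem exists_c11Bounded [FiniteDimensional ℝ E] {W : E → G} (hW : ContDiff ℝ ∞ W)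
    (hc : HasCompactSupport W) : ∃ B, C11Bounded B W := by
  obtain ⟨B₀, h₀⟩ := hc.exists_bound_of_continuous hW.continuous
  obtain ⟨B₁, h₁⟩ := hW.lipschitzWith_of_hasCompactSupport hc (by simp)
  have hW' : ContDiff ℝ ∞ (fderiv ℝ W) := hW.fderiv_right (by simp)
  obtain ⟨B₂, h₂⟩ := hW'.lipschitzWith_of_hasCompactSupport (hc.fderiv ℝ) (by simp)
  refine ⟨max B₀ (max B₁ B₂), ⟨fun y => (h₀ y).trans (le_max_left _ _), fun y y' => ?_,
    fun y y' g => ?_⟩⟩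
  · have := h₁.norm_sub_le y y'
    exact this.trans (by gcongr; exact (le_max_left _ _).trans (le_max_right _ _))
  · have hd : Differentiable ℝ W := hW.differentiable (by simp)
    have key : ‖(W (y + g) - W y) - (W (y' + g) - W y')‖ ≤ (B₂ * ‖g‖) * ‖y - y'‖ := by
      refine Convex.norm_image_sub_le_of_norm_hasFDerivWithin_le (s := univ)
        (f := fun z => W (z + g) - W z) (f' := fun z => fderiv ℝ W (z + g) - fderiv ℝ W z)
        (fun z _ => ?_) (fun z _ => ?_) convex_univ (mem_univ _) (mem_univ _)
      · exact (((hasFDerivAt_comp_add_right g).2 (hd (z + g)).hasFDerivAt).sub (hd z).hasFDerivAt).hasFDerivWithinAt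
      · simpa using h₂.norm_sub_le (z + g) z
    exact key.trans (by gcongr; exact (le_max_right _ _).trans (le_max_right _ _))

/-- The field that drives a solution of `dy = V(y) dZ` together with a tangent vector, the latter
truncated by `ψ`. -/
noncomputable def tangentField (V : E → F →L[ℝ] E) (ψ : E → E) (p : E × E) : F →L[ℝ] E × E :=
  (V p.1).prod (fderiv ℝ V p.1 (ψ p.2))

theorem C11Bounded.prod {B : ℝ} {V : E → F →L[ℝ] E} {W : E × E → F →L[ℝ] E}
    (hV : C11Bounded B V) (hW : C11Bounded B W) :
    C11Bounded B (fun p : E × E => (V p.1).prod (W p)) := by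
  have hB := hV.nonneg
  have hsub : ∀ L L' M M' : F →L[ℝ] E, L.prod L' - M.prod M' = (L - M).prod (L' - M') :=
    fun _ _ _ _ => rfl
  refine ⟨fun y => ?_, fun y y' => ?_, fun y y' g => ?_⟩
  · rw [ContinuousLinearMap.opNorm_prod]
    exact max_le (hV.norm_le _) (hW.norm_le _)
  · rw [hsub, ContinuousLinearMap.opNorm_prod]
    refine max_le ((hV.lip y.1 y'.1).trans ?_) (hW.lip y y')
    exact mul_le_mul_of_nonneg_left (norm_fst_le (y - y')) hB
  · rw [hsub, hsub, hsub, ContinuousLinearMap.opNorm_prod]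
    refine max_le ((hV.lip₂ y.1 y'.1 g.1).trans ?_) (hW.lip₂ y y' g)
    exact mul_le_mul (mul_le_mul_of_nonneg_left (norm_fst_le g) hB) (norm_fst_le (y - y'))
      (norm_nonneg _) (by positivity)

/-- The linearised field `DV(y) w` grows linearly in `w` and would have no global `C^{1,1}` bound;
truncating `w` by `ψ` makes it compactly supported in `(y, w)`. -/
theorem exists_c11Bounded_tangentField [FiniteDimensional ℝ E] {V : E → F →L[ℝ] E}
    (hV : ContDiff ℝ ∞ V) (hc : HasCompactSupport V) {ψ : E → E} (hψ : ContDiff ℝ ∞ ψ)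
    (hψc : HasCompactSupport ψ) : ∃ B, C11Bounded B V ∧ C11Bounded B (tangentField V ψ) := by
  obtain ⟨B₁, h₁⟩ := exists_c11Bounded hV hc
  have hW : ContDiff ℝ ∞ (fun p : E × E => fderiv ℝ V p.1 (ψ p.2)) :=
    ((hV.fderiv_right (m := ∞) (by simp)).comp contDiff_fst).clm_apply (hψ.comp contDiff_snd)
  have hWc : HasCompactSupport (fun p : E × E => fderiv ℝ V p.1 (ψ p.2)) := by
    refine HasCompactSupport.intro (hc.isCompact.prod hψc.isCompact) (fun p hp => ?_)
    by_cases h : p.1 ∈ tsupport V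
    · have : p.2 ∉ tsupport ψ := fun h' => hp ⟨h, h'⟩
      rw [image_eq_zero_of_notMem_tsupport this, map_zero]
    · have h' : p.1 ∉ tsupport (fderiv ℝ V) := fun h' => h (tsupport_fderiv_subset ℝ h')
      rw [image_eq_zero_of_notMem_tsupport h', zero_apply]
  obtain ⟨B₂, h₂⟩ := exists_c11Bounded hW hWc
  have g₁ := h₁.mono (le_max_left B₁ B₂)
  have g₂ := h₂.mono (le_max_right B₁ B₂)
  exact ⟨max B₁ B₂, g₁, g₁.prod g₂⟩

theorem C11Bounded.additiveField {B K a : ℝ} (ha : 0 < a) {V : E → F →L[ℝ] E}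
    (hV : C11Bounded B V) {Z : ℝ → F} (hZ : ∀ s t, ‖Z t - Z s‖ ≤ K * |t - s| ^ a) :
    AdditiveField a (B * K) (fun t s y => V y (Z t - Z s)) := by
  have hB := hV.nonneg
  have hZc : Continuous Z := by
    rw [continuous_iff_continuousAt]
    intro s
    rw [ContinuousAt, tendsto_iff_norm_sub_tendsto_zero]
    refine squeeze_zero (fun _ => norm_nonneg _) (fun t => hZ s t) ?_
    have : ContinuousAt (fun t : ℝ => K * |t - s| ^ a) s := by
      refine continuousAt_const.mul (ContinuousAt.rpow_const (by fun_prop) (Or.inr ha.le))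
    simpa [Real.zero_rpow ha.ne'] using this.tendsto
  have hVc : Continuous V := by
    have : LipschitzWith (Real.toNNReal B) V := LipschitzWith.of_dist_le_mul fun y y' => by
      rw [dist_eq_norm, dist_eq_norm, Real.coe_toNNReal _ hB]; exact hV.lip y y'
    exact this.continuous
  refine ⟨fun s u t y => ?_, fun t s y => ?_, fun t s y y' => ?_, fun t s y y' g => ?_, ?_⟩
  · rw [← map_add, sub_add_sub_cancel]
  · calc _ ≤ ‖V y‖ * ‖Z t - Z s‖ := (V y).le_opNorm _
      _ ≤ B * (K * |t - s| ^ a) := mul_le_mul (hV.norm_le y) (hZ s t) (norm_nonneg _) hB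
      _ = _ := by ring
  · rw [← sub_apply]
    calc _ ≤ ‖V y - V y'‖ * ‖Z t - Z s‖ := ContinuousLinearMap.le_opNorm _ _
      _ ≤ (B * ‖y - y'‖) * (K * |t - s| ^ a) :=
        mul_le_mul (hV.lip y y') (hZ s t) (norm_nonneg _) (by positivity)
      _ = _ := by ring
  · simp only [← sub_apply]
    calc _ ≤ ‖(V (y + g) - V y) - (V (y' + g) - V y')‖ * ‖Z t - Z s‖ :=
          ContinuousLinearMap.le_opNorm _ _
      _ ≤ (B * ‖g‖ * ‖y - y'‖) * (K * |t - s| ^ a) :=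
        mul_le_mul (hV.lip₂ y y' g) (hZ s t) (norm_nonneg _) (by positivity)
      _ = _ := by ring
  · fun_prop

/-- The Euler scheme of the tangent field computes the derivative of the Euler scheme. -/
theorem hasFDerivAt_dyadicFlow {a D K ρ h c : ℝ} (H : StepSize a D K ρ h)
    {V : E → F →L[ℝ] E} (hV : Differentiable ℝ V) {ψ : E → E} (hψ : ∀ w, ‖w‖ ≤ 2 → ψ w = w)
    {Z : ℝ → F} (hc0 : 0 ≤ c)
    (hv : AdditiveField a D (fun t s y => tangentField V ψ y (Z t - Z s)))
    (hc : (D + 1) * (1 / 2 : ℝ) ^ a ≤ c * (1 - (1 / 2 : ℝ) ^ a)) (n : ℕ) :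
    ∀ {s t : ℝ}, |t - s| ≤ h → ∀ y, ∃ L : E →L[ℝ] E,
      HasFDerivAt (dyadicFlow (fun t s y => V y (Z t - Z s)) n t s) L y ∧
      ∀ w, ‖w‖ ≤ 2 - c * |t - s| ^ a →
        dyadicFlow (fun t s y => tangentField V ψ y (Z t - Z s)) n t s (y, w) =
          (dyadicFlow (fun t s y => V y (Z t - Z s)) n t s y, L w) := by
  induction n with
  | zero =>
    intro s t _ y
    refine ⟨ContinuousLinearMap.id ℝ E +
      (ContinuousLinearMap.apply ℝ E (Z t - Z s)).comp (fderiv ℝ V y), ?_, fun w hw => ?_⟩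
    · exact (hasFDerivAt_id y).add
        ((ContinuousLinearMap.apply ℝ E (Z t - Z s)).hasFDerivAt.comp y (hV y).hasFDerivAt)
    · have h1 : 0 ≤ c * |t - s| ^ a := mul_nonneg hc0 (Real.rpow_nonneg (abs_nonneg _) _)
      simp [dyadicFlow, tangentField, hψ w (by linarith)]
  | succ n ih =>
    intro s t hst y
    have hw := abs_nonneg (t - s)
    have e1 := abs_mid_sub s t
    have e2 := abs_sub_mid s t
    have l1 : |(s + t) / 2 - s| ≤ h := by rw [e1]; linarith
    have l2 : |t - (s + t) / 2| ≤ h := by rw [e2]; linarith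
    simp only [dyadicFlow]
    set m := (s + t) / 2
    obtain ⟨L₁, hL₁, hw₁⟩ := ih l1 y
    obtain ⟨L₂, hL₂, hw₂⟩ := ih l2 (dyadicFlow (fun t s y => V y (Z t - Z s)) n m s y)
    refine ⟨L₂.comp L₁, hL₂.comp y hL₁, fun w hw' => ?_⟩
    have hp : 0 ≤ |t - s| ^ a := Real.rpow_nonneg hw _
    have hhalf : (1 / 2 : ℝ) ^ a ≤ 1 :=
      Real.rpow_le_one (by norm_num) (by norm_num) H.a_pos.le
    have k1 : ‖w‖ ≤ 2 - c * |m - s| ^ a := by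
      rw [e1, half_rpow hw]
      have : c * ((1 / 2 : ℝ) ^ a * |t - s| ^ a) ≤ c * |t - s| ^ a := by
        gcongr; nlinarith
      linarith
    -- The first half may lengthen `w` by `(D + 1) (|t - s| / 2) ^ a`. The condition on `c` says
    -- that the allowance `c |t - s| ^ a` pays for this and leaves `c (|t - s| / 2) ^ a` for the
    -- second half, so vectors stay where `ψ` is the identity.
    have k2 : ‖L₁ w‖ ≤ 2 - c * |t - m| ^ a := by
      have b := H.norm_sub_self_le hv l1 (H.norm_dyadicFlow_sub_le hv n l1 (y, w))
      rw [hw₁ w k1] at b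
      have b' := (norm_snd_le _).trans b
      simp only [Prod.snd_sub] at b'
      rw [e1, half_rpow hw] at b'
      rw [e2, half_rpow hw]
      have b3 : ‖L₁ w‖ ≤ ‖L₁ w - w‖ + ‖w‖ := by
        simpa using norm_add_le (L₁ w - w) w
      have b4 := mul_le_mul_of_nonneg_right hc hp
      linarith
    rw [hw₁ w k1, hw₂ _ k2]
    rfl

/-- `Φ` is the flow of the Young differential equation `dy = V(y) dZ` over times at most `h`
apart (in either order), and `A` is its derivative in the initial condition. -/
structure RoughFlow (a C h : ℝ) (Z : ℝ → F) (V : E → F →L[ℝ] E) (Φ : ℝ → ℝ → E → E)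
    (A : ℝ → ℝ → E → E →L[ℝ] E) : Prop where
  half_lt : 1 / 2 < a
  C_nonneg : 0 ≤ C
  h_pos : 0 < h
  comp : ∀ {s u t}, |t - s| ≤ h → |u - s| ≤ h → |t - u| ≤ h → ∀ y, Φ t u (Φ u s y) = Φ t s y
  self : ∀ s y, Φ s s y = y
  davie : ∀ {s t}, |t - s| ≤ h → ∀ y, ‖Φ t s y - y - V y (Z t - Z s)‖ ≤ C * |t - s| ^ (2 * a)
  near : ∀ {s t}, |t - s| ≤ h → ∀ y, ‖Φ t s y - y‖ ≤ C * |t - s| ^ a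
  lip : ∀ {s t}, |t - s| ≤ h → ∀ y y', ‖Φ t s y - Φ t s y'‖ ≤ C * ‖y - y'‖
  hasFDerivAt : ∀ {s t}, |t - s| ≤ h → ∀ y, HasFDerivAt (Φ t s) (A t s y) y
  fderiv_near : ∀ {s t}, |t - s| ≤ h → ∀ y,
    ‖A t s y - ContinuousLinearMap.id ℝ E‖ ≤ C * |t - s| ^ a
  fderiv_lip : ∀ {s t}, |t - s| ≤ h → ∀ y y', ‖A t s y - A t s y'‖ ≤ C * ‖y - y'‖
  unique : ∀ {I : Set ℝ}, OrdConnected I → (∀ s ∈ I, ∀ t ∈ I, |t - s| ≤ h) →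
    ∀ {x : ℝ → E} {C' : ℝ}, 0 ≤ C' →
    (∀ s ∈ I, ∀ t ∈ I, ‖x t - x s - V (x s) (Z t - Z s)‖ ≤ C' * |t - s| ^ (2 * a)) →
    ∀ {s t}, s ∈ I → t ∈ I → x t = Φ t s (x s)

/-- On unit vectors the derivative of the `n`-th scheme is the second component of the tangent
scheme, which converges geometrically and uniformly. So the derivatives converge uniformly and the
limit map is differentiable, with derivative read off from `Ψ`. -/
theorem exists_hasFDerivAt [CompleteSpace E] {a D K ρ h c : ℝ} (H : StepSize a D K ρ h)
    {V : E → F →L[ℝ] E} (hV : Differentiable ℝ V) {ψ : E → E} (hψ : ∀ w, ‖w‖ ≤ 2 → ψ w = w)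
    {Z : ℝ → F} (hc0 : 0 ≤ c) {Φ : ℝ → ℝ → E → E} {Ψ : ℝ → ℝ → E × E → E × E}
    (hΦ : DyadicLimit a D K ρ h (fun t s y => V y (Z t - Z s)) Φ)
    (hΨ : DyadicLimit a D K ρ h (fun t s y => tangentField V ψ y (Z t - Z s)) Ψ)
    (hc : (D + 1) * (1 / 2 : ℝ) ^ a ≤ c * (1 - (1 / 2 : ℝ) ^ a)) (hch : c * h ^ a ≤ 1)
    {s t : ℝ} (hst : |t - s| ≤ h) :
    ∃ A : E → E →L[ℝ] E, ∀ y, HasFDerivAt (Φ t s) (A y) y ∧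
      ∀ w, ‖w‖ ≤ 1 → A y w = (Ψ t s (y, w)).2 := by
  have hex := fun n y => hasFDerivAt_dyadicFlow H hV hψ hc0 hΨ.toAdditiveField hc n hst y
  choose L hL hLw using hex
  have hw1 : ∀ w : E, ‖w‖ ≤ 1 → ‖w‖ ≤ 2 - c * |t - s| ^ a := by
    intro w hw
    have : c * |t - s| ^ a ≤ c * h ^ a := by
      exact mul_le_mul_of_nonneg_left (H.rpow_le (abs_nonneg _) hst) hc0
    linarith
  set M := K * h ^ (2 * a) / (1 - ρ) with hM
  have hM0 : 0 ≤ M := by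
    have := H.K_nonneg
    have := H.h_pos
    have : 0 < 1 - ρ := by linarith [H.ρ_lt]
    positivity
  have happ : ∀ n y w, ‖w‖ ≤ 1 → ‖L n y w - (Ψ t s (y, w)).2‖ ≤ M * ρ ^ n := by
    intro n y w hw
    have b := (norm_snd_le _).trans (hΨ.approx hst n (y, w))
    rw [hLw n y w (hw1 w hw)] at b
    refine b.trans (le_of_eq ?_)
    rw [hM]; ring
  have hcau : ∀ y n, dist (L n y) (L (n + 1) y) ≤ (2 * M) * ρ ^ n := by
    intro y n
    have hρn := pow_nonneg H.ρ_nonneg n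
    rw [dist_eq_norm]
    refine ContinuousLinearMap.opNorm_le_of_unit_norm (by positivity) (fun w hw => ?_)
    have b1 := happ n y w hw.le
    have b2 := happ (n + 1) y w hw.le
    have b3 : ρ ^ (n + 1) ≤ ρ ^ n := pow_le_pow_of_le_one H.ρ_nonneg H.ρ_lt.le (Nat.le_succ n)
    rw [sub_apply]
    rw [norm_sub_rev] at b2
    calc _ ≤ _ := norm_sub_le_norm_sub_add_norm_sub _ (Ψ t s (y, w)).2 _
      _ ≤ M * ρ ^ n + M * ρ ^ n := add_le_add b1 (b2.trans (by gcongr))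
      _ = _ := by ring
  choose A hA using fun y => cauchySeq_tendsto_of_complete
    (cauchySeq_of_le_geometric ρ _ H.ρ_lt (hcau y))
  have hpow : Tendsto (fun n : ℕ => ρ ^ n) atTop (𝓝 0) :=
    tendsto_pow_atTop_nhds_zero_of_lt_one H.ρ_nonneg H.ρ_lt
  refine ⟨A, fun y => ⟨?_, fun w hw => ?_⟩⟩
  · refine hasFDerivAt_of_tendstoUniformly (l := atTop) (f' := L) (g' := A)
      (f := fun n => dyadicFlow (fun t s y => V y (Z t - Z s)) n t s) ?_
      (fun n y => hL n y) (fun y => ?_) y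
    · rw [Metric.tendstoUniformly_iff]
      intro ε hε
      have : Tendsto (fun n : ℕ => (2 * M) * ρ ^ n / (1 - ρ)) atTop (𝓝 0) := by
        simpa using (hpow.const_mul (2 * M)).div_const (1 - ρ)
      filter_upwards [this.eventually_lt_const hε] with n hn y
      rw [dist_comm]
      exact (dist_le_of_le_geometric_of_tendsto ρ _ H.ρ_lt (hcau y) (hA y) n).trans_lt hn
    · rw [tendsto_iff_norm_sub_tendsto_zero]
      refine squeeze_zero (fun _ => norm_nonneg _) (fun n => hΦ.approx hst n y) ?_
      simpa using (hpow.const_mul (K * h ^ (2 * a))).div_const (1 - ρ)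
  · refine tendsto_nhds_unique (((ContinuousLinearMap.apply ℝ E w).continuous.tendsto _).comp
      (hA y)) ?_
    rw [tendsto_iff_norm_sub_tendsto_zero]
    refine squeeze_zero (fun _ => norm_nonneg _) (fun n => happ n y w hw) ?_
    simpa using hpow.const_mul M

theorem exists_roughFlow [FiniteDimensional ℝ E] {V : E → F →L[ℝ] E} (hV : ContDiff ℝ ∞ V)
    (hc : HasCompactSupport V) {a K : ℝ} (ha : 1 / 2 < a) (hK : 0 ≤ K) {Z : ℝ → F}
    (hZ : ∀ s t, ‖Z t - Z s‖ ≤ K * |t - s| ^ a) :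
    ∃ C h Φ A, RoughFlow a C h Z V Φ A := by
  have : CompleteSpace E := FiniteDimensional.complete ℝ E
  -- Unit tangent vectors grow by at most `c * h ^ a ≤ 1`, so the cut-off must equal `1` up to
  -- radius `2`; the outer radius is immaterial.
  let χ : ContDiffBump (0 : E) := ⟨2, 3, by norm_num, by norm_num⟩
  let ψ : E → E := fun w => χ w • w
  have hψ : ∀ w, ‖w‖ ≤ 2 → ψ w = w := fun w hw => by
    simp [ψ, χ.one_of_mem_closedBall (show w ∈ Metric.closedBall 0 2 by simpa using hw)]
  obtain ⟨B, hB, hB'⟩ := exists_c11Bounded_tangentField hV hc (ψ := ψ)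
    (χ.contDiff.smul contDiff_id) (χ.hasCompactSupport.smul_right)
  have ha0 : 0 < a := by linarith
  have hv := hB.additiveField ha0 hZ
  have hv' := hB'.additiveField ha0 hZ
  set D := B * K
  have hD : 0 ≤ D := mul_nonneg hB.nonneg hK
  have hhalf : (1 / 2 : ℝ) ^ a < 1 := Real.rpow_lt_one (by norm_num) (by norm_num) ha0
  set c := (D + 1) * (1 / 2 : ℝ) ^ a / (1 - (1 / 2 : ℝ) ^ a) with hcdef
  have hc0 : 0 ≤ c := by
    have : 0 < 1 - (1 / 2 : ℝ) ^ a := by linarith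
    positivity
  obtain ⟨K', ρ, h, H, hch⟩ := exists_stepSize ha hD c
  obtain ⟨Φ, hΦ⟩ := exists_dyadicLimit H hv
  obtain ⟨Ψ, hΨ⟩ := exists_dyadicLimit H hv'
  have hA : ∀ t s, ∃ A : E → E →L[ℝ] E, |t - s| ≤ h → ∀ y, HasFDerivAt (Φ t s) (A y) y ∧
      ∀ w, ‖w‖ ≤ 1 → A y w = (Ψ t s (y, w)).2 := by
    intro t s
    by_cases hst : |t - s| ≤ h
    · obtain ⟨A, hA⟩ := exists_hasFDerivAt H (hV.differentiable (by simp)) hψ hc0 hΦ hΨ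
        (by rw [hcdef, div_mul_cancel₀]; linarith) hch hst
      exact ⟨A, fun _ => hA⟩
    · exact ⟨fun _ => 0, fun h => absurd h hst⟩
  choose A hA using hA
  -- One constant serves `Φ` and its derivative: the estimates for `A` are those of the tangent flow
  -- `Ψ` restricted to unit vectors.
  set C := max K' (max (D + 1) (1 + (D + 1) * h ^ a))
  have c1 : K' ≤ C := le_max_left _ _
  have c2 : D + 1 ≤ C := (le_max_left _ _).trans (le_max_right _ _)
  have c3 : 1 + (D + 1) * h ^ a ≤ C := (le_max_right _ _).trans (le_max_right _ _)
  have hC : 0 ≤ C := H.K_nonneg.trans c1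
  refine ⟨C, h, Φ, A, ⟨ha, hC, H.h_pos, fun h1 h2 h3 y => hΦ.comp h1 h2 h3 y, hΦ.self,
    fun hst y => (hΦ.near hst y).trans (by gcongr),
    fun hst y => (hΦ.norm_sub_self hst y).trans (by gcongr),
    fun hst y y' => (hΦ.norm_lip hst y y').trans (by gcongr),
    fun hst y => (hA _ _ hst y).1, fun {s t} hst y => ?_, fun {s t} hst y y' => ?_, ?_⟩⟩
  · refine ContinuousLinearMap.opNorm_le_of_unit_norm (by positivity) (fun w hw => ?_)
    rw [sub_apply, (hA _ _ hst y).2 w hw.le, ContinuousLinearMap.id_apply]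
    exact ((norm_snd_le _).trans (hΨ.norm_sub_self hst (y, w))).trans (by gcongr)
  · refine ContinuousLinearMap.opNorm_le_of_unit_norm (by positivity) (fun w hw => ?_)
    rw [sub_apply, (hA _ _ hst y).2 w hw.le, (hA _ _ hst y').2 w hw.le]
    refine ((norm_snd_le _).trans (hΨ.norm_lip hst (y, w) (y', w))).trans ?_
    rw [Prod.mk_sub_mk, sub_self, Prod.norm_def, norm_zero, max_eq_left (norm_nonneg _)]
    gcongr
  · intro I hI hIh x C' hC' hx s t hs ht
    refine hΦ.eq_of_norm_sub_le hI (add_nonneg hC' H.K_nonneg) (fun s hs t ht => ?_) hs ht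
      (hIh s hs t ht)
    calc ‖x t - Φ t s (x s)‖
        = ‖(x t - x s - V (x s) (Z t - Z s)) -
          (Φ t s (x s) - x s - V (x s) (Z t - Z s))‖ := by congr 1; abel
      _ ≤ _ := norm_sub_le _ _
      _ ≤ C' * |t - s| ^ (2 * a) + K' * |t - s| ^ (2 * a) :=
        add_le_add (hx s hs t ht) (hΦ.near (hIh s hs t ht) _)
      _ = _ := by ring

end RoughFlow

end YoungFlow

namespace YoungFlow

/-! ### Calculus of `C^{1,1}` maps and first order expansions along paths. -/

section Calculus

open Asymptotics

variable {E F G H : Type*} [NormedAddCommGroup E] [NormedSpace ℝ E]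
  [NormedAddCommGroup F] [NormedSpace ℝ F] [NormedAddCommGroup G] [NormedSpace ℝ G]
  [NormedAddCommGroup H] [NormedSpace ℝ H]

/-- `κ` is differentiable near `c` and its derivative is Lipschitz near `c`. -/
structure C11At (κ : E → G) (c : E) : Prop where
  differentiableAt : ∀ᶠ y in 𝓝 c, DifferentiableAt ℝ κ y
  lip : (fun p : E × E => fderiv ℝ κ p.1 - fderiv ℝ κ p.2) =O[𝓝 (c, c)] fun p => p.1 - p.2

theorem C11At.congr {κ κ' : E → G} {c : E} (h : C11At κ c) (hκ : κ =ᶠ[𝓝 c] κ') : C11At κ' c := by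
  have h1 := hκ.eventuallyEq_nhds
  constructor
  · filter_upwards [h.differentiableAt, h1] with y hy hy'
    exact hy.congr_of_eventuallyEq hy'.symm
  · refine h.lip.congr' ?_ EventuallyEq.rfl
    rw [nhds_prod_eq]
    have h2 : fderiv ℝ κ =ᶠ[𝓝 c] fderiv ℝ κ' := h1.mono fun y hy => hy.fderiv_eq
    filter_upwards [prod_mem_prod h2 h2] with p hp
    rw [show _ = _ from hp.1, show _ = _ from hp.2]

theorem isBigO_clm_comp {α : Type*} {l : Filter α} {A : α → G →L[ℝ] H} {B : α → E →L[ℝ] G}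
    {f g : α → ℝ} (hA : A =O[l] f) (hB : B =O[l] g) :
    (fun x => (A x).comp (B x)) =O[l] fun x => f x * g x :=
  (IsBigO.of_bound 1 (Eventually.of_forall fun x => by
    rw [one_mul, norm_mul, norm_norm, norm_norm]
    exact (A x).opNorm_comp_le (B x))).trans (hA.norm_left.mul hB.norm_left)

theorem isBigO_clm_apply {α : Type*} {l : Filter α} {A : α → G →L[ℝ] H} {B : α → G}
    {f g : α → ℝ} (hA : A =O[l] f) (hB : B =O[l] g) :
    (fun x => A x (B x)) =O[l] fun x => f x * g x :=
  (IsBigO.of_bound 1 (Eventually.of_forall fun x => by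
    rw [one_mul, norm_mul, norm_norm, norm_norm]
    exact (A x).le_opNorm (B x))).trans (hA.norm_left.mul hB.norm_left)

theorem C11At.continuousAt_fderiv {κ : E → G} {c : E} (h : C11At κ c) :
    ContinuousAt (fderiv ℝ κ) c := by
  have h1 : Tendsto (fun y : E => (y, c)) (𝓝 c) (𝓝 (c, c)) :=
    (continuous_id.prodMk continuous_const).tendsto c
  have h2 := h.lip.comp_tendsto h1
  rw [ContinuousAt, tendsto_iff_norm_sub_tendsto_zero]
  have h3 := (h2.trans_tendsto ?_).norm
  · simpa using h3
  have : Tendsto (fun y : E => y - c) (𝓝 c) (𝓝 (c - c)) := by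
    exact (continuous_id.sub continuous_const).tendsto c
  rw [sub_self] at this
  exact this

theorem C11At.hasStrictFDerivAt {κ : E → G} {c : E} (h : C11At κ c) :
    HasStrictFDerivAt κ (fderiv ℝ κ c) c :=
  hasStrictFDerivAt_of_hasFDerivAt_of_continuousAt
    (h.differentiableAt.mono fun _ hy => hy.hasFDerivAt) h.continuousAt_fderiv

theorem C11At.continuousAt {κ : E → G} {c : E} (h : C11At κ c) : ContinuousAt κ c :=
  h.differentiableAt.self_of_nhds.continuousAt

/-- Mean value inequality on the segment, where the derivative differs from its value at `p.2` by a
multiple of `‖p.1 - p.2‖`. The square is what gives order `2a` along `a`-Hölder paths. -/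
theorem C11At.taylor {κ : E → G} {c : E} (h : C11At κ c) :
    (fun p : E × E => κ p.1 - κ p.2 - fderiv ℝ κ p.2 (p.1 - p.2)) =O[𝓝 (c, c)]
      fun p => ‖p.1 - p.2‖ ^ 2 := by
  obtain ⟨C, hC⟩ := h.lip.bound
  have h1 : ∀ᶠ p : E × E in 𝓝 (c, c), DifferentiableAt ℝ κ p.1 :=
    (continuous_fst.tendsto (c, c)).eventually h.differentiableAt
  obtain ⟨ε, hε, hball⟩ := Metric.eventually_nhds_iff_ball.1 (hC.and h1)
  rw [← ball_prod_same] at hball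
  refine IsBigO.of_bound (max C 0) ?_
  filter_upwards [Metric.ball_mem_nhds (c, c) hε] with p hp
  rw [← ball_prod_same] at hp
  have hseg : segment ℝ p.2 p.1 ⊆ Metric.ball c ε := (convex_ball c ε).segment_subset hp.2 hp.1
  have key := Convex.norm_image_sub_le_of_norm_hasFDerivWithin_le' (𝕜 := ℝ) (f := κ)
    (f' := fderiv ℝ κ) (φ := fderiv ℝ κ p.2) (s := segment ℝ p.2 p.1)
    (C := max C 0 * ‖p.1 - p.2‖) (x := p.2) (y := p.1)
    (fun z hz => (hball (z, p.2) ⟨hseg hz, hp.2⟩).2.hasFDerivAt.hasFDerivWithinAt)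
    (fun z hz => ?_) (convex_segment _ _) (left_mem_segment _ _ _) (right_mem_segment _ _ _)
  · refine key.trans (le_of_eq ?_)
    rw [norm_pow, norm_norm]; ring
  · refine (hball (z, p.2) ⟨hseg hz, hp.2⟩).1.trans ?_
    have hz' : ‖z - p.2‖ ≤ ‖p.1 - p.2‖ := by
      rw [segment_eq_image'] at hz
      obtain ⟨r, hr, rfl⟩ := hz
      simp only [add_sub_cancel_left, norm_smul, Real.norm_eq_abs, abs_of_nonneg hr.1]
      exact mul_le_of_le_one_left (norm_nonneg _) hr.2
    exact mul_le_mul (le_max_left _ _) hz' (norm_nonneg _) (le_max_right _ _)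

theorem _root_.ContDiffAt.c11At {κ : E → G} {c : E} (h : ContDiffAt ℝ ∞ κ c) : C11At κ c := by
  constructor
  · filter_upwards [(h.of_le (m := 1) (by exact_mod_cast le_top)).eventually (by decide)] with y hy
    exact hy.differentiableAt (by simp)
  · have : ContDiffAt ℝ ∞ (fderiv ℝ κ) c := h.fderiv_right (by simp)
    exact (this.hasStrictFDerivAt (by simp)).isBigO_sub

theorem C11At.comp {g : G → H} {f : E → G} {c : E} (hg : C11At g (f c)) (hf : C11At f c) :
    C11At (g ∘ f) c := by
  have hfc := hf.continuousAt
  have e1 : ∀ᶠ y in 𝓝 c, DifferentiableAt ℝ g (f y) := hfc.eventually hg.differentiableAt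
  have e2 : ∀ᶠ y in 𝓝 c, fderiv ℝ (g ∘ f) y = (fderiv ℝ g (f y)).comp (fderiv ℝ f y) := by
    filter_upwards [e1, hf.differentiableAt] with y h1 h2
    exact fderiv_comp y h1 h2
  constructor
  · filter_upwards [e1, hf.differentiableAt] with y h1 h2
    exact h1.comp y h2
  · have t1 : Tendsto (fun p : E × E => p.1) (𝓝 (c, c)) (𝓝 c) := continuous_fst.tendsto (c, c)
    have t2 : Tendsto (fun p : E × E => p.2) (𝓝 (c, c)) (𝓝 c) := continuous_snd.tendsto (c, c)
    have hff : Tendsto (fun p : E × E => (f p.1, f p.2)) (𝓝 (c, c)) (𝓝 (f c, f c)) :=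
      (hfc.tendsto.comp t1).prodMk_nhds (hfc.tendsto.comp t2)
    have b1 : (fun p : E × E => fderiv ℝ g (f p.1) - fderiv ℝ g (f p.2)) =O[𝓝 (c, c)]
        fun p => p.1 - p.2 :=
      (hg.lip.comp_tendsto hff).trans hf.hasStrictFDerivAt.isBigO_sub
    have b2 : (fun p : E × E => fderiv ℝ f p.1) =O[𝓝 (c, c)] fun _ => (1 : ℝ) :=
      (hf.continuousAt_fderiv.tendsto.comp t1).isBigO_one ℝ
    have b3 : (fun p : E × E => fderiv ℝ g (f p.2)) =O[𝓝 (c, c)] fun _ => (1 : ℝ) :=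
      ((hg.continuousAt_fderiv.tendsto.comp hfc.tendsto).comp t2).isBigO_one ℝ
    have b4 := isBigO_clm_comp b1.norm_right b2
    have b5 := isBigO_clm_comp b3 hf.lip.norm_right
    simp only [mul_one, one_mul] at b4 b5
    refine IsBigO.of_norm_right ((b4.add b5).congr' ?_ EventuallyEq.rfl)
    filter_upwards [t1.eventually e2, t2.eventually e2] with p h1 h2
    rw [h1, h2, ContinuousLinearMap.sub_comp, ContinuousLinearMap.comp_sub]
    abel

/-! ### Hölder paths and first order expansions -/

/-- `u` is `a`-Hölder on `S` near `t₀`. -/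
def IsHolderNear (a : ℝ) (S : Set ℝ) (t₀ : ℝ) (u : ℝ → E) : Prop :=
  (fun p : ℝ × ℝ => u p.1 - u p.2) =O[𝓝[S] t₀ ×ˢ 𝓝[S] t₀] fun p => |p.1 - p.2| ^ a

/-- On `S` near `t₀`, the path `u` satisfies `du = A dZ` in the sense of a first order expansion
with remainder of order `2 a`. -/
structure HasExpansion (a : ℝ) (Z : ℝ → F) (S : Set ℝ) (t₀ : ℝ) (u : ℝ → E) (A : ℝ → F →L[ℝ] E) :
    Prop where
  holder : IsHolderNear a S t₀ u
  holder' : IsHolderNear a S t₀ A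
  expand : (fun p : ℝ × ℝ => u p.1 - u p.2 - A p.2 (Z p.1 - Z p.2)) =O[𝓝[S] t₀ ×ˢ 𝓝[S] t₀]
    fun p => |p.1 - p.2| ^ (2 * a)

variable {a : ℝ} {S : Set ℝ} {t₀ : ℝ}

theorem tendsto_rpow_abs_sub (ha : 0 < a) :
    Tendsto (fun p : ℝ × ℝ => |p.1 - p.2| ^ a) (𝓝[S] t₀ ×ˢ 𝓝[S] t₀) (𝓝 0) := by
  have h : ContinuousAt (fun p : ℝ × ℝ => |p.1 - p.2| ^ a) (t₀, t₀) :=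
    ContinuousAt.rpow_const (by fun_prop) (Or.inr ha.le)
  have h' := h.tendsto
  simp only [sub_self, abs_zero, Real.zero_rpow ha.ne', nhds_prod_eq] at h'
  exact h'.mono_left (prod_mono nhdsWithin_le_nhds nhdsWithin_le_nhds)

theorem rpow_two_mul_eq (ha : 0 < a) : (fun p : ℝ × ℝ => |p.1 - p.2| ^ (2 * a)) =
    fun p => |p.1 - p.2| ^ a * |p.1 - p.2| ^ a :=
  funext fun _ => rpow_two_mul' (abs_nonneg _) ha

theorem isBigO_rpow_two_mul (ha : 0 < a) : (fun p : ℝ × ℝ => |p.1 - p.2| ^ (2 * a))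
    =O[𝓝[S] t₀ ×ˢ 𝓝[S] t₀] fun p => |p.1 - p.2| ^ a := by
  rw [rpow_two_mul_eq ha]
  simpa using ((tendsto_rpow_abs_sub (S := S) (t₀ := t₀) ha).isBigO_one ℝ).mul
    (isBigO_refl (fun p : ℝ × ℝ => |p.1 - p.2| ^ a) _)

namespace IsHolderNear

variable {u : ℝ → E}

omit [NormedSpace ℝ E] in
theorem congr {u' : ℝ → E} (h : IsHolderNear a S t₀ u) (hu : u =ᶠ[𝓝[S] t₀] u') :
    IsHolderNear a S t₀ u' := by
  refine IsBigO.congr' h ?_ EventuallyEq.rfl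
  filter_upwards [prod_mem_prod hu hu] with p hp
  rw [show _ = _ from hp.1, show _ = _ from hp.2]

omit [NormedSpace ℝ E] in
theorem const (c : E) : IsHolderNear a S t₀ fun _ => c := by
  simp only [IsHolderNear, sub_self]
  exact isBigO_zero _ _

omit [NormedSpace ℝ E] in
theorem tendsto (h : IsHolderNear a S t₀ u) (ha : 0 < a) (ht₀ : t₀ ∈ S) :
    Tendsto u (𝓝[S] t₀) (𝓝 (u t₀)) := by
  have h1 : Tendsto (fun t => (t, t₀)) (𝓝[S] t₀) (𝓝[S] t₀ ×ˢ 𝓝[S] t₀) :=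
    tendsto_id.prodMk (tendsto_const_pure.mono_right (pure_le_nhdsWithin ht₀))
  have h2 : Tendsto (fun t => u t - u t₀) (𝓝[S] t₀) (𝓝 0) :=
    (IsBigO.trans_tendsto h (tendsto_rpow_abs_sub ha)).comp h1
  simpa using h2.add_const (u t₀)

theorem tendsto_prod (h : IsHolderNear a S t₀ u) (ha : 0 < a) (ht₀ : t₀ ∈ S) :
    Tendsto (fun p : ℝ × ℝ => (u p.1, u p.2)) (𝓝[S] t₀ ×ˢ 𝓝[S] t₀) (𝓝 (u t₀, u t₀)) := by
  rw [nhds_prod_eq]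
  exact (h.tendsto ha ht₀).prodMap (h.tendsto ha ht₀)

theorem isBigO_one_fst (h : IsHolderNear a S t₀ u) (ha : 0 < a) (ht₀ : t₀ ∈ S) :
    (fun p : ℝ × ℝ => u p.1) =O[𝓝[S] t₀ ×ˢ 𝓝[S] t₀] fun _ => (1 : ℝ) :=
  ((h.tendsto ha ht₀).comp tendsto_fst).isBigO_one ℝ

theorem isBigO_one_snd (h : IsHolderNear a S t₀ u) (ha : 0 < a) (ht₀ : t₀ ∈ S) :
    (fun p : ℝ × ℝ => u p.2) =O[𝓝[S] t₀ ×ˢ 𝓝[S] t₀] fun _ => (1 : ℝ) :=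
  ((h.tendsto ha ht₀).comp tendsto_snd).isBigO_one ℝ

omit [NormedSpace ℝ G] in
theorem comp_of_isBigO {κ : E → G} (h : IsHolderNear a S t₀ u) (ha : 0 < a) (ht₀ : t₀ ∈ S)
    (hκ : (fun p : E × E => κ p.1 - κ p.2) =O[𝓝 (u t₀, u t₀)] fun p => p.1 - p.2) :
    IsHolderNear a S t₀ fun t => κ (u t) :=
  (hκ.comp_tendsto (h.tendsto_prod ha ht₀)).trans h

theorem comp_contDiffAt {κ : E → G} (h : IsHolderNear a S t₀ u) (ha : 0 < a) (ht₀ : t₀ ∈ S)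
    (hκ : ContDiffAt ℝ 1 κ (u t₀)) : IsHolderNear a S t₀ fun t => κ (u t) :=
  h.comp_of_isBigO ha ht₀ (hκ.hasStrictFDerivAt (by simp)).isBigO_sub

omit [NormedSpace ℝ E] in
theorem neg (h : IsHolderNear a S t₀ u) : IsHolderNear a S t₀ fun t => -u t := by
  refine (IsBigO.neg_left h).congr_left fun p => ?_
  rw [neg_sub, neg_sub_neg]

theorem clm_comp {A : ℝ → G →L[ℝ] H} {B : ℝ → E →L[ℝ] G} (hA : IsHolderNear a S t₀ A)
    (hB : IsHolderNear a S t₀ B) (ha : 0 < a) (ht₀ : t₀ ∈ S) :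
    IsHolderNear a S t₀ fun t => (A t).comp (B t) := by
  have b₁ := isBigO_clm_comp (f := fun p : ℝ × ℝ => |p.1 - p.2| ^ a) hA
    (hB.isBigO_one_fst ha ht₀)
  have b₂ := isBigO_clm_comp (g := fun p : ℝ × ℝ => |p.1 - p.2| ^ a)
    (hA.isBigO_one_snd ha ht₀) hB
  simp only [mul_one, one_mul] at b₁ b₂
  refine (b₁.add b₂).congr_left fun p => ?_
  rw [ContinuousLinearMap.sub_comp, ContinuousLinearMap.comp_sub]
  abel

theorem inverse [CompleteSpace E] {A : ℝ → E →L[ℝ] G} (hA : IsHolderNear a S t₀ A) (ha : 0 < a)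
    (ht₀ : t₀ ∈ S) (hinv : (A t₀).IsInvertible) : IsHolderNear a S t₀ fun t => (A t).inverse := by
  obtain ⟨e, he⟩ := hinv
  refine hA.comp_contDiffAt ha ht₀ ?_
  rw [← he]
  exact contDiffAt_map_inverse e

end IsHolderNear

theorem HasExpansion.congr {Z : ℝ → F} {u u' : ℝ → E} {A A' : ℝ → F →L[ℝ] E}
    (h : HasExpansion a Z S t₀ u A) (hu : u =ᶠ[𝓝[S] t₀] u') (hA : A =ᶠ[𝓝[S] t₀] A') :
    HasExpansion a Z S t₀ u' A' := by
  refine ⟨h.holder.congr hu, h.holder'.congr hA, h.expand.congr' ?_ EventuallyEq.rfl⟩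
  filter_upwards [prod_mem_prod hu (hu.and hA)] with p hp
  rw [show _ = _ from hp.1, show _ = _ from hp.2.1, show _ = _ from hp.2.2]

/-- Chain rule for `C^{1,1}` maps. -/
theorem HasExpansion.comp_c11At {Z : ℝ → F} {u : ℝ → E} {A : ℝ → F →L[ℝ] E}
    (h : HasExpansion a Z S t₀ u A) (ha : 0 < a) (ht₀ : t₀ ∈ S) {κ : E → G}
    (hκ : C11At κ (u t₀)) :
    HasExpansion a Z S t₀ (fun t => κ (u t)) (fun t => (fderiv ℝ κ (u t)).comp (A t)) := by
  have hd : IsHolderNear a S t₀ fun t => fderiv ℝ κ (u t) :=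
    h.holder.comp_of_isBigO ha ht₀ hκ.lip
  refine ⟨h.holder.comp_of_isBigO ha ht₀ hκ.hasStrictFDerivAt.isBigO_sub,
    hd.clm_comp h.holder' ha ht₀, ?_⟩
  have b1 := (hκ.taylor.comp_tendsto (h.holder.tendsto_prod ha ht₀)).trans
    (h.holder.norm_left.pow 2)
  have b2 := isBigO_clm_apply (hd.isBigO_one_snd ha ht₀) h.expand
  simp only [one_mul] at b2
  have e : (fun p : ℝ × ℝ => (|p.1 - p.2| ^ a) ^ 2) = fun p => |p.1 - p.2| ^ (2 * a) := by
    rw [rpow_two_mul_eq ha]; exact funext fun p => sq _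
  rw [e] at b1
  refine (b1.add b2).congr_left fun p => ?_
  simp only [Function.comp_apply, map_sub, ContinuousLinearMap.comp_apply]
  abel

end Calculus
end YoungFlow

namespace YoungFlow

/-! ### Paths with an expansion along `V` are orbits of the flow, and conversely. -/

section FlowExpansion

open Asymptotics

variable {E F : Type*} [NormedAddCommGroup E] [NormedSpace ℝ E]
  [NormedAddCommGroup F] [NormedSpace ℝ F]

theorem eventually_nhdsWithin_prod_self {S : Set ℝ} {t₀ : ℝ} {P : ℝ × ℝ → Prop} :
    (∀ᶠ p in 𝓝[S] t₀ ×ˢ 𝓝[S] t₀, P p) ↔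
      ∃ ε > 0, ∀ s ∈ Metric.ball t₀ ε ∩ S, ∀ t ∈ Metric.ball t₀ ε ∩ S, P (t, s) := by
  refine (eventually_prod_self_iff (r := fun x y => P (x, y))).trans ?_
  constructor
  · rintro ⟨U, hU, h⟩
    obtain ⟨ε, hε, hb⟩ := Metric.mem_nhdsWithin_iff.1 hU
    exact ⟨ε, hε, fun s hs t ht => h t (hb ht) s (hb hs)⟩
  · rintro ⟨ε, hε, h⟩
    exact ⟨_, Metric.mem_nhdsWithin_iff.2 ⟨ε, hε, Subset.rfl⟩, fun t ht s hs => h s hs t ht⟩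

theorem eventually_abs_sub_le {S : Set ℝ} {t₀ h : ℝ} (hh : 0 < h) :
    ∀ᶠ p : ℝ × ℝ in 𝓝[S] t₀ ×ˢ 𝓝[S] t₀, |p.1 - p.2| ≤ h := by
  refine eventually_nhdsWithin_prod_self.2 ⟨h / 2, by linarith, fun s hs t ht => ?_⟩
  have h1 := Metric.mem_ball.1 hs.1
  have h2 := Metric.mem_ball.1 ht.1
  rw [← Real.dist_eq]
  linarith [dist_triangle_right t s t₀]

namespace RoughFlow

variable {a C h : ℝ} {Z : ℝ → F} {V : E → F →L[ℝ] E} {Φ : ℝ → ℝ → E → E}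
  {A : ℝ → ℝ → E → E →L[ℝ] E} (R : RoughFlow a C h Z V Φ A)
include R

theorem a_pos : 0 < a := by linarith [R.half_lt]

theorem leftInverse {s t : ℝ} (hst : |t - s| ≤ h) (y : E) : Φ s t (Φ t s y) = y := by
  rw [R.comp (by simpa using R.h_pos.le) hst (by rwa [abs_sub_comm]), R.self]

theorem fderiv_eq {s t : ℝ} (hst : |t - s| ≤ h) (y : E) : fderiv ℝ (Φ t s) y = A t s y :=
  (R.hasFDerivAt hst y).fderiv

theorem c11At {s t : ℝ} (hst : |t - s| ≤ h) (y : E) : C11At (Φ t s) y where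
  differentiableAt := Eventually.of_forall fun z => (R.hasFDerivAt hst z).differentiableAt
  lip := IsBigO.of_bound C (Eventually.of_forall fun p => by
    rw [R.fderiv_eq hst, R.fderiv_eq hst]; exact R.fderiv_lip hst _ _)

theorem fderiv_comp {s t : ℝ} (hst : |t - s| ≤ h) (y : E) :
    (A s t (Φ t s y)).comp (A t s y) = ContinuousLinearMap.id ℝ E := by
  have h1 := (R.hasFDerivAt (by rwa [abs_sub_comm] : |s - t| ≤ h) (Φ t s y)).comp y
    (R.hasFDerivAt hst y)
  have h2 : Φ s t ∘ Φ t s = id := funext fun y => R.leftInverse hst y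
  rw [h2] at h1
  exact h1.unique (hasFDerivAt_id y)

theorem eventually_eq {τ t₀ : ℝ} {u : ℝ → E}
    (hu : HasExpansion a Z (Icc 0 τ) t₀ u fun t => V (u t)) :
    ∀ᶠ p : ℝ × ℝ in 𝓝[Icc 0 τ] t₀ ×ˢ 𝓝[Icc 0 τ] t₀, u p.1 = Φ p.1 p.2 (u p.2) := by
  obtain ⟨C', hC'⟩ := hu.expand.bound
  obtain ⟨ε, hε, hb⟩ :=
    eventually_nhdsWithin_prod_self.1 (hC'.and (eventually_abs_sub_le R.h_pos))
  refine eventually_nhdsWithin_prod_self.2 ⟨ε, hε, fun s hs t ht => ?_⟩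
  refine R.unique (I := Metric.ball t₀ ε ∩ Icc 0 τ) ?_ (fun s hs t ht => (hb s hs t ht).2)
    (le_max_right C' 0) (fun s hs t ht => ?_) hs ht
  · rw [Real.ball_eq_Ioo]; exact ordConnected_Ioo.inter ordConnected_Icc
  · have h1 := (hb s hs t ht).1
    rw [Real.norm_of_nonneg (Real.rpow_nonneg (abs_nonneg _) _)] at h1
    refine h1.trans ?_
    gcongr
    exact le_max_left _ _

/-- The hypothesis only relates each time to `t₀`, whereas an expansion concerns two arbitrary
nearby times; the cocycle law of `Φ` bridges the gap. -/
theorem hasExpansion {S : Set ℝ} {t₀ : ℝ} (hV : ContDiff ℝ ∞ V) {u : ℝ → E} (ht₀ : t₀ ∈ S)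
    (hu : ∀ᶠ t in 𝓝[S] t₀, u t = Φ t t₀ (u t₀)) :
    HasExpansion a Z S t₀ u fun t => V (u t) := by
  have hh := R.h_pos
  have h1 : ∀ᶠ t in 𝓝[S] t₀, |t - t₀| ≤ h := by
    have : Metric.closedBall t₀ h ∈ 𝓝 t₀ := Metric.closedBall_mem_nhds _ R.h_pos
    filter_upwards [mem_nhdsWithin_of_mem_nhds this] with t ht
    rwa [← Real.dist_eq]
  have key : ∀ᶠ p : ℝ × ℝ in 𝓝[S] t₀ ×ˢ 𝓝[S] t₀,
      |p.1 - p.2| ≤ h ∧ u p.1 = Φ p.1 p.2 (u p.2) := by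
    filter_upwards [prod_mem_prod (hu.and h1) (hu.and h1), eventually_abs_sub_le hh] with p hp hp'
    refine ⟨hp', ?_⟩
    rw [hp.1.1, hp.2.1, R.comp hp.1.2 hp.2.2 hp']
  have hol : IsHolderNear a S t₀ u := by
    refine IsBigO.of_bound C ?_
    filter_upwards [key] with p hp
    rw [hp.2, Real.norm_of_nonneg (Real.rpow_nonneg (abs_nonneg _) _)]
    exact R.near hp.1 _
  refine ⟨hol, hol.comp_contDiffAt R.a_pos ht₀ ((hV.of_le (by simp)).contDiffAt), ?_⟩
  refine IsBigO.of_bound C ?_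
  filter_upwards [key] with p hp
  rw [hp.2, Real.norm_of_nonneg (Real.rpow_nonneg (abs_nonneg _) _)]
  exact R.davie hp.1 _

end RoughFlow

end FlowExpansion

/-! ### Young integrals against first order expansions. -/

section YoungIntegral

open Asymptotics

variable {d : ℕ} {Y : ℝ → (EuclideanSpace ℝ (Fin d) →L[ℝ] ℝ)}
  {Z : ℝ → EuclideanSpace ℝ (Fin d)} {J : ℝ → ℝ} {a K τ : ℝ}

/-- Compactness of `[0, τ]`, as for a Lebesgue number. In the induction only `s` is localised while
`t` ranges over the whole interval, so that the property passes to unions. -/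
theorem exists_uniform_expansion (h : ∀ t₀ ∈ Icc 0 τ, HasExpansion a Z (Icc 0 τ) t₀ J Y) :
    ∃ C ≥ 0, ∃ δ > 0, ∀ s ∈ Icc 0 τ, ∀ t ∈ Icc 0 τ, |t - s| < δ →
      |J t - J s - Y s (Z t - Z s)| ≤ C * |t - s| ^ (2 * a) ∧
      ‖Y t - Y s‖ ≤ C * |t - s| ^ a := by
  refine IsCompact.induction_on (p := fun U => ∃ C ≥ 0, ∃ δ > 0, ∀ s ∈ U, ∀ t ∈ Icc 0 τ,
      |t - s| < δ → |J t - J s - Y s (Z t - Z s)| ≤ C * |t - s| ^ (2 * a) ∧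
      ‖Y t - Y s‖ ≤ C * |t - s| ^ a) isCompact_Icc ?_ ?_ ?_ ?_
  · exact ⟨0, le_rfl, 1, one_pos, fun s hs => absurd hs (notMem_empty s)⟩
  · rintro U U' hU ⟨C, hC, δ, hδ, h⟩
    exact ⟨C, hC, δ, hδ, fun s hs => h s (hU hs)⟩
  · rintro U U' ⟨C, hC, δ, hδ, h⟩ ⟨C', hC', δ', hδ', h'⟩
    refine ⟨max C C', le_max_of_le_left hC, min δ δ', lt_min hδ hδ', fun s hs t ht hst => ?_⟩
    rcases hs with hs | hs
    · obtain ⟨h1, h2⟩ := h s hs t ht (hst.trans_le (min_le_left _ _))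
      exact ⟨h1.trans (by gcongr; exact le_max_left _ _),
        h2.trans (by gcongr; exact le_max_left _ _)⟩
    · obtain ⟨h1, h2⟩ := h' s hs t ht (hst.trans_le (min_le_right _ _))
      exact ⟨h1.trans (by gcongr; exact le_max_right _ _),
        h2.trans (by gcongr; exact le_max_right _ _)⟩
  · intro t₀ ht₀
    obtain ⟨C, hC⟩ := (h t₀ ht₀).expand.bound
    obtain ⟨C', hC'⟩ := IsBigO.bound (h t₀ ht₀).holder'
    obtain ⟨ε, hε, hb⟩ := eventually_nhdsWithin_prod_self.1 (hC.and hC')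
    refine ⟨Metric.ball t₀ (ε / 2) ∩ Icc 0 τ, Metric.mem_nhdsWithin_iff.2
      ⟨ε / 2, by linarith, Subset.rfl⟩, max (max C C') 0, le_max_right _ _, ε / 2, by linarith,
      fun s hs t ht hst => ?_⟩
    have hs1 := Metric.mem_ball.1 hs.1
    have ht1 : t ∈ Metric.ball t₀ ε := by
      rw [Metric.mem_ball]
      rw [← Real.dist_eq] at hst
      linarith [dist_triangle t s t₀]
    obtain ⟨h1, h2⟩ := hb s ⟨Metric.ball_subset_ball (by linarith) hs.1, hs.2⟩ t ⟨ht1, ht⟩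
    rw [Real.norm_of_nonneg (Real.rpow_nonneg (abs_nonneg _) _)] at h1 h2
    exact ⟨h1.trans (by gcongr; exact (le_max_left _ _).trans (le_max_left _ _)),
      h2.trans (by gcongr; exact (le_max_right _ _).trans (le_max_left _ _))⟩

theorem partition_le {n : ℕ} {t ξ : ℕ → ℝ} {δ : ℝ}
    (h : ∀ i < n, ξ i ∈ Icc (t i) (t (i + 1)) ∧ t (i + 1) - t i < δ) {i j : ℕ} (hij : i ≤ j)
    (hj : j ≤ n) : t i ≤ t j := by
  induction j, hij using Nat.le_induction with
  | base => exact le_rfl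
  | succ j _ ih =>
    have := (h j (by omega)).1
    exact (ih (by omega)).trans (this.1.trans this.2)

/-- A path with a first order expansion of order `> 1` is a Young integral. -/
theorem hasYoungIntegral_of_hasExpansion (ha : 1 / 2 < a) (hK : 0 ≤ K)
    (hZ : ∀ s t, ‖Z t - Z s‖ ≤ K * |t - s| ^ a)
    (h : ∀ t₀ ∈ Icc 0 τ, HasExpansion a Z (Icc 0 τ) t₀ J Y) {T : ℝ} (hT : T ∈ Icc 0 τ) :
    HasYoungIntegral Y Z 0 T (J T - J 0) := by
  obtain ⟨C, hC, δ, hδ, hb⟩ := exists_uniform_expansion h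
  intro ε hε
  -- A subinterval of length `w < x` contributes at most `C (1 + K) w ^ (2a)`, hence at most `C (1 +
  -- K) x ^ (2a - 1) w`; these bounds sum to `C (1 + K) T x ^ (2a - 1)`.
  have hlim : Tendsto (fun x : ℝ => C * (1 + K) * T * x ^ (2 * a - 1)) (𝓝[>] 0) (𝓝 0) := by
    have h0 : ContinuousAt (fun x : ℝ => C * (1 + K) * T * x ^ (2 * a - 1)) 0 :=
      continuousAt_const.mul (Real.continuousAt_rpow_const _ _ (Or.inr (by linarith)))
    have := h0.tendsto
    rw [Real.zero_rpow (by linarith), mul_zero] at this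
    exact this.mono_left nhdsWithin_le_nhds
  have hδ' : ∀ᶠ x : ℝ in 𝓝[>] 0, x < δ := mem_nhdsWithin_of_mem_nhds (Iio_mem_nhds hδ)
  obtain ⟨x, ⟨hx1, hx2⟩, hx0⟩ :=
    ((hlim.eventually_lt_const hε).and hδ' |>.and self_mem_nhdsWithin).exists
  refine ⟨x, hx0, fun n t ξ h0 hn ht => ?_⟩
  have htel : J T - J 0 = ∑ i ∈ Finset.range n, (J (t (i + 1)) - J (t i)) := by
    rw [Finset.sum_range_sub (fun i => J (t i)), h0, hn]
  have hterm : ∀ i ∈ Finset.range n,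
      |Y (ξ i) (Z (t (i + 1)) - Z (t i)) - (J (t (i + 1)) - J (t i))| ≤
        C * (1 + K) * x ^ (2 * a - 1) * (t (i + 1) - t i) := by
    intro i hi
    have hi := Finset.mem_range.1 hi
    obtain ⟨⟨hξ1, hξ2⟩, hlt⟩ := ht i hi
    have m0 : 0 ≤ t i := h0 ▸ partition_le ht (Nat.zero_le i) hi.le
    have m1 : t (i + 1) ≤ T := hn ▸ partition_le ht (Nat.succ_le_of_lt hi) le_rfl
    have hT' := hT.2
    have hw : 0 ≤ t (i + 1) - t i := by linarith
    have b1 := (hb (t i) ⟨m0, by linarith⟩ (t (i + 1)) ⟨by linarith, by linarith⟩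
      (by rw [abs_of_nonneg hw]; linarith)).1
    have b2 := (hb (t i) ⟨m0, by linarith⟩ (ξ i) ⟨by linarith, by linarith⟩
      (by rw [abs_of_nonneg (by linarith)]; linarith)).2
    have b3 := hZ (t i) (t (i + 1))
    rw [abs_of_nonneg hw] at b1 b3
    rw [abs_of_nonneg (by linarith : 0 ≤ ξ i - t i)] at b2
    have b4 : (ξ i - t i) ^ a ≤ (t (i + 1) - t i) ^ a :=
      Real.rpow_le_rpow (by linarith) (by linarith) (by linarith)
    have b5 : |(Y (ξ i) - Y (t i)) (Z (t (i + 1)) - Z (t i))| ≤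
        (C * (t (i + 1) - t i) ^ a) * (K * (t (i + 1) - t i) ^ a) := by
      rw [← Real.norm_eq_abs]
      refine (ContinuousLinearMap.le_opNorm _ _).trans ?_
      have := Real.rpow_nonneg hw a
      exact mul_le_mul (b2.trans (by gcongr)) b3 (norm_nonneg _) (by positivity)
    have b6 : (t (i + 1) - t i) ^ (2 * a) ≤ x ^ (2 * a - 1) * (t (i + 1) - t i) := by
      have e : (t (i + 1) - t i) ^ (2 * a) =
          (t (i + 1) - t i) ^ (2 * a - 1) * (t (i + 1) - t i) := by
        conv_lhs => rw [show 2 * a = (2 * a - 1) + 1 by ring]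
        rw [Real.rpow_add_of_nonneg hw (by linarith) (by norm_num), Real.rpow_one]
      rw [e]
      gcongr
      linarith
    calc _ = |(Y (ξ i) - Y (t i)) (Z (t (i + 1)) - Z (t i)) -
          (J (t (i + 1)) - J (t i) - Y (t i) (Z (t (i + 1)) - Z (t i)))| := by
          rw [sub_apply]; congr 1; ring
      _ ≤ _ := abs_sub _ _
      _ ≤ (C * (t (i + 1) - t i) ^ a) * (K * (t (i + 1) - t i) ^ a) +
          C * (t (i + 1) - t i) ^ (2 * a) := add_le_add b5 b1
      _ = C * (1 + K) * (t (i + 1) - t i) ^ (2 * a) := by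
          rw [rpow_two_mul' hw (by linarith)]; ring
      _ ≤ C * (1 + K) * (x ^ (2 * a - 1) * (t (i + 1) - t i)) := by gcongr
      _ = _ := by ring
  rw [htel, ← Finset.sum_sub_distrib]
  refine (Finset.abs_sum_le_sum_abs _ _).trans_lt ((Finset.sum_le_sum hterm).trans_lt ?_)
  rw [← Finset.mul_sum, Finset.sum_range_sub, h0, hn, sub_zero]
  linarith

/-- `R` is a Riemann-Stieltjes sum of mesh less than `δ` for `∫_s^t Y dZ`. -/
def IsRiemannSum (Y : ℝ → (EuclideanSpace ℝ (Fin d) →L[ℝ] ℝ)) (Z : ℝ → EuclideanSpace ℝ (Fin d))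
    (δ s t R : ℝ) : Prop :=
  ∃ (n : ℕ) (p ξ : ℕ → ℝ), p 0 = s ∧ p n = t ∧
    (∀ i < n, ξ i ∈ Icc (p i) (p (i + 1)) ∧ p (i + 1) - p i < δ) ∧
    R = ∑ i ∈ Finset.range n, Y (ξ i) (Z (p (i + 1)) - Z (p i))

theorem IsRiemannSum.add {δ s u t R R' : ℝ} (h : IsRiemannSum Y Z δ s u R)
    (h' : IsRiemannSum Y Z δ u t R') : IsRiemannSum Y Z δ s t (R + R') := by
  obtain ⟨n, p, ξ, p0, pn, hp, rfl⟩ := h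
  obtain ⟨n', p', ξ', p0', pn', hp', rfl⟩ := h'
  set q : ℕ → ℝ := fun i => if i < n then p i else p' (i - n) with hq
  have q1 : ∀ i ≤ n, q i = p i := by
    intro i hi
    rcases hi.lt_or_eq with hi | rfl
    · simp [hq, hi]
    · simp [hq, p0', pn]
  have q2 : ∀ i, q (n + i) = p' i := by intro i; simp [hq]
  set ζ : ℕ → ℝ := fun i => if i < n then ξ i else ξ' (i - n) with hζ
  have z1 : ∀ i < n, ζ i = ξ i := by intro i hi; simp [hζ, hi]
  have z2 : ∀ i, ζ (n + i) = ξ' i := by intro i; simp [hζ]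
  refine ⟨n + n', q, ζ, by rw [q1 0 (Nat.zero_le n), p0],
    by rw [q2, pn'], fun i hi => ?_, ?_⟩
  · by_cases hin : i < n
    · rw [q1 i hin.le, q1 (i + 1) hin, z1 i hin]
      exact hp i hin
    · obtain ⟨j, rfl⟩ := Nat.exists_eq_add_of_le (not_lt.1 hin)
      rw [add_assoc, q2, q2, z2]
      exact hp' j (by omega)
  · rw [Finset.sum_range_add]
    congr 1
    · refine Finset.sum_congr rfl fun i hi => ?_
      have hi := Finset.mem_range.1 hi
      rw [q1 i hi.le, q1 (i + 1) hi, z1 i hi]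
    · refine Finset.sum_congr rfl fun i _ => ?_
      rw [add_assoc, q2, q2, z2]

/-- The left point Riemann sum along the `2 ^ n` dyadic subintervals of `[s, t]`. -/
noncomputable def dyadicSum (Y : ℝ → (EuclideanSpace ℝ (Fin d) →L[ℝ] ℝ))
    (Z : ℝ → EuclideanSpace ℝ (Fin d)) : ℕ → ℝ → ℝ → ℝ
  | 0 => fun s t => Y s (Z t - Z s)
  | n + 1 => fun s t => dyadicSum Y Z n s ((s + t) / 2) + dyadicSum Y Z n ((s + t) / 2) t

theorem isRiemannSum_dyadicSum (n : ℕ) : ∀ {s t δ : ℝ}, s ≤ t → (t - s) / 2 ^ n < δ →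
    IsRiemannSum Y Z δ s t (dyadicSum Y Z n s t) := by
  induction n with
  | zero =>
    intro s t δ hst hδ
    refine ⟨1, fun i => if i = 0 then s else t, fun _ => s, by simp, by simp, ?_, by
      simp [dyadicSum]⟩
    intro i hi
    obtain rfl : i = 0 := by omega
    simpa [hst] using hδ
  | succ n ih =>
    intro s t δ hst hδ
    have e1 : ((s + t) / 2 - s) / 2 ^ n = (t - s) / 2 ^ (n + 1) := by rw [pow_succ]; field_simp; ring
    have e2 : (t - (s + t) / 2) / 2 ^ n = (t - s) / 2 ^ (n + 1) := by rw [pow_succ]; field_simp; ring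
    exact (ih (by linarith) (by rwa [e1])).add (ih (by linarith) (by rwa [e2]))

theorem exists_isRiemannSum_dyadicSum {s t δ : ℝ} (hst : s ≤ t) (hδ : 0 < δ) :
    ∃ n, IsRiemannSum Y Z δ s t (dyadicSum Y Z n s t) := by
  have h1 : Tendsto (fun n : ℕ => (t - s) * (1 / 2 : ℝ) ^ n) atTop (𝓝 0) := by
    simpa using (tendsto_pow_atTop_nhds_zero_of_lt_one (by norm_num : (0 : ℝ) ≤ 1 / 2)
      (by norm_num)).const_mul (t - s)
  obtain ⟨n, hn⟩ := (h1.eventually_lt_const hδ).exists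
  refine ⟨n, isRiemannSum_dyadicSum n hst ?_⟩
  rwa [one_div, inv_pow, ← div_eq_mul_inv] at hn

/-- Young's estimate, by bisection. With `q = (1/2) ^ (2a)` the induction needs `2 M q + C K q ≤ M`,
which holds for `M = C K / (1 - 2q)` because `q ≤ 1`. -/
theorem abs_dyadicSum_sub_le {I : Set ℝ} (hI : OrdConnected I) {C : ℝ} (hC : 0 ≤ C) (hK : 0 ≤ K)
    (ha : 1 / 2 < a) (hZ : ∀ s t, ‖Z t - Z s‖ ≤ K * |t - s| ^ a)
    (hY : ∀ s ∈ I, ∀ t ∈ I, ‖Y t - Y s‖ ≤ C * |t - s| ^ a) (n : ℕ) :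
    ∀ {s t : ℝ}, s ∈ I → t ∈ I → |dyadicSum Y Z n s t - Y s (Z t - Z s)| ≤
      C * K / (1 - 2 * (1 / 2 : ℝ) ^ (2 * a)) * |t - s| ^ (2 * a) := by
  have hq : (1 / 2 : ℝ) ^ (2 * a) < 1 / 2 := by
    calc (1 / 2 : ℝ) ^ (2 * a) < (1 / 2 : ℝ) ^ (1 : ℝ) :=
          Real.rpow_lt_rpow_of_exponent_gt (by norm_num) (by norm_num) (by linarith)
      _ = 1 / 2 := Real.rpow_one _
  set q := (1 / 2 : ℝ) ^ (2 * a) with hqdef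
  have hq0 : 0 ≤ q := Real.rpow_nonneg (by norm_num) _
  have hq1 : 0 < 1 - 2 * q := by linarith
  set M := C * K / (1 - 2 * q) with hM
  have hM0 : 0 ≤ M := by positivity
  have hMq : M * (1 - 2 * q) = C * K := by rw [hM, div_mul_cancel₀ _ hq1.ne']
  induction n with
  | zero =>
    intro s t _ _
    simp only [dyadicSum, sub_self, abs_zero]
    positivity
  | succ n ih =>
    intro s t hs ht
    have hm : (s + t) / 2 ∈ I := hI.uIcc_subset hs ht (by
      rw [mem_uIcc]
      rcases le_total s t with h | h
      · left; constructor <;> linarith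
      · right; constructor <;> linarith)
    have b1 := ih hs hm
    have b2 := ih hm ht
    have hw := abs_nonneg (t - s)
    have b3 := hY s hs _ hm
    have b4 := hZ ((s + t) / 2) t
    rw [abs_mid_sub] at b1 b3
    rw [abs_sub_mid] at b2 b4
    simp only [dyadicSum]
    set m := (s + t) / 2
    have b5 : |(Y m - Y s) (Z t - Z m)| ≤ (C * (|t - s| / 2) ^ a) * (K * (|t - s| / 2) ^ a) := by
      rw [← Real.norm_eq_abs]
      refine (ContinuousLinearMap.le_opNorm _ _).trans ?_
      have := Real.rpow_nonneg (by linarith : 0 ≤ |t - s| / 2) a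
      exact mul_le_mul b3 b4 (norm_nonneg _) (by positivity)
    have hp : 0 ≤ |t - s| ^ (2 * a) := Real.rpow_nonneg hw _
    calc _ = |(dyadicSum Y Z n s m - Y s (Z m - Z s)) + (dyadicSum Y Z n m t - Y m (Z t - Z m)) +
          (Y m - Y s) (Z t - Z m)| := by
          rw [sub_apply, map_sub, map_sub, map_sub, map_sub]; congr 1; ring
      _ ≤ _ := abs_add_three _ _ _
      _ ≤ M * (|t - s| / 2) ^ (2 * a) + M * (|t - s| / 2) ^ (2 * a) +
          (C * (|t - s| / 2) ^ a) * (K * (|t - s| / 2) ^ a) := add_le_add (add_le_add b1 b2) b5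
      _ = (2 * M + C * K) * (|t - s| / 2) ^ (2 * a) := by
          rw [rpow_two_mul' (by linarith : 0 ≤ |t - s| / 2) (by linarith)]; ring
      _ = (2 * M * q + C * K * q) * |t - s| ^ (2 * a) := by rw [half_rpow hw]; ring
      _ ≤ M * |t - s| ^ (2 * a) := by
          refine mul_le_mul_of_nonneg_right ?_ hp
          have : C * K * q ≤ C * K * 1 := by gcongr; linarith
          linarith

/-- A Young integral with Hölder integrand has a first order expansion. -/
theorem hasExpansion_of_hasYoungIntegral (ha : 1 / 2 < a) (hK : 0 ≤ K)
    (hZ : ∀ s t, ‖Z t - Z s‖ ≤ K * |t - s| ^ a)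
    (hJ : ∀ t ∈ Icc 0 τ, HasYoungIntegral Y Z 0 t (J t - J 0)) {t₀ : ℝ} (ht₀ : t₀ ∈ Icc 0 τ)
    (hY : IsHolderNear a (Icc 0 τ) t₀ Y) : HasExpansion a Z (Icc 0 τ) t₀ J Y := by
  have ha0 : 0 < a := by linarith
  have key : (fun p : ℝ × ℝ => J p.1 - J p.2 - Y p.2 (Z p.1 - Z p.2))
      =O[𝓝[Icc 0 τ] t₀ ×ˢ 𝓝[Icc 0 τ] t₀] fun p => |p.1 - p.2| ^ (2 * a) := by
    obtain ⟨C, hC⟩ := IsBigO.bound hY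
    obtain ⟨ε, hε, hb⟩ := eventually_nhdsWithin_prod_self.1 hC
    set I := Metric.ball t₀ ε ∩ Icc 0 τ
    have hI : OrdConnected I := by
      rw [show I = Metric.ball t₀ ε ∩ Icc 0 τ from rfl, Real.ball_eq_Ioo]
      exact ordConnected_Ioo.inter ordConnected_Icc
    have hY' : ∀ s ∈ I, ∀ t ∈ I, ‖Y t - Y s‖ ≤ max C 0 * |t - s| ^ a := by
      intro s hs t ht
      have := hb s hs t ht
      rw [Real.norm_of_nonneg (Real.rpow_nonneg (abs_nonneg _) _)] at this
      exact this.trans (by gcongr; exact le_max_left _ _)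
    have hdy := abs_dyadicSum_sub_le (Y := Y) (Z := Z) hI (le_max_right C 0) hK ha hZ hY'
    set M := max C 0 * K / (1 - 2 * (1 / 2 : ℝ) ^ (2 * a))
    have hle : ∀ s ∈ I, ∀ t ∈ I, s ≤ t →
        |J t - J s - Y s (Z t - Z s)| ≤ M * |t - s| ^ (2 * a) := by
      intro s hs t ht hst
      refine le_of_forall_pos_le_add fun η hη => ?_
      obtain ⟨δ₁, hδ₁, h₁⟩ := hJ s hs.2 (η / 2) (by linarith)
      obtain ⟨δ₂, hδ₂, h₂⟩ := hJ t ht.2 (η / 2) (by linarith)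
      obtain ⟨n₁, r₁⟩ := exists_isRiemannSum_dyadicSum (Y := Y) (Z := Z) hs.2.1
        (lt_min hδ₁ hδ₂)
      obtain ⟨n₂, r₂⟩ := exists_isRiemannSum_dyadicSum (Y := Y) (Z := Z) hst (lt_min hδ₁ hδ₂)
      -- The integral is only known from time `0`. A fine sum on `[0, s]` followed by a dyadic sum
      -- on `[s, t]` is a fine sum on `[0, t]`; subtracting shows that the dyadic sum approximates
      -- `J t - J s`.
      have r₃ := r₁.add r₂
      obtain ⟨n, p, ξ, p0, pn, hp, hR⟩ := r₁
      obtain ⟨n', p', ξ', p0', pn', hp', hR'⟩ := r₃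
      have g₁ := h₁ n p ξ p0 pn fun i hi =>
        ⟨(hp i hi).1, (hp i hi).2.trans_le (min_le_left _ _)⟩
      have g₂ := h₂ n' p' ξ' p0' pn' fun i hi =>
        ⟨(hp' i hi).1, (hp' i hi).2.trans_le (min_le_right _ _)⟩
      rw [← hR] at g₁
      rw [← hR'] at g₂
      have g₃ := hdy n₂ hs ht
      rw [abs_lt] at g₁ g₂
      rw [abs_le] at g₃ ⊢
      constructor <;> linarith
    refine IsBigO.of_bound (M + max C 0 * K) (eventually_nhdsWithin_prod_self.2
      ⟨ε, hε, fun s hs t ht => ?_⟩)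
    rw [Real.norm_of_nonneg (Real.rpow_nonneg (abs_nonneg _) _), Real.norm_eq_abs]
    have hp : 0 ≤ |t - s| ^ (2 * a) := Real.rpow_nonneg (abs_nonneg _) _
    have hCK : 0 ≤ max C 0 * K := mul_nonneg (le_max_right _ _) hK
    rcases le_total s t with hst | hst
    · refine (hle s hs t ht hst).trans ?_
      nlinarith
    -- Riemann sums only treat `s ≤ t`. Reversing the order replaces `Y t` by `Y s` at the base
    -- point, which costs `(Y t - Y s) (Z t - Z s)`, again of order `2a`.
    · have b1 := hle t ht s hs hst
      have b2 : |(Y t - Y s) (Z t - Z s)| ≤ (max C 0 * |t - s| ^ a) * (K * |t - s| ^ a) := by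
        rw [← Real.norm_eq_abs]
        exact (ContinuousLinearMap.le_opNorm _ _).trans
          (mul_le_mul (hY' s hs t ht) (hZ s t) (norm_nonneg _) (by positivity))
      rw [abs_sub_comm s t] at b1
      calc _ = |-(J s - J t - Y t (Z s - Z t)) + (Y t - Y s) (Z t - Z s)| := by
            rw [sub_apply, map_sub, map_sub, map_sub]; congr 1; ring
        _ ≤ _ := abs_add_le _ _
        _ ≤ M * |t - s| ^ (2 * a) + (max C 0 * |t - s| ^ a) * (K * |t - s| ^ a) := by
            rw [abs_neg]; exact add_le_add b1 b2
        _ = _ := by rw [rpow_two_mul' (abs_nonneg _) ha0]; ring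
  refine ⟨?_, hY, key⟩
  have hZ' : (fun p : ℝ × ℝ => Z p.1 - Z p.2) =O[𝓝[Icc 0 τ] t₀ ×ˢ 𝓝[Icc 0 τ] t₀]
      fun p => |p.1 - p.2| ^ a :=
    IsBigO.of_bound K (Eventually.of_forall fun p => by
      rw [Real.norm_of_nonneg (Real.rpow_nonneg (abs_nonneg _) _)]; exact hZ _ _)
  have b := isBigO_clm_apply (hY.isBigO_one_snd ha0 ht₀) hZ'
  simp only [one_mul] at b
  refine ((key.trans (isBigO_rpow_two_mul ha0)).add b).congr_left fun p => ?_
  ring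

end YoungIntegral

end YoungFlow

namespace YoungFlow

/-! ### Fields and derivatives read in charts. -/

section Charts

variable {m d : ℕ} {M : Type*} [TopologicalSpace M]
  [ChartedSpace (EuclideanSpace ℝ (Fin m)) M] {G : Type*} [NormedAddCommGroup G] [NormedSpace ℝ G]

/-- The derivative of a vector-valued function on `M`. -/
noncomputable def vderiv (m : ℕ) {M : Type*} [TopologicalSpace M]
    [ChartedSpace (EuclideanSpace ℝ (Fin m)) M] (f : M → G) (q : M) : TangentSpace (𝓡 m) q →L[ℝ] G :=
  mfderiv (𝓡 m) 𝓘(ℝ, G) f q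

/-- The expression in the chart at `p` of the fields `X`. -/
noncomputable def chartField
    (X : (x : M) → (EuclideanSpace ℝ (Fin d) →L[ℝ] TangentSpace (𝓡 m) x)) (p : M)
    (y : EuclideanSpace ℝ (Fin m)) : EuclideanSpace ℝ (Fin d) →L[ℝ] EuclideanSpace ℝ (Fin m) :=
  (vderiv m (extChartAt (𝓡 m) p) ((extChartAt (𝓡 m) p).symm y)).comp
    (X ((extChartAt (𝓡 m) p).symm y))

theorem chartField_extChartAt
    (X : (x : M) → (EuclideanSpace ℝ (Fin d) →L[ℝ] TangentSpace (𝓡 m) x)) {p q : M}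
    (hq : q ∈ (extChartAt (𝓡 m) p).source) :
    chartField X p (extChartAt (𝓡 m) p q) = (vderiv m (extChartAt (𝓡 m) p) q).comp (X q) := by
  rw [chartField, (extChartAt (𝓡 m) p).left_inv hq]

variable [IsManifold (𝓡 m) ∞ M]

theorem mdifferentiableAt_extChartAt' {p q : M} (hq : q ∈ (extChartAt (𝓡 m) p).source) :
    MDifferentiableAt (𝓡 m) 𝓘(ℝ, EuclideanSpace ℝ (Fin m)) (extChartAt (𝓡 m) p) q :=
  have : IsManifold (𝓡 m) 1 M := .of_le (n := ∞) (by simp)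
  mdifferentiableAt_extChartAt (I := 𝓡 m) (by rwa [← extChartAt_source (𝓡 m)])

theorem contMDiffAt_extChartAt_symm {p : M} {y : EuclideanSpace ℝ (Fin m)}
    (hy : y ∈ (extChartAt (𝓡 m) p).target) :
    ContMDiffAt 𝓘(ℝ, EuclideanSpace ℝ (Fin m)) (𝓡 m) ∞ (extChartAt (𝓡 m) p).symm y :=
  (contMDiffOn_extChartAt_symm p).contMDiffAt ((isOpen_extChartAt_target p).mem_nhds hy)

theorem isInvertible_vderiv_extChartAt {p q : M} (hq : q ∈ (extChartAt (𝓡 m) p).source) :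
    (vderiv m (extChartAt (𝓡 m) p) q).IsInvertible :=
  have : IsManifold (𝓡 m) 1 M := .of_le (n := ∞) (by simp)
  isInvertible_mfderiv_extChartAt (I := 𝓡 m) hq

theorem vderiv_eq {f : M → G} {p q : M} (hq : q ∈ (extChartAt (𝓡 m) p).source)
    (hf : MDifferentiableAt (𝓡 m) 𝓘(ℝ, G) f q) :
    vderiv m f q = (fderiv ℝ (f ∘ (extChartAt (𝓡 m) p).symm) (extChartAt (𝓡 m) p q)).comp
      (vderiv m (extChartAt (𝓡 m) p) q) := by
  have h1 : f =ᶠ[𝓝 q] (f ∘ (extChartAt (𝓡 m) p).symm) ∘ extChartAt (𝓡 m) p := by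
    filter_upwards [(isOpen_extChartAt_source p).mem_nhds hq] with z hz
    simp only [Function.comp_apply, (extChartAt (𝓡 m) p).left_inv hz]
  have h2 : MDifferentiableAt 𝓘(ℝ, EuclideanSpace ℝ (Fin m)) 𝓘(ℝ, G)
      (f ∘ (extChartAt (𝓡 m) p).symm) (extChartAt (𝓡 m) p q) := by
    refine MDifferentiableAt.comp (I' := 𝓡 m) _ ?_
      ((contMDiffAt_extChartAt_symm ((extChartAt (𝓡 m) p).map_source hq)).mdifferentiableAt
        (by simp))
    rwa [(extChartAt (𝓡 m) p).left_inv hq]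
  rw [vderiv, h1.mfderiv_eq, mfderiv_comp q h2 (mdifferentiableAt_extChartAt' hq),
    mfderiv_eq_fderiv]
  rfl

theorem contDiffAt_comp_extChartAt_symm {f : M → G} {p q : M}
    (hq : q ∈ (extChartAt (𝓡 m) p).source) (hf : ContMDiffAt (𝓡 m) 𝓘(ℝ, G) ∞ f q) :
    ContDiffAt ℝ ∞ (f ∘ (extChartAt (𝓡 m) p).symm) (extChartAt (𝓡 m) p q) := by
  rw [← contMDiffAt_iff_contDiffAt]
  refine ContMDiffAt.comp (I' := 𝓡 m) _ ?_
    (contMDiffAt_extChartAt_symm ((extChartAt (𝓡 m) p).map_source hq))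
  rwa [(extChartAt (𝓡 m) p).left_inv hq]

/-- The trivialization of the tangent bundle at `p` acts on fibres as the derivative of the chart at
`p`, so `chartField` is the fibre coordinate of the smooth section `X`. -/
theorem contDiffOn_chartField
    {X : (x : M) → (EuclideanSpace ℝ (Fin d) →L[ℝ] TangentSpace (𝓡 m) x)}
    (hX : IsSmoothFields X) (p : M) :
    ContDiffOn ℝ ∞ (chartField X p) (extChartAt (𝓡 m) p).target := by
  have : IsManifold (𝓡 m) 1 M := .of_le (n := ∞) (by simp)
  rw [contDiffOn_clm_apply]
  intro v
  set e := trivializationAt (EuclideanSpace ℝ (Fin m)) (TangentSpace (𝓡 m)) p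
  have h1 : ContMDiffOn (𝓡 m) 𝓘(ℝ, EuclideanSpace ℝ (Fin m)) ∞
      (fun x : M => (e ⟨x, X x v⟩).2) (extChartAt (𝓡 m) p).source := by
    have := (Bundle.Trivialization.contMDiffOn_section_iff (IB := 𝓡 m) (n := ∞) e (s := fun x => X x v)
      (a := (extChartAt (𝓡 m) p).source) (isOpen_extChartAt_source p) (by
        rw [extChartAt_source]; exact Subset.rfl)).1 (hX v).contMDiffOn
    exact this
  have h2 := h1.comp (contMDiffOn_extChartAt_symm (n := ∞) p)
    (fun y hy => (extChartAt (𝓡 m) p).map_target hy)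
  refine (contMDiffOn_iff_contDiffOn.1 h2).congr fun y hy => ?_
  have hq := (extChartAt (𝓡 m) p).map_target hy
  rw [extChartAt_source] at hq
  have h3 := TangentBundle.continuousLinearMapAt_trivializationAt (I := 𝓡 m) hq
  rw [chartField, vderiv, ← h3]
  change e.continuousLinearMapAt ℝ _ (X ((extChartAt (𝓡 m) p).symm y) v) = _
  rw [Bundle.Trivialization.continuousLinearMapAt_apply, e.linearMapAt_apply]
  exact if_pos hq

end Charts

end YoungFlow

namespace YoungFlow

/-! ### Solutions on the manifold as expansions in charts. -/

section Paths

open Asymptotics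

theorem isHolderNear_iff {E : Type*} [NormedAddCommGroup E] {α : ℝ≥0} {S : Set ℝ}
    {t₀ : ℝ} {u : ℝ → E} :
    IsHolderNear α S t₀ u ↔ ∃ C : ℝ≥0, ∃ U ∈ 𝓝[S] t₀, HolderOnWith C α u U := by
  constructor
  · intro h
    obtain ⟨C, hC⟩ := IsBigO.bound h
    obtain ⟨ε, hε, hb⟩ := eventually_nhdsWithin_prod_self.1 hC
    refine ⟨Real.toNNReal C, _, Metric.mem_nhdsWithin_iff.2 ⟨ε, hε, Subset.rfl⟩,
      fun t ht s hs => ?_⟩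
    have h1 := hb s hs t ht
    rw [Real.norm_of_nonneg (Real.rpow_nonneg (abs_nonneg _) _), ← dist_eq_norm,
      ← Real.dist_eq] at h1
    have h2 : nndist (u t) (u s) ≤ Real.toNNReal C * nndist t s ^ (α : ℝ) := by
      rw [← NNReal.coe_le_coe]
      push_cast
      exact h1.trans (by gcongr; exact Real.le_coe_toNNReal C)
    rw [edist_nndist, edist_nndist, ← ENNReal.coe_rpow_of_nonneg _ α.coe_nonneg]
    exact_mod_cast h2
  · rintro ⟨C, U, hU, h⟩
    refine IsBigO.of_bound C ?_
    filter_upwards [prod_mem_prod hU hU] with p hp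
    rw [Real.norm_of_nonneg (Real.rpow_nonneg (abs_nonneg _) _), ← dist_eq_norm, ← Real.dist_eq]
    exact h.dist_le hp.1 hp.2

variable {m d : ℕ} {M : Type*} [TopologicalSpace M]
  [ChartedSpace (EuclideanSpace ℝ (Fin m)) M] [IsManifold (𝓡 m) ∞ M]
  {G : Type*} [NormedAddCommGroup G] [NormedSpace ℝ G]
  {a τ t₀ : ℝ} {S : Set ℝ} {Z : ℝ → EuclideanSpace ℝ (Fin d)} {x : ℝ → M}

/-- A first order expansion in a chart yields one for every smooth function. -/
theorem HasExpansion.smooth_comp (ha : 0 < a) (ht₀ : t₀ ∈ S) (hx : ContinuousWithinAt x S t₀)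
    {W : (s : ℝ) → EuclideanSpace ℝ (Fin d) →L[ℝ] TangentSpace (𝓡 m) (x s)} {p : M}
    (hp : x t₀ ∈ (extChartAt (𝓡 m) p).source)
    (h : HasExpansion a Z S t₀ (fun s => extChartAt (𝓡 m) p (x s))
      (fun s => (vderiv m (extChartAt (𝓡 m) p) (x s)).comp (W s)))
    {f : M → G} (hf : ContMDiffAt (𝓡 m) 𝓘(ℝ, G) ∞ f (x t₀)) :
    HasExpansion a Z S t₀ (fun s => f (x s)) (fun s => (vderiv m f (x s)).comp (W s)) := by
  have : IsManifold (𝓡 m) 1 M := .of_le (n := ∞) (by simp)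
  have hsrc : ∀ᶠ s in 𝓝[S] t₀, x s ∈ (extChartAt (𝓡 m) p).source :=
    hx.eventually ((isOpen_extChartAt_source p).mem_nhds hp)
  have hfd : ∀ᶠ s in 𝓝[S] t₀, MDifferentiableAt (𝓡 m) 𝓘(ℝ, G) f (x s) :=
    (hx.eventually ((contMDiffAt_iff_contMDiffAt_nhds (n := 1) (by decide)).1
      (hf.of_le (by exact_mod_cast le_top)))).mono fun s hs => hs.mdifferentiableAt (by simp)
  refine (h.comp_c11At ha ht₀ (contDiffAt_comp_extChartAt_symm hp hf).c11At).congr ?_ ?_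
  · filter_upwards [hsrc] with s hs
    simp only [Function.comp_apply, (extChartAt (𝓡 m) p).left_inv hs]
  · filter_upwards [hsrc, hfd] with s hs hs'
    rw [vderiv_eq hs hs']
    rfl

theorem hasExpansion_of_coord {u : ℝ → EuclideanSpace ℝ (Fin m)}
    {A : ℝ → EuclideanSpace ℝ (Fin d) →L[ℝ] EuclideanSpace ℝ (Fin m)}
    (hA : IsHolderNear a S t₀ A)
    (h : ∀ i, HasExpansion a Z S t₀ (fun s => EuclideanSpace.proj (𝕜 := ℝ) i (u s))
      (fun s => (EuclideanSpace.proj (𝕜 := ℝ) i).comp (A s))) :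
    HasExpansion a Z S t₀ u A := by
  have key : ∀ {g : ℝ × ℝ → EuclideanSpace ℝ (Fin m)} {r : ℝ × ℝ → ℝ} {l : Filter (ℝ × ℝ)},
      (∀ i, (fun p => EuclideanSpace.proj (𝕜 := ℝ) i (g p)) =O[l] r) → g =O[l] r := by
    intro g r l hg
    refine ((EuclideanSpace.equiv (Fin m) ℝ).isBigO_comp_rev g l).trans ?_
    exact isBigO_pi.2 hg
  refine ⟨key fun i => ?_, hA, key fun i => ?_⟩
  · exact IsBigO.congr_left (h i).holder fun p => by rw [map_sub]
  · exact (h i).expand.congr_left fun p => by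
      simp only [map_sub, ContinuousLinearMap.comp_apply]

variable {α : ℝ≥0} {W : ℝ → (x : M) → (EuclideanSpace ℝ (Fin d) →L[ℝ] TangentSpace (𝓡 m) x)}
  {K : ℝ}

/-- Any chart around `x t₀` will do: by `smooth_comp` its expansion yields one for the chart centred
at `x t₀`, which gives the Hölder condition, and for every test function, which gives the integrals.
-/
theorem isYoungSolution_of_hasExpansion (hα : 1 / 2 < (α : ℝ)) (hK : 0 ≤ K)
    (hZ : ∀ s t, ‖Z t - Z s‖ ≤ K * |t - s| ^ (α : ℝ))
    (h : ∀ t₀ ∈ Icc 0 τ, ContinuousWithinAt x (Icc 0 τ) t₀ ∧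
      ∃ p, x t₀ ∈ (extChartAt (𝓡 m) p).source ∧
        HasExpansion α Z (Icc 0 τ) t₀ (fun s => extChartAt (𝓡 m) p (x s))
          (fun s => (vderiv m (extChartAt (𝓡 m) p) (x s)).comp (W s (x s)))) :
    IsYoungSolution α Z W τ x := by
  have hα0 : 0 < (α : ℝ) := by linarith
  refine ⟨⟨fun t₀ ht₀ => (h t₀ ht₀).1, fun t₀ ht₀ => ?_⟩, fun f hf t ht => ?_⟩
  · obtain ⟨hx, p, hp, hexp⟩ := h t₀ ht₀
    exact isHolderNear_iff.1 (hexp.smooth_comp hα0 ht₀ hx (W := fun s => W s (x s)) hp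
      (contMDiffAt_extChartAt (I := 𝓡 m) (n := ∞) (x := x t₀))).holder
  · refine hasYoungIntegral_of_hasExpansion (J := fun s => f (x s)) hα hK hZ
      (fun t₀ ht₀ => ?_) ht
    obtain ⟨hx, p, hp, hexp⟩ := h t₀ ht₀
    exact hexp.smooth_comp hα0 ht₀ hx (W := fun s => W s (x s)) hp hf.contMDiffAt

/-- Chart coordinates are not global test functions, but their products with a bump function are,
and agree with them near `x t₀`. Hölder continuity of the coefficient is a hypothesis because `W`
has no regularity in time; it has to be checked for each equation. -/
theorem IsYoungSolution.hasExpansion [T2Space M] (hα : 1 / 2 < (α : ℝ)) (hK : 0 ≤ K)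
    (hZ : ∀ s t, ‖Z t - Z s‖ ≤ K * |t - s| ^ (α : ℝ))
    (h : IsYoungSolution α Z W τ x) (ht₀ : t₀ ∈ Icc 0 τ)
    (hW : IsHolderNear (α : ℝ) (Icc 0 τ) t₀
      (fun s => (vderiv m (extChartAt (𝓡 m) (x t₀)) (x s)).comp (W s (x s)))) :
    HasExpansion α Z (Icc 0 τ) t₀ (fun s => extChartAt (𝓡 m) (x t₀) (x s))
      (fun s => (vderiv m (extChartAt (𝓡 m) (x t₀)) (x s)).comp (W s (x s))) := by
  have hα0 : 0 < (α : ℝ) := by linarith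
  have hx := h.1.1 t₀ ht₀
  refine hasExpansion_of_coord hW fun i => ?_
  set φ := extChartAt (𝓡 m) (x t₀)
  obtain ⟨b⟩ : Nonempty (SmoothBumpFunction (𝓡 m) (x t₀)) := inferInstance
  let g : M → ℝ := fun q => EuclideanSpace.proj (𝕜 := ℝ) i (φ q)
  let f : M → ℝ := fun q => b q • g q
  have hg : ContMDiffOn (𝓡 m) 𝓘(ℝ, ℝ) ∞ g (chartAt (EuclideanSpace ℝ (Fin m)) (x t₀)).source :=
    (EuclideanSpace.proj (𝕜 := ℝ) i).contMDiff.comp_contMDiffOn contMDiffOn_extChartAt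
  have hf : ContMDiff (𝓡 m) 𝓘(ℝ, ℝ) ∞ f := b.contMDiff_smul hg
  have hfg : ∀ᶠ q in 𝓝 (x t₀), f =ᶠ[𝓝 q] g := by
    refine Filter.Eventually.eventually_nhds (p := fun q => f q = g q) ?_
    filter_upwards [b.eventuallyEq_one] with q hq
    simp [f, hq]
  have hsrc : ∀ᶠ s in 𝓝[Icc 0 τ] t₀, x s ∈ φ.source :=
    hx.eventually ((isOpen_extChartAt_source (x t₀)).mem_nhds (mem_extChartAt_source (x t₀)))
  have e1 : (fun s => f (x s)) =ᶠ[𝓝[Icc 0 τ] t₀] fun s => g (x s) :=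
    (hx.eventually hfg).mono fun s hs => hs.eq_of_nhds
  have e2 : (fun s => (vderiv m f (x s)).comp (W s (x s))) =ᶠ[𝓝[Icc 0 τ] t₀] fun s =>
      (EuclideanSpace.proj (𝕜 := ℝ) i).comp ((vderiv m φ (x s)).comp (W s (x s))) := by
    filter_upwards [hx.eventually hfg, hsrc] with s hs hs'
    have hd : vderiv m f (x s) = (EuclideanSpace.proj (𝕜 := ℝ) i).comp (vderiv m φ (x s)) := by
      rw [vderiv, hs.mfderiv_eq]
      have := mfderiv_comp (I := 𝓡 m) (I' := 𝓘(ℝ, EuclideanSpace ℝ (Fin m))) (I'' := 𝓘(ℝ, ℝ)) (x s)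
        (g := EuclideanSpace.proj (𝕜 := ℝ) i) (f := φ)
        ((EuclideanSpace.proj (𝕜 := ℝ) i).differentiableAt.mdifferentiableAt)
        (mdifferentiableAt_extChartAt' hs')
      rw [mfderiv_eq_fderiv, ContinuousLinearMap.fderiv] at this
      exact this
    rw [hd]
    rfl
  have hol : IsHolderNear (α : ℝ) (Icc 0 τ) t₀ fun s => (vderiv m f (x s)).comp (W s (x s)) :=
    ((IsHolderNear.const (EuclideanSpace.proj (𝕜 := ℝ) i)).clm_comp hW hα0 ht₀).congr e2.symm
  exact (hasExpansion_of_hasYoungIntegral (J := fun s => f (x s)) hα hK hZ (h.2 f hf) ht₀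
    hol).congr e1 e2

/-- For the autonomous field the coefficient is the smooth map `chartField` along a Hölder path,
hence Hölder. The expansion is obtained in the chart at `x t₀` and carried to the chart at `p`. -/
theorem IsYoungSolution.hasExpansion_chartField [T2Space M] (hα : 1 / 2 < (α : ℝ)) (hK : 0 ≤ K)
    (hZ : ∀ s t, ‖Z t - Z s‖ ≤ K * |t - s| ^ (α : ℝ))
    {X : (x : M) → (EuclideanSpace ℝ (Fin d) →L[ℝ] TangentSpace (𝓡 m) x)} (hX : IsSmoothFields X)
    (h : IsYoungSolution α Z (fun _ => X) τ x) (ht₀ : t₀ ∈ Icc 0 τ) {p : M}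
    (hp : x t₀ ∈ (extChartAt (𝓡 m) p).source) :
    HasExpansion α Z (Icc 0 τ) t₀ (fun s => extChartAt (𝓡 m) p (x s))
      (fun s => (vderiv m (extChartAt (𝓡 m) p) (x s)).comp (X (x s))) := by
  have hα0 : 0 < (α : ℝ) := by linarith
  have hx := h.1.1 t₀ ht₀
  have hol : IsHolderNear (α : ℝ) (Icc 0 τ) t₀ fun s => extChartAt (𝓡 m) (x t₀) (x s) :=
    isHolderNear_iff.2 (h.1.2 t₀ ht₀)
  have hq := mem_extChartAt_source (I := 𝓡 m) (x t₀)
  refine (h.hasExpansion hα hK hZ ht₀ ?_).smooth_comp hα0 ht₀ hx (W := fun s => X (x s)) hq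
    ((contMDiffOn_extChartAt (I := 𝓡 m) (n := ∞) (x := p)).contMDiffAt
      ((chartAt _ p).open_source.mem_nhds (by rwa [← extChartAt_source (𝓡 m)])))
  have hcd : ContDiffAt ℝ 1 (chartField X (x t₀)) (extChartAt (𝓡 m) (x t₀) (x t₀)) :=
    ((contDiffOn_chartField hX (x t₀)).contDiffAt
      ((isOpen_extChartAt_target _).mem_nhds ((extChartAt (𝓡 m) (x t₀)).map_source hq))).of_le
      (by simp)
  refine (hol.comp_contDiffAt hα0 ht₀ hcd).congr ?_
  filter_upwards [hx.eventually ((isOpen_extChartAt_source (x t₀)).mem_nhds hq)] with s hs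
  exact chartField_extChartAt X hs

end Paths

end YoungFlow

namespace YoungFlow

/-! ### Flow boxes: local flows on the manifold. -/

section FlowBox

theorem RoughFlow.mono {E F : Type*} [NormedAddCommGroup E] [NormedSpace ℝ E]
    [NormedAddCommGroup F] [NormedSpace ℝ F] {a C h h' : ℝ} {Z : ℝ → F} {V : E → F →L[ℝ] E}
    {Φ : ℝ → ℝ → E → E} {A : ℝ → ℝ → E → E →L[ℝ] E} (R : RoughFlow a C h Z V Φ A)
    (h0 : 0 < h') (hh : h' ≤ h) : RoughFlow a C h' Z V Φ A where
  half_lt := R.half_lt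
  C_nonneg := R.C_nonneg
  h_pos := h0
  comp h1 h2 h3 := R.comp (h1.trans hh) (h2.trans hh) (h3.trans hh)
  self := R.self
  davie h1 := R.davie (h1.trans hh)
  near h1 := R.near (h1.trans hh)
  lip h1 := R.lip (h1.trans hh)
  hasFDerivAt h1 := R.hasFDerivAt (h1.trans hh)
  fderiv_near h1 := R.fderiv_near (h1.trans hh)
  fderiv_lip h1 := R.fderiv_lip (h1.trans hh)
  unique hI hIh := R.unique hI fun s hs t ht => (hIh s hs t ht).trans hh

/-- The continuation principle used throughout: a property whose truth is locally constant in time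
has the same truth value at all times of an interval. -/
theorem iff_of_locally_const {P : ℝ → Prop} {I : Set ℝ} (hI : IsPreconnected I)
    (h : ∀ r ∈ I, ∀ᶠ s in 𝓝[I] r, (P s ↔ P r)) {s t : ℝ} (hs : s ∈ I) (ht : t ∈ I) :
    P s ↔ P t :=
  hI.induction₂ (fun x y => (P x ↔ P y)) (fun r hr => (h r hr).mono fun _ hs => hs.symm)
    (fun _ _ _ _ _ _ h1 h2 => h1.trans h2) (fun _ _ _ _ h1 => h1.symm) hs ht

variable {m d : ℕ} {M : Type*} [TopologicalSpace M]
  [ChartedSpace (EuclideanSpace ℝ (Fin m)) M]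

/-- A chart at `p` together with the flow of a globally defined field that agrees on a ball with
the expression of `X` in this chart. -/
structure FlowBox (a : ℝ) (Z : ℝ → EuclideanSpace ℝ (Fin d))
    (X : (x : M) → (EuclideanSpace ℝ (Fin d) →L[ℝ] TangentSpace (𝓡 m) x)) (p : M) where
  r : ℝ
  C : ℝ
  h : ℝ
  V : EuclideanSpace ℝ (Fin m) → EuclideanSpace ℝ (Fin d) →L[ℝ] EuclideanSpace ℝ (Fin m)
  Φ : ℝ → ℝ → EuclideanSpace ℝ (Fin m) → EuclideanSpace ℝ (Fin m)
  A : ℝ → ℝ → EuclideanSpace ℝ (Fin m) → EuclideanSpace ℝ (Fin m) →L[ℝ] EuclideanSpace ℝ (Fin m)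
  r_pos : 0 < r
  flow : RoughFlow a C h Z V Φ A
  smooth : ContDiff ℝ ∞ V
  ball_subset : Metric.ball (extChartAt (𝓡 m) p p) r ⊆ (extChartAt (𝓡 m) p).target
  eq_chartField : ∀ y ∈ Metric.ball (extChartAt (𝓡 m) p p) r, V y = chartField X p y
  stay : ∀ {s t}, |t - s| ≤ h → ∀ y ∈ Metric.ball (extChartAt (𝓡 m) p p) (r / 2),
    Φ t s y ∈ Metric.ball (extChartAt (𝓡 m) p p) r

theorem exists_contDiff_hasCompactSupport_eqOn {E G : Type*} [NormedAddCommGroup E]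
    [InnerProductSpace ℝ E] [FiniteDimensional ℝ E] [NormedAddCommGroup G] [NormedSpace ℝ G] {c : E}
    {U : Set E} (hU : IsOpen U) (hc : c ∈ U) {f : E → G} (hf : ContDiffOn ℝ ∞ f U) :
    ∃ (r : ℝ) (V : E → G), 0 < r ∧ ContDiff ℝ ∞ V ∧ HasCompactSupport V ∧
      Metric.ball c r ⊆ U ∧ ∀ y ∈ Metric.ball c r, V y = f y := by
  obtain ⟨R, hR, hsub⟩ := Metric.nhds_basis_closedBall.mem_iff.1 (hU.mem_nhds hc)
  let χ : ContDiffBump c := ⟨R / 2, R, half_pos hR, half_lt_self hR⟩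
  refine ⟨R / 2, fun y => χ y • f y, half_pos hR, ?_, χ.hasCompactSupport.smul_right,
    (Metric.ball_subset_closedBall.trans
      (Metric.closedBall_subset_closedBall (half_le_self hR.le))).trans hsub, fun y hy => ?_⟩
  · rw [contDiff_iff_contDiffAt]
    intro y
    by_cases hy : y ∈ U
    · exact χ.contDiff.contDiffAt.smul (hf.contDiffAt (hU.mem_nhds hy))
    · have hy' : y ∉ tsupport χ := fun h => hy (hsub (by rwa [χ.tsupport_eq] at h))
      have : (fun y => χ y • f y) =ᶠ[𝓝 y] fun _ => 0 := by
        filter_upwards [(isClosed_tsupport χ).isOpen_compl.mem_nhds hy'] with z hz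
        rw [image_eq_zero_of_notMem_tsupport hz, zero_smul]
      exact contDiffAt_const.congr_of_eventuallyEq this
  · simp only [χ.one_of_mem_closedBall (Metric.ball_subset_closedBall hy), one_smul]

/-- Displacements over time `h'` are at most `C * h' ^ a`, so it suffices to make this less than `r
/ 2`. -/
theorem RoughFlow.exists_stay {E F : Type*} [NormedAddCommGroup E] [NormedSpace ℝ E]
    [NormedAddCommGroup F] [NormedSpace ℝ F] {a C h r : ℝ} {Z : ℝ → F} {V : E → F →L[ℝ] E}
    {Φ : ℝ → ℝ → E → E} {A : ℝ → ℝ → E → E →L[ℝ] E} (R : RoughFlow a C h Z V Φ A)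
    (ha : 0 < a) (hr : 0 < r) : ∃ h', 0 < h' ∧ h' ≤ h ∧
      ∀ {s t}, |t - s| ≤ h' → ∀ {c y : E}, y ∈ Metric.ball c (r / 2) →
        Φ t s y ∈ Metric.ball c r := by
  have hlim : Tendsto (fun x : ℝ => C * x ^ a) (𝓝[>] 0) (𝓝 0) := by
    have h0 : ContinuousAt (fun x : ℝ => C * x ^ a) 0 :=
      continuousAt_const.mul (Real.continuousAt_rpow_const _ _ (Or.inr ha.le))
    have := h0.tendsto
    rw [Real.zero_rpow ha.ne', mul_zero] at this
    exact this.mono_left nhdsWithin_le_nhds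
  have hlt : ∀ᶠ x : ℝ in 𝓝[>] 0, x < h := mem_nhdsWithin_of_mem_nhds (Iio_mem_nhds R.h_pos)
  obtain ⟨h', ⟨h1, h2⟩, h3⟩ := ((hlim.eventually_lt_const (half_pos hr)).and hlt
    |>.and self_mem_nhdsWithin).exists
  refine ⟨h', h3, h2.le, fun {s t} hst {c y} hy => ?_⟩
  rw [Metric.mem_ball] at hy ⊢
  have b1 := R.near (hst.trans h2.le) y
  have b2 : |t - s| ^ a ≤ h' ^ a := Real.rpow_le_rpow (abs_nonneg _) hst ha.le
  have b3 := mul_le_mul_of_nonneg_left b2 R.C_nonneg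
  rw [← dist_eq_norm] at b1
  linarith [dist_triangle (Φ t s y) y c]

theorem nonempty_flowBox [IsManifold (𝓡 m) ∞ M] {a K : ℝ} (ha : 1 / 2 < a) (hK : 0 ≤ K)
    {Z : ℝ → EuclideanSpace ℝ (Fin d)} (hZ : ∀ s t, ‖Z t - Z s‖ ≤ K * |t - s| ^ a)
    {X : (x : M) → (EuclideanSpace ℝ (Fin d) →L[ℝ] TangentSpace (𝓡 m) x)}
    (hX : IsSmoothFields X) (p : M) : Nonempty (FlowBox a Z X p) := by
  obtain ⟨r, V, hr, hVs, hVc, hsub, hVX⟩ := exists_contDiff_hasCompactSupport_eqOn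
    (isOpen_extChartAt_target p) (mem_extChartAt_target p) (contDiffOn_chartField hX p)
  obtain ⟨C, h, Φ, A, hfl⟩ := exists_roughFlow hVs hVc ha hK hZ
  obtain ⟨h', h1, h2, h3⟩ := hfl.exists_stay (by linarith) hr
  exact ⟨{ r := r, C := C, h := h', V := V, Φ := Φ, A := A, r_pos := hr, flow := hfl.mono h1 h2,
           smooth := hVs, ball_subset := hsub, eq_chartField := hVX,
           stay := fun hst y hy => h3 hst hy }⟩

namespace FlowBox

variable {a : ℝ} {Z : ℝ → EuclideanSpace ℝ (Fin d)}
  {X : (x : M) → (EuclideanSpace ℝ (Fin d) →L[ℝ] TangentSpace (𝓡 m) x)} {p : M}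
  (B : FlowBox a Z X p)

/-- The points of the chart whose coordinates lie in the ball on which the flow of the box is
driven by `X`. -/
def dom : Set M :=
  (extChartAt (𝓡 m) p).source ∩ extChartAt (𝓡 m) p ⁻¹' Metric.ball (extChartAt (𝓡 m) p p) B.r

/-- A smaller neighbourhood of `p` that does not leave `dom` during time `h`. -/
def core : Set M :=
  (extChartAt (𝓡 m) p).source ∩
    extChartAt (𝓡 m) p ⁻¹' Metric.ball (extChartAt (𝓡 m) p p) (B.r / 2)

/-- The flow of the box from time `s` to time `t`. -/
noncomputable def move (t s : ℝ) (q : M) : M :=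
  (extChartAt (𝓡 m) p).symm (B.Φ t s (extChartAt (𝓡 m) p q))

theorem isOpen_dom : IsOpen B.dom :=
  isOpen_extChartAt_preimage' p Metric.isOpen_ball

theorem isOpen_core : IsOpen B.core :=
  isOpen_extChartAt_preimage' p Metric.isOpen_ball

theorem mem_core : p ∈ B.core :=
  ⟨mem_extChartAt_source p, Metric.mem_ball_self (by linarith [B.r_pos])⟩

theorem core_subset_dom : B.core ⊆ B.dom := fun _ hq =>
  ⟨hq.1, Metric.ball_subset_ball (by linarith [B.r_pos]) hq.2⟩

theorem move_self {q : M} (hq : q ∈ (extChartAt (𝓡 m) p).source) (s : ℝ) : B.move s s q = q := by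
  rw [move, B.flow.self, (extChartAt (𝓡 m) p).left_inv hq]

theorem extChartAt_move {s t : ℝ} {q : M}
    (hq : B.Φ t s (extChartAt (𝓡 m) p q) ∈ Metric.ball (extChartAt (𝓡 m) p p) B.r) :
    extChartAt (𝓡 m) p (B.move t s q) = B.Φ t s (extChartAt (𝓡 m) p q) :=
  (extChartAt (𝓡 m) p).right_inv (B.ball_subset hq)

theorem move_mem_dom {s t : ℝ} {q : M}
    (hq : B.Φ t s (extChartAt (𝓡 m) p q) ∈ Metric.ball (extChartAt (𝓡 m) p p) B.r) :
    B.move t s q ∈ B.dom :=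
  ⟨(extChartAt (𝓡 m) p).map_target (B.ball_subset hq), by
    rw [mem_preimage, B.extChartAt_move hq]; exact hq⟩

theorem move_move {s u t : ℝ} {q : M}
    (hq : B.Φ u s (extChartAt (𝓡 m) p q) ∈ Metric.ball (extChartAt (𝓡 m) p p) B.r)
    (h1 : |t - s| ≤ B.h) (h2 : |u - s| ≤ B.h) (h3 : |t - u| ≤ B.h) :
    B.move t u (B.move u s q) = B.move t s q := by
  rw [move, B.extChartAt_move hq, B.flow.comp h1 h2 h3]
  rfl

theorem tendsto_flow {s t₀ : ℝ} (hst : |t₀ - s| ≤ B.h) (S : Set ℝ)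
    (hS : ∀ᶠ t in 𝓝[S] t₀, |t - s| ≤ B.h) (y : EuclideanSpace ℝ (Fin m)) :
    Tendsto (fun t => B.Φ t s y) (𝓝[S] t₀) (𝓝 (B.Φ t₀ s y)) := by
  rw [tendsto_iff_norm_sub_tendsto_zero]
  have ha := B.flow.a_pos
  have h1 : ∀ᶠ t in 𝓝[S] t₀, |t - t₀| ≤ B.h := by
    have : Metric.closedBall t₀ B.h ∈ 𝓝 t₀ := Metric.closedBall_mem_nhds _ B.flow.h_pos
    filter_upwards [mem_nhdsWithin_of_mem_nhds this] with t ht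
    rwa [← Real.dist_eq]
  have h2 : Tendsto (fun t => B.C * |t - t₀| ^ a) (𝓝[S] t₀) (𝓝 0) := by
    have : ContinuousAt (fun t : ℝ => B.C * |t - t₀| ^ a) t₀ :=
      continuousAt_const.mul (ContinuousAt.rpow_const (by fun_prop) (Or.inr ha.le))
    have := this.tendsto
    simp only [sub_self, abs_zero, Real.zero_rpow ha.ne', mul_zero] at this
    exact this.mono_left nhdsWithin_le_nhds
  refine squeeze_zero' (Eventually.of_forall fun _ => norm_nonneg _) ?_ h2
  filter_upwards [h1, hS] with t ht ht'
  rw [← B.flow.comp ht' hst ht]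
  exact B.flow.near ht _

theorem tendsto_flow_self (t₀ : ℝ) (S : Set ℝ) (y : EuclideanSpace ℝ (Fin m)) :
    Tendsto (fun t => B.Φ t t₀ y) (𝓝[S] t₀) (𝓝 y) := by
  have h1 : ∀ᶠ t in 𝓝[S] t₀, |t - t₀| ≤ B.h := by
    have : Metric.closedBall t₀ B.h ∈ 𝓝 t₀ := Metric.closedBall_mem_nhds _ B.flow.h_pos
    filter_upwards [mem_nhdsWithin_of_mem_nhds this] with t ht
    rwa [← Real.dist_eq]
  have := B.tendsto_flow (s := t₀) (t₀ := t₀) (by simpa using B.flow.h_pos.le) S h1 y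
  rwa [B.flow.self] at this

theorem eventually_flow_mem_ball {t₀ : ℝ} (S : Set ℝ) {q : M} (hq : q ∈ B.dom) :
    ∀ᶠ t in 𝓝[S] t₀,
      B.Φ t t₀ (extChartAt (𝓡 m) p q) ∈ Metric.ball (extChartAt (𝓡 m) p p) B.r :=
  (B.tendsto_flow_self t₀ S _).eventually (Metric.isOpen_ball.mem_nhds hq.2)

end FlowBox

variable [IsManifold (𝓡 m) ∞ M] {α : ℝ≥0} {K τ : ℝ} {Z : ℝ → EuclideanSpace ℝ (Fin d)}
  {X : (x : M) → (EuclideanSpace ℝ (Fin d) →L[ℝ] TangentSpace (𝓡 m) x)} {x y : ℝ → M}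

/-- A path that locally follows flow boxes is a solution. -/
theorem isYoungSolution_of_move (hα : 1 / 2 < (α : ℝ)) (hK : 0 ≤ K)
    (hZ : ∀ s t, ‖Z t - Z s‖ ≤ K * |t - s| ^ (α : ℝ))
    (h : ∀ t₀ ∈ Icc 0 τ, ∃ (p : M) (B : FlowBox (α : ℝ) Z X p), x t₀ ∈ B.dom ∧
      ∀ᶠ t in 𝓝[Icc 0 τ] t₀, x t = B.move t t₀ (x t₀)) :
    IsYoungSolution α Z (fun _ => X) τ x := by
  refine isYoungSolution_of_hasExpansion hα hK hZ fun t₀ ht₀ => ?_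
  obtain ⟨p, B, hB, hmove⟩ := h t₀ ht₀
  have hcont : ContinuousWithinAt x (Icc 0 τ) t₀ := by
    have h1 : Tendsto (fun t => B.move t t₀ (x t₀)) (𝓝[Icc 0 τ] t₀) (𝓝 (x t₀)) := by
      have := (contMDiffAt_extChartAt_symm (p := p) (B.ball_subset hB.2)).continuousAt.tendsto.comp
        (B.tendsto_flow_self t₀ (Icc 0 τ) (extChartAt (𝓡 m) p (x t₀)))
      rwa [(extChartAt (𝓡 m) p).left_inv hB.1] at this
    exact h1.congr' (hmove.mono fun _ ht => ht.symm)
  refine ⟨hcont, p, hB.1, ?_⟩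
  refine (B.flow.hasExpansion B.smooth (u := fun t => extChartAt (𝓡 m) p (x t)) ht₀ ?_).congr
    EventuallyEq.rfl ?_
  · filter_upwards [hmove, B.eventually_flow_mem_ball (Icc 0 τ) hB] with t ht ht'
    rw [ht, B.extChartAt_move ht']
  · filter_upwards [hcont.eventually (B.isOpen_dom.mem_nhds hB)] with t ht
    rw [B.eq_chartField _ ht.2, chartField_extChartAt X ht.1]

variable [T2Space M]

/-- A solution locally follows every flow box. -/
theorem IsYoungSolution.eventually_flow (hα : 1 / 2 < (α : ℝ)) (hK : 0 ≤ K)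
    (hZ : ∀ s t, ‖Z t - Z s‖ ≤ K * |t - s| ^ (α : ℝ)) (hX : IsSmoothFields X)
    (h : IsYoungSolution α Z (fun _ => X) τ x) {t₀ : ℝ} (ht₀ : t₀ ∈ Icc 0 τ) {p : M}
    (B : FlowBox (α : ℝ) Z X p) (hp : x t₀ ∈ B.dom) :
    ∀ᶠ t in 𝓝[Icc 0 τ] t₀, x t ∈ B.dom ∧ x t = B.move t t₀ (x t₀) := by
  have hcont := h.1.1 t₀ ht₀
  have hdom := hcont.eventually (B.isOpen_dom.mem_nhds hp)
  have h1 : HasExpansion (α : ℝ) Z (Icc 0 τ) t₀ (fun s => extChartAt (𝓡 m) p (x s))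
      (fun s => B.V (extChartAt (𝓡 m) p (x s))) := by
    refine (h.hasExpansion_chartField hα hK hZ hX ht₀ hp.1).congr EventuallyEq.rfl ?_
    filter_upwards [hdom] with t ht
    rw [B.eq_chartField _ ht.2, chartField_extChartAt X ht.1]
  have h2 := B.flow.eventually_eq h1
  have h3 : Tendsto (fun t => (t, t₀)) (𝓝[Icc 0 τ] t₀) (𝓝[Icc 0 τ] t₀ ×ˢ 𝓝[Icc 0 τ] t₀) :=
    tendsto_id.prodMk (tendsto_const_pure.mono_right (pure_le_nhdsWithin ht₀))
  filter_upwards [h3.eventually h2, hdom] with t ht ht'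
  refine ⟨ht', ?_⟩
  rw [FlowBox.move, ← ht, (extChartAt (𝓡 m) p).left_inv ht'.1]

end FlowBox

end YoungFlow

namespace YoungFlow

/-! ### Uniqueness, continuation and the domain of the flow. -/

section Flow

variable {m d : ℕ} {M : Type*} [TopologicalSpace M]
  [ChartedSpace (EuclideanSpace ℝ (Fin m)) M]

theorem IsYoungSolution.mono {α : ℝ≥0} {Z : ℝ → EuclideanSpace ℝ (Fin d)}
    {W : ℝ → (x : M) → (EuclideanSpace ℝ (Fin d) →L[ℝ] TangentSpace (𝓡 m) x)} {τ τ' : ℝ}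
    {x : ℝ → M} (h : IsYoungSolution α Z W τ x) (hτ : τ' ≤ τ) : IsYoungSolution α Z W τ' x := by
  have hsub : Icc 0 τ' ⊆ Icc 0 τ := Icc_subset_Icc_right hτ
  refine ⟨⟨h.1.1.mono hsub, fun t₀ ht₀ => ?_⟩, fun f hf t ht => h.2 f hf t (hsub ht)⟩
  obtain ⟨C, U, hU, hC⟩ := h.1.2 t₀ (hsub ht₀)
  exact ⟨C, U, nhdsWithin_mono _ hsub hU, hC⟩

theorem flowDomain_anti {α : ℝ≥0} {Z : ℝ → EuclideanSpace ℝ (Fin d)}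
    {X : (x : M) → (EuclideanSpace ℝ (Fin d) →L[ℝ] TangentSpace (𝓡 m) x)} {s t : ℝ} (h : s ≤ t) :
    flowDomain α Z X t ⊆ flowDomain α Z X s :=
  fun _ ⟨y, hy, h0⟩ => ⟨y, hy.mono h, h0⟩

theorem eventually_ne_of_tendsto {ι N : Type*} [TopologicalSpace N] [T2Space N] {l : Filter ι}
    {f g : ι → N} {b c : N} (hf : Tendsto f l (𝓝 b)) (hg : Tendsto g l (𝓝 c)) (h : b ≠ c) :
    ∀ᶠ i in l, f i ≠ g i :=
  (hf.prodMk_nhds hg).eventually (isClosed_diagonal.isOpen_compl.mem_nhds (x := (b, c)) h)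

theorem abs_sub_le_of_mem_uIcc {s t r r' : ℝ} (hr : r ∈ uIcc s t) (hr' : r' ∈ uIcc s t) :
    |r - r'| ≤ |t - s| := by
  rw [abs_sub_comm t s]
  exact abs_sub_le_of_uIcc_subset_uIcc (uIcc_subset_uIcc hr' hr |>.trans (by rw [uIcc_comm]))
    |>.trans (by rw [abs_sub_comm])

variable [IsManifold (𝓡 m) ∞ M]

theorem FlowBox.tendsto_move {a : ℝ} {Z : ℝ → EuclideanSpace ℝ (Fin d)}
    {X : (x : M) → (EuclideanSpace ℝ (Fin d) →L[ℝ] TangentSpace (𝓡 m) x)} {p : M}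
    (B : FlowBox a Z X p) {s t₀ : ℝ} {S : Set ℝ} (hst : |t₀ - s| ≤ B.h)
    (hS : ∀ᶠ t in 𝓝[S] t₀, |t - s| ≤ B.h) {q : M}
    (hq : B.Φ t₀ s (extChartAt (𝓡 m) p q) ∈ Metric.ball (extChartAt (𝓡 m) p p) B.r) :
    Tendsto (fun t => B.move t s q) (𝓝[S] t₀) (𝓝 (B.move t₀ s q)) :=
  (contMDiffAt_extChartAt_symm (p := p) (B.ball_subset hq)).continuousAt.tendsto.comp
    (B.tendsto_flow hst S hS _)

variable {α : ℝ≥0} {K τ τ' : ℝ} {Z : ℝ → EuclideanSpace ℝ (Fin d)}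
  {X : (x : M) → (EuclideanSpace ℝ (Fin d) →L[ℝ] TangentSpace (𝓡 m) x)} {x y : ℝ → M}
  (hα : 1 / 2 < (α : ℝ)) (hK : 0 ≤ K) (hZ : ∀ s t, ‖Z t - Z s‖ ≤ K * |t - s| ^ (α : ℝ))

section

include hα hK hZ

/-- The orbits of a flow box are solutions. -/
theorem FlowBox.isYoungSolution_move {p : M} (B : FlowBox (α : ℝ) Z X p) {s : ℝ} {q : M}
    (hτ : τ ≤ B.h) (hs : ∀ r ∈ Icc 0 τ, |r - s| ≤ B.h)
    (hq : ∀ r ∈ Icc 0 τ,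
      B.Φ r s (extChartAt (𝓡 m) p q) ∈ Metric.ball (extChartAt (𝓡 m) p p) B.r) :
    IsYoungSolution α Z (fun _ => X) τ fun r => B.move r s q := by
  refine isYoungSolution_of_move hα hK hZ fun t₀ ht₀ => ⟨p, B, B.move_mem_dom (hq t₀ ht₀), ?_⟩
  filter_upwards [self_mem_nhdsWithin] with t ht
  refine (B.move_move (hq t₀ ht₀) (hs t ht) (hs t₀ ht₀) ?_).symm
  rw [abs_le]
  constructor <;> linarith [ht.1, ht.2, ht₀.1, ht₀.2]

theorem flowDomain_zero (hX : IsSmoothFields X) : flowDomain α Z X 0 = univ := by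
  refine eq_univ_of_forall fun q => ?_
  obtain ⟨B⟩ := nonempty_flowBox hα hK hZ hX q
  have hq0 : ∀ r ∈ Icc (0 : ℝ) 0, |r - 0| ≤ B.h := by
    intro r hr
    rw [le_antisymm hr.2 hr.1]
    simpa using B.flow.h_pos.le
  exact ⟨_, B.isYoungSolution_move hα hK hZ (s := 0) (q := q) B.flow.h_pos.le hq0
    (fun r hr => B.stay (hq0 r hr) _ B.mem_core.2), B.move_self (mem_extChartAt_source q) 0⟩

variable [T2Space M] (hX : IsSmoothFields X)

include hX

/-- It is not assumed that `x` stays in the chart; only the box orbit does. Where the two agree,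
they agree nearby since solutions locally follow boxes; where they differ, they differ nearby by
continuity in a Hausdorff space. -/
theorem IsYoungSolution.eq_move (h : IsYoungSolution α Z (fun _ => X) τ x) {p : M}
    (B : FlowBox (α : ℝ) Z X p) {s t : ℝ} (hs : s ∈ Icc 0 τ) (ht : t ∈ Icc 0 τ)
    (hst : |t - s| ≤ B.h) (hsrc : x s ∈ (extChartAt (𝓡 m) p).source)
    (hball : ∀ r ∈ uIcc s t,
      B.Φ r s (extChartAt (𝓡 m) p (x s)) ∈ Metric.ball (extChartAt (𝓡 m) p p) B.r) :
    x t = B.move t s (x s) := by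
  have hsub : uIcc s t ⊆ Icc 0 τ := uIcc_subset_Icc hs ht
  refine (iff_of_locally_const (P := fun r => x r = B.move r s (x s)) isPreconnected_uIcc
    (fun r hr => ?_) left_mem_uIcc right_mem_uIcc).1 (B.move_self hsrc s).symm
  have hle : ∀ {r r'}, r ∈ uIcc s t → r' ∈ uIcc s t → |r - r'| ≤ B.h := fun h1 h2 =>
    (abs_sub_le_of_mem_uIcc h1 h2).trans hst
  by_cases hP : x r = B.move r s (x s)
  · have hd : x r ∈ B.dom := by rw [hP]; exact B.move_mem_dom (hball r hr)
    filter_upwards [nhdsWithin_mono _ hsub (h.eventually_flow hα hK hZ hX (hsub hr) B hd),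
      self_mem_nhdsWithin] with r' h1 h2
    refine ⟨fun _ => hP, fun _ => ?_⟩
    rw [h1.2, hP, B.move_move (hball r hr) (hle h2 left_mem_uIcc) (hle hr left_mem_uIcc)
      (hle h2 hr)]
  · have h1 := (h.1.1 r (hsub hr)).mono_left (nhdsWithin_mono _ hsub)
    have h2 := B.tendsto_move (S := uIcc s t) (hle hr left_mem_uIcc)
      (eventually_nhdsWithin_of_forall fun r' hr' => hle hr' left_mem_uIcc) (hball r hr)
    filter_upwards [eventually_ne_of_tendsto h1 h2 hP] with r' hr'
    exact ⟨fun h => absurd h hr', fun h => absurd h hP⟩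

theorem IsYoungSolution.eq_move_of_mem_core (h : IsYoungSolution α Z (fun _ => X) τ x) {p : M}
    (B : FlowBox (α : ℝ) Z X p) {s t : ℝ} (hs : s ∈ Icc 0 τ) (ht : t ∈ Icc 0 τ)
    (hst : |t - s| ≤ B.h) (hcore : x s ∈ B.core) : x t = B.move t s (x s) :=
  h.eq_move hα hK hZ hX B hs ht hst hcore.1 fun _ hr =>
    B.stay ((abs_sub_le_of_mem_uIcc hr left_mem_uIcc).trans hst) _ hcore.2

theorem IsYoungSolution.unique (hx : IsYoungSolution α Z (fun _ => X) τ x)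
    (hy : IsYoungSolution α Z (fun _ => X) τ y) {s t : ℝ} (hs : s ∈ Icc 0 τ) (ht : t ∈ Icc 0 τ)
    (h : x s = y s) : x t = y t := by
  refine (iff_of_locally_const (P := fun r => x r = y r) isPreconnected_Icc
    (fun r hr => ?_) hs ht).1 h
  by_cases hP : x r = y r
  · obtain ⟨B⟩ := nonempty_flowBox hα hK hZ hX (x r)
    have hd := B.core_subset_dom B.mem_core
    filter_upwards [hx.eventually_flow hα hK hZ hX hr B hd,
      hy.eventually_flow hα hK hZ hX hr B (hP ▸ hd)] with r' h1 h2
    exact ⟨fun _ => hP, fun _ => by rw [h1.2, h2.2]; exact congrArg (B.move r' r) hP⟩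
  · filter_upwards [eventually_ne_of_tendsto (hx.1.1 r hr) (hy.1.1 r hr) hP] with r' hr'
    exact ⟨fun h => absurd h hr', fun h => absurd h hP⟩

/-- Being a solution is local by `isYoungSolution_of_move`, so only the junction time is delicate;
there the same box `B` describes both sides. -/
theorem IsYoungSolution.extend (h : IsYoungSolution α Z (fun _ => X) τ x) (hτ : 0 ≤ τ)
    {p : M} (B : FlowBox (α : ℝ) Z X p) (hle : τ' - τ ≤ B.h)
    (hsrc : x τ ∈ (extChartAt (𝓡 m) p).source)
    (hball : ∀ r ∈ Icc τ τ',
      B.Φ r τ (extChartAt (𝓡 m) p (x τ)) ∈ Metric.ball (extChartAt (𝓡 m) p p) B.r) :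
    IsYoungSolution α Z (fun _ => X) τ' fun t => if t ≤ τ then x t else B.move t τ (x τ) := by
  refine isYoungSolution_of_move hα hK hZ fun t₀ ht₀ => ?_
  rcases lt_trichotomy t₀ τ with hlt | rfl | hlt
  · obtain ⟨B'⟩ := nonempty_flowBox hα hK hZ hX (x t₀)
    refine ⟨_, B', ?_, ?_⟩
    · rw [if_pos hlt.le]
      exact B'.core_subset_dom B'.mem_core
    · have h1 := eventually_nhdsWithin_iff.1 (h.eventually_flow hα hK hZ hX ⟨ht₀.1, hlt.le⟩ B'
        (B'.core_subset_dom B'.mem_core))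
      filter_upwards [mem_nhdsWithin_of_mem_nhds h1, self_mem_nhdsWithin,
        mem_nhdsWithin_of_mem_nhds (Iio_mem_nhds hlt)] with t h2 h3 h4
      rw [if_pos hlt.le, if_pos (le_of_lt h4)]
      exact (h2 ⟨h3.1, le_of_lt h4⟩).2
  · have hd : x t₀ ∈ B.dom := ⟨hsrc, by
      have := hball t₀ ⟨le_rfl, ht₀.2⟩
      rwa [B.flow.self] at this⟩
    refine ⟨p, B, by rwa [if_pos le_rfl], ?_⟩
    have h1 := eventually_nhdsWithin_iff.1 (h.eventually_flow hα hK hZ hX ⟨hτ, le_rfl⟩ B hd)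
    filter_upwards [mem_nhdsWithin_of_mem_nhds h1, self_mem_nhdsWithin] with t h2 h3
    rw [if_pos le_rfl]
    split_ifs with ht
    · exact (h2 ⟨h3.1, ht⟩).2
    · rfl
  · refine ⟨p, B, ?_, ?_⟩
    · rw [if_neg hlt.not_ge]
      exact B.move_mem_dom (hball t₀ ⟨hlt.le, ht₀.2⟩)
    · filter_upwards [self_mem_nhdsWithin,
        mem_nhdsWithin_of_mem_nhds (Ioi_mem_nhds hlt)] with t h3 h4
      have h4' : τ < t := h4
      rw [if_neg hlt.not_ge, if_neg h4'.not_ge, B.move_move (hball t₀ ⟨hlt.le, ht₀.2⟩)]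
      all_goals
        rw [abs_le]
        constructor <;> linarith [h3.1, h3.2, ht₀.1, ht₀.2, B.flow.h_pos]

variable {T : ℝ} {η : ℝ → M → M} (hη : IsSolutionFlow α T Z X η)

include hη

omit [T2Space M] in
theorem IsSolutionFlow.apply_zero (hT : 0 ≤ T) (q : M) : η 0 q = q :=
  (hη 0 ⟨le_rfl, hT⟩ q (by rw [flowDomain_zero hα hK hZ hX]; trivial)).2

theorem IsSolutionFlow.apply_eq {t s : ℝ} (ht : t ≤ T)
    (hy : IsYoungSolution α Z (fun _ => X) t y) (hs : s ∈ Icc 0 t) : η s (y 0) = y s := by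
  have ht0 : 0 ≤ t := hs.1.trans hs.2
  obtain ⟨h1, h2⟩ := hη t ⟨ht0, ht⟩ (y 0) ⟨y, hy, rfl⟩
  exact h1.unique hα hK hZ hX hy ⟨le_rfl, ht0⟩ hs h2

/-- The step length `B.h` is the same for all points of the core. This uniformity yields openness of
the domains and expresses `η t` near a point as a box map after `η s`, for both orders of `s` and
`t`. -/
theorem IsSolutionFlow.eq_move {s t : ℝ} (hs : s ∈ Icc 0 T) (ht : t ∈ Icc 0 T) {p : M}
    (B : FlowBox (α : ℝ) Z X p) (hst : |t - s| ≤ B.h) {q : M} (hq : q ∈ flowDomain α Z X s)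
    (hcore : η s q ∈ B.core) : q ∈ flowDomain α Z X t ∧ η t q = B.move t s (η s q) := by
  have h1 := hη s hs q hq
  have hD : q ∈ flowDomain α Z X t := by
    rcases le_total t s with hle | hle
    · exact flowDomain_anti hle hq
    · refine ⟨_, h1.1.extend hα hK hZ hX hs.1 B ((le_abs_self _).trans hst) hcore.1 fun r hr =>
        B.stay (le_trans ?_ hst) _ hcore.2, ?_⟩
      · rw [abs_of_nonneg (by linarith [hr.1]), abs_of_nonneg (by linarith)]
        linarith [hr.2]
      · rw [if_pos hs.1, h1.2]
  refine ⟨hD, ?_⟩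
  have h2 := (hη (max s t) ⟨hs.1.trans (le_max_left _ _), max_le hs.2 ht.2⟩ q (by
    rcases max_choice s t with h | h <;> rwa [h])).1
  exact h2.eq_move_of_mem_core hα hK hZ hX B ⟨hs.1, le_max_left _ _⟩ ⟨ht.1, le_max_right _ _⟩ hst
    hcore

theorem IsSolutionFlow.injOn {t : ℝ} (ht : t ∈ Icc 0 T) : InjOn (η t) (flowDomain α Z X t) := by
  intro q hq q' hq' h
  have h1 := hη t ht q hq
  have h2 := hη t ht q' hq'
  rw [← h1.2, ← h2.2]
  exact h1.1.unique hα hK hZ hX h2.1 ⟨ht.1, le_rfl⟩ ⟨le_rfl, ht.1⟩ h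

theorem IsSolutionFlow.eventually_mem_image (p : M) :
    ∀ᶠ t in 𝓝[Icc 0 T] 0, p ∈ η t '' flowDomain α Z X t := by
  obtain ⟨B⟩ := nonempty_flowBox hα hK hZ hX p
  filter_upwards [self_mem_nhdsWithin,
    mem_nhdsWithin_of_mem_nhds (Iic_mem_nhds B.flow.h_pos)] with t ht hth
  have hth' : t ≤ B.h := hth
  have hr : ∀ r ∈ Icc 0 t, |r - t| ≤ B.h := by
    intro r hr
    rw [abs_le]
    constructor <;> linarith [hr.1, hr.2]
  -- The box is run backwards from `p` at time `t`; the resulting solution starts at the required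
  -- preimage.
  have hy := B.isYoungSolution_move hα hK hZ (s := t) (q := p) hth' hr
    (fun r h => B.stay (hr r h) _ B.mem_core.2)
  refine ⟨B.move 0 t p, ⟨_, hy, rfl⟩, ?_⟩
  rw [hη.apply_eq hα hK hZ hX ht.2 hy ⟨ht.1, le_rfl⟩, B.move_self (mem_extChartAt_source p)]

end

/-! ### Compact manifolds: existence for all times, forwards and backwards. -/

section Compact

variable [CompactSpace M] (hX : IsSmoothFields X)

include hα hK hZ hX

/-- On a compact manifold all the flow boxes of a finite family of cores covering `M` can be used
during the same time. -/
theorem exists_uniform_flowBox :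
    ∃ h, 0 < h ∧ ∀ q : M, ∃ (p : M) (B : FlowBox (α : ℝ) Z X p), h ≤ B.h ∧ q ∈ B.core := by
  have B : ∀ p : M, FlowBox (α : ℝ) Z X p := fun p => (nonempty_flowBox hα hK hZ hX p).some
  obtain ⟨S, hS⟩ := CompactSpace.elim_nhds_subcover (fun p => (B p).core)
    fun p => (B p).isOpen_core.mem_nhds (B p).mem_core
  have h1 : ∀ᶠ h : ℝ in 𝓝[>] 0, ∀ p ∈ S, h ≤ (B p).h := by
    rw [Filter.eventually_all_finset]
    exact fun p _ => mem_nhdsWithin_of_mem_nhds (Iic_mem_nhds (B p).flow.h_pos)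
  obtain ⟨h, h2, h3⟩ := (h1.and self_mem_nhdsWithin).exists
  refine ⟨h, h3, fun q => ?_⟩
  have hq : q ∈ (⊤ : Set M) := trivial
  rw [← hS] at hq
  obtain ⟨p, hp, hq⟩ := mem_iUnion₂.1 hq
  exact ⟨p, B p, h2 p hp, hq⟩

/-- Backward steps of uniform length `h`, by induction on their number: `q` is carried back to time
`τ₁ = max 0 (τ - h)`, a solution reaching that point at `τ₁` is taken from the induction hypothesis,
and the same box extends it back to `q`. This gives surjectivity of `η τ`. -/
theorem exists_isYoungSolution_of_compactSpace [T2Space M] (hτ : 0 ≤ τ) (q : M) :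
    ∃ y, IsYoungSolution α Z (fun _ => X) τ y ∧ y τ = q := by
  obtain ⟨h, h0, hB⟩ := exists_uniform_flowBox (α := α) (Z := Z) hα hK hZ hX
  obtain ⟨n, hn⟩ := exists_nat_ge (τ / h)
  rw [div_le_iff₀ h0] at hn
  induction n generalizing τ q with
  | zero =>
    have h1 : q ∈ flowDomain α Z X 0 := by rw [flowDomain_zero hα hK hZ hX]; trivial
    obtain rfl : τ = 0 := le_antisymm (by simpa using hn) hτ
    exact h1
  | succ n ih =>
    obtain ⟨p, B, hhB, hq⟩ := hB q
    set τ₁ := max 0 (τ - h)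
    have hτ₁ : τ₁ ≤ τ := max_le hτ (by linarith)
    have hτ₂ : τ - h ≤ τ₁ := le_max_right _ _
    have hn' : τ - h ≤ n * h := by push_cast at hn; linarith
    obtain ⟨y, hy, hyq⟩ := ih (τ := τ₁) (le_max_left _ _) (B.move τ₁ τ q)
      (max_le (by positivity) hn')
    have habs : ∀ {r r'}, r ∈ Icc τ₁ τ → r' ∈ Icc τ₁ τ → |r - r'| ≤ B.h := by
      intro r r' hr hr'
      rw [abs_le]
      constructor <;> linarith [hr.1, hr.2, hr'.1, hr'.2]
    have hmem₁ : τ₁ ∈ Icc τ₁ τ := ⟨le_rfl, hτ₁⟩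
    have hmem : τ ∈ Icc τ₁ τ := ⟨hτ₁, le_rfl⟩
    have hstay := B.stay (habs hmem₁ hmem) _ hq.2
    refine ⟨_, hy.extend hα hK hZ hX (le_max_left _ _) B (τ' := τ) (by linarith) ?_ ?_, ?_⟩
    · rw [hyq]
      exact (B.move_mem_dom hstay).1
    · intro r hr
      rw [hyq, B.extChartAt_move hstay,
        B.flow.comp (habs hr hmem) (habs hmem₁ hmem) (habs hr hmem₁)]
      exact B.stay (habs hr hmem) _ hq.2
    · have h2 : B.move τ τ₁ (B.move τ₁ τ q) = q := by
        rw [B.move_move hstay (habs hmem hmem) (habs hmem₁ hmem) (habs hmem hmem₁),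
          B.move_self hq.1]
      split_ifs with hif
      · rw [le_antisymm hif hτ₁, hyq, ← le_antisymm hif hτ₁, B.move_self hq.1]
      · rw [hyq, h2]

variable [T2Space M] {T : ℝ} {η : ℝ → M → M} (hη : IsSolutionFlow α T Z X η)

include hη

theorem IsSolutionFlow.flowDomain_eq_univ {t : ℝ} (ht : t ∈ Icc 0 T) :
    flowDomain α Z X t = univ := by
  obtain ⟨h, h0, hB⟩ := exists_uniform_flowBox (α := α) (Z := Z) hα hK hZ hX
  obtain ⟨n, hn⟩ := exists_nat_ge (t / h)
  rw [div_le_iff₀ h0] at hn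
  induction n generalizing t with
  | zero =>
    obtain rfl : t = 0 := le_antisymm (by simpa using hn) ht.1
    exact flowDomain_zero hα hK hZ hX
  | succ n ih =>
    refine eq_univ_of_forall fun q => ?_
    set t₁ := max 0 (t - h)
    have ht₁ : t₁ ≤ t := max_le ht.1 (by linarith)
    have ht₂ : t - h ≤ t₁ := le_max_right _ _
    have ht₁' : t₁ ∈ Icc 0 T := ⟨le_max_left _ _, ht₁.trans ht.2⟩
    have hn' : t - h ≤ n * h := by push_cast at hn; linarith
    have hq : q ∈ flowDomain α Z X t₁ := by
      rw [ih ht₁' (max_le (by positivity) hn')]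
      trivial
    obtain ⟨p, B, hhB, hcore⟩ := hB (η t₁ q)
    refine (hη.eq_move hα hK hZ hX ht₁' ht B ?_ hq hcore).1
    rw [abs_le]
    constructor <;> linarith

theorem IsSolutionFlow.bijective {t : ℝ} (ht : t ∈ Icc 0 T) : Function.Bijective (η t) := by
  refine ⟨fun q q' h => hη.injOn hα hK hZ hX ht ?_ ?_ h, fun q => ?_⟩
  · rw [hη.flowDomain_eq_univ hα hK hZ hX ht]; trivial
  · rw [hη.flowDomain_eq_univ hα hK hZ hX ht]; trivial
  · obtain ⟨y, hy, hyq⟩ := exists_isYoungSolution_of_compactSpace hα hK hZ hX ht.1 q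
    exact ⟨y 0, by rw [hη.apply_eq hα hK hZ hX ht.2 hy ⟨ht.1, le_rfl⟩, hyq]⟩

end Compact

end Flow

end YoungFlow

namespace YoungFlow

/-! ### Local `C^{1,1}` diffeomorphisms of the manifold. -/

section LocalDiffeo

variable {m d : ℕ} {M : Type*} [TopologicalSpace M]
  [ChartedSpace (EuclideanSpace ℝ (Fin m)) M]

/-- The expression of `f : M → M` in the charts at `p` and `p'`. -/
noncomputable def chartExpr (m : ℕ) {M : Type*} [TopologicalSpace M]
    [ChartedSpace (EuclideanSpace ℝ (Fin m)) M] (p p' : M) (f : M → M) :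
    EuclideanSpace ℝ (Fin m) → EuclideanSpace ℝ (Fin m) :=
  extChartAt (𝓡 m) p' ∘ f ∘ (extChartAt (𝓡 m) p).symm

theorem chartExpr_extChartAt {p p' q : M} {f : M → M} (hq : q ∈ (extChartAt (𝓡 m) p).source) :
    chartExpr m p p' f (extChartAt (𝓡 m) p q) = extChartAt (𝓡 m) p' (f q) := by
  simp only [chartExpr, Function.comp_apply, (extChartAt (𝓡 m) p).left_inv hq]

/-- `f` is a local homeomorphism of class `C^{1,1}` near `q`, with an invertible derivative. -/
structure IsC11DiffeoAt (m : ℕ) {M : Type*} [TopologicalSpace M]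
    [ChartedSpace (EuclideanSpace ℝ (Fin m)) M] (f : M → M) (q : M) : Prop where
  continuousAt : ContinuousAt f q
  exists_chart : ∃ p p', q ∈ (extChartAt (𝓡 m) p).source ∧ f q ∈ (extChartAt (𝓡 m) p').source ∧
    C11At (chartExpr m p p' f) (extChartAt (𝓡 m) p q) ∧
    (fderiv ℝ (chartExpr m p p' f) (extChartAt (𝓡 m) p q)).IsInvertible

theorem eventually_symm_of_eventually {p q : M} (hq : q ∈ (extChartAt (𝓡 m) p).source) {P : M → Prop}
    (h : ∀ᶠ z in 𝓝 q, P z) :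
    ∀ᶠ y in 𝓝 (extChartAt (𝓡 m) p q), P ((extChartAt (𝓡 m) p).symm y) :=
  (continuousAt_extChartAt_symm' hq).eventually (by rwa [(extChartAt (𝓡 m) p).left_inv hq])

theorem isInvertible_of_comp {E F G : Type*} [AddCommGroup E] [Module ℝ E]
    [TopologicalSpace E] [AddCommGroup F] [Module ℝ F] [TopologicalSpace F] [AddCommGroup G]
    [Module ℝ G] [TopologicalSpace G]
    {A : F →L[ℝ] G} {B : E →L[ℝ] F} (hB : B.IsInvertible) (h : (A.comp B).IsInvertible) :
    A.IsInvertible := by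
  obtain ⟨e, rfl⟩ := hB
  obtain ⟨e', he'⟩ := h
  refine ⟨e.symm.trans e', ?_⟩
  ext v
  have := DFunLike.congr_fun he' (e.symm v)
  simpa using this

theorem isInvertible_of_comp_left {E F G : Type*} [AddCommGroup E] [Module ℝ E]
    [TopologicalSpace E] [AddCommGroup F] [Module ℝ F] [TopologicalSpace F] [AddCommGroup G]
    [Module ℝ G] [TopologicalSpace G]
    {A : F →L[ℝ] G} {B : E →L[ℝ] F} (hA : A.IsInvertible) (h : (A.comp B).IsInvertible) :
    B.IsInvertible := by
  obtain ⟨e, rfl⟩ := hA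
  obtain ⟨e', he'⟩ := h
  refine ⟨e'.trans e.symm, ?_⟩
  ext v
  have := DFunLike.congr_fun he' v
  simp only [ContinuousLinearEquiv.coe_coe, ContinuousLinearMap.comp_apply] at this
  simp [this]

variable [IsManifold (𝓡 m) ∞ M]

theorem contDiffAt_transition {p p' q : M} (hq : q ∈ (extChartAt (𝓡 m) p).source)
    (hq' : q ∈ (extChartAt (𝓡 m) p').source) :
    ContDiffAt ℝ ∞ (chartExpr m p p' id) (extChartAt (𝓡 m) p q) :=
  contDiffAt_comp_extChartAt_symm hq (contMDiffAt_extChartAt' (by rwa [← extChartAt_source (𝓡 m)]))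

theorem isInvertible_fderiv_transition {p p' q : M} (hq : q ∈ (extChartAt (𝓡 m) p).source)
    (hq' : q ∈ (extChartAt (𝓡 m) p').source) :
    (fderiv ℝ (chartExpr m p p' id) (extChartAt (𝓡 m) p q)).IsInvertible := by
  refine isInvertible_of_comp (isInvertible_vderiv_extChartAt hq) ?_
  have := vderiv_eq hq (mdifferentiableAt_extChartAt' hq')
  have h2 := isInvertible_vderiv_extChartAt hq'
  rw [this] at h2
  exact h2

theorem isInvertible_fderiv_comp {E F G : Type*} [NormedAddCommGroup E] [NormedSpace ℝ E]
    [NormedAddCommGroup F] [NormedSpace ℝ F] [NormedAddCommGroup G] [NormedSpace ℝ G]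
    {f : F → G} {g : E → F} {c : E} (hf : C11At f (g c)) (hg : C11At g c)
    (h1 : (fderiv ℝ f (g c)).IsInvertible) (h2 : (fderiv ℝ g c).IsInvertible) :
    (fderiv ℝ (f ∘ g) c).IsInvertible := by
  rw [fderiv_comp c hf.differentiableAt.self_of_nhds hg.differentiableAt.self_of_nhds]
  exact h1.comp h2

namespace IsC11DiffeoAt

variable {f g : M → M} {q : M}

omit [IsManifold (𝓡 m) ∞ M] in
theorem congr (h : IsC11DiffeoAt m f q) (hfg : f =ᶠ[𝓝 q] g) : IsC11DiffeoAt m g q := by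
  obtain ⟨p, p', h1, h2, h3, h4⟩ := h.exists_chart
  have he : chartExpr m p p' f =ᶠ[𝓝 (extChartAt (𝓡 m) p q)] chartExpr m p p' g := by
    filter_upwards [eventually_symm_of_eventually h1 hfg] with y hy
    exact congrArg (extChartAt (𝓡 m) p') hy
  refine ⟨h.continuousAt.congr hfg, p, p', h1, hfg.self_of_nhds ▸ h2, h3.congr he, ?_⟩
  rwa [← he.fderiv_eq]

/-- The definition provides one pair of charts; any other pair differs from it by smooth transition
maps with invertible derivatives. -/
theorem chart (h : IsC11DiffeoAt m f q) {p p' : M} (hp : q ∈ (extChartAt (𝓡 m) p).source)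
    (hp' : f q ∈ (extChartAt (𝓡 m) p').source) :
    C11At (chartExpr m p p' f) (extChartAt (𝓡 m) p q) ∧
      (fderiv ℝ (chartExpr m p p' f) (extChartAt (𝓡 m) p q)).IsInvertible := by
  obtain ⟨p₁, p₁', h1, h2, h3, h4⟩ := h.exists_chart
  have he : chartExpr m p₁' p' id ∘ chartExpr m p₁ p₁' f ∘ chartExpr m p p₁ id
      =ᶠ[𝓝 (extChartAt (𝓡 m) p q)] chartExpr m p p' f := by
    filter_upwards [eventually_symm_of_eventually hp
      ((isOpen_extChartAt_source (I := 𝓡 m) p₁).mem_nhds h1),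
      eventually_symm_of_eventually hp (h.continuousAt.eventually
        ((isOpen_extChartAt_source (I := 𝓡 m) p₁').mem_nhds h2))] with y hy hy'
    simp only [chartExpr, Function.comp_apply, id_eq, (extChartAt (𝓡 m) p₁).left_inv hy,
      (extChartAt (𝓡 m) p₁').left_inv hy']
  have e1 : chartExpr m p p₁ id (extChartAt (𝓡 m) p q) = extChartAt (𝓡 m) p₁ q :=
    chartExpr_extChartAt hp
  have a1 : C11At (chartExpr m p p₁ id) (extChartAt (𝓡 m) p q) :=
    (contDiffAt_transition hp h1).c11At
  have b1 := isInvertible_fderiv_transition hp h1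
  have e2 : (chartExpr m p₁ p₁' f ∘ chartExpr m p p₁ id) (extChartAt (𝓡 m) p q) =
      extChartAt (𝓡 m) p₁' (f q) := by
    rw [Function.comp_apply, e1, chartExpr_extChartAt h1]
  rw [← e1] at h3 h4
  have a2 := h3.comp a1
  have b2 := isInvertible_fderiv_comp h3 a1 h4 b1
  have a3 : C11At (chartExpr m p₁' p' id) (extChartAt (𝓡 m) p₁' (f q)) :=
    (contDiffAt_transition h2 hp').c11At
  have b3 := isInvertible_fderiv_transition h2 hp'
  rw [← e2] at a3 b3
  refine ⟨(a3.comp a2).congr he, ?_⟩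
  rw [← he.fderiv_eq]
  exact isInvertible_fderiv_comp a3 a2 b3 b2

theorem comp (hg : IsC11DiffeoAt m g (f q)) (hf : IsC11DiffeoAt m f q) :
    IsC11DiffeoAt m (g ∘ f) q := by
  refine ⟨hg.continuousAt.comp hf.continuousAt, ?_⟩
  obtain ⟨p, p', h1, h2, h3, h4⟩ := hf.exists_chart
  have h5 := mem_extChartAt_source (I := 𝓡 m) (g (f q))
  obtain ⟨h6, h7⟩ := hg.chart h2 h5
  refine ⟨p, g (f q), h1, h5, ?_⟩
  have he : chartExpr m p' (g (f q)) g ∘ chartExpr m p p' f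
      =ᶠ[𝓝 (extChartAt (𝓡 m) p q)] chartExpr m p (g (f q)) (g ∘ f) := by
    filter_upwards [eventually_symm_of_eventually h1 (hf.continuousAt.eventually
        ((isOpen_extChartAt_source (I := 𝓡 m) p').mem_nhds h2))] with y hy
    simp only [chartExpr, Function.comp_apply, (extChartAt (𝓡 m) p').left_inv hy]
  rw [← chartExpr_extChartAt h1] at h6 h7
  refine ⟨(h6.comp h3).congr he, ?_⟩
  rw [← he.fderiv_eq]
  exact isInvertible_fderiv_comp h6 h3 h7 h4

omit [IsManifold (𝓡 m) ∞ M] in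
theorem id (q : M) : IsC11DiffeoAt m (id : M → M) q := by
  have h1 := mem_extChartAt_source (I := 𝓡 m) q
  have he : _root_.id =ᶠ[𝓝 (extChartAt (𝓡 m) q q)] chartExpr m q q _root_.id := by
    filter_upwards [extChartAt_target_mem_nhds (I := 𝓡 m) q] with y hy
    exact ((extChartAt (𝓡 m) q).right_inv hy).symm
  refine ⟨continuousAt_id, q, q, h1, h1, (contDiffAt_id.c11At).congr he, ?_⟩
  rw [← he.fderiv_eq, fderiv_id]
  exact ⟨ContinuousLinearEquiv.refl ℝ _, rfl⟩

-- The inverse function theorem in charts: a `C^{1,1}` map is strictly differentiable, hence open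
-- where its derivative is invertible. This is the source of the openness of `η_t(D_t)`.
omit [IsManifold (𝓡 m) ∞ M] in
theorem map_nhds (h : IsC11DiffeoAt m f q) : map f (𝓝 q) = 𝓝 (f q) := by
  obtain ⟨p, p', h1, h2, h3, e, he⟩ := h.exists_chart
  have h4 := h3.hasStrictFDerivAt
  rw [← he] at h4
  have h5 := h4.map_nhds_eq_of_equiv
  rw [chartExpr_extChartAt h1, ← nhdsWithin_univ, ← (𝓡 m).range_eq_univ,
    ← map_extChartAt_nhds' h1, Filter.map_map] at h5
  have h6 : (extChartAt (𝓡 m) p').symm ∘ chartExpr m p p' f ∘ extChartAt (𝓡 m) p =ᶠ[𝓝 q] f := by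
    filter_upwards [(isOpen_extChartAt_source (I := 𝓡 m) p).mem_nhds h1,
      h.continuousAt.eventually ((isOpen_extChartAt_source (I := 𝓡 m) p').mem_nhds h2)] with z hz hz'
    simp only [chartExpr, Function.comp_apply, (extChartAt (𝓡 m) p).left_inv hz,
      (extChartAt (𝓡 m) p').left_inv hz']
  rw [← Filter.map_congr h6, ← Filter.map_map, h5, ← nhdsWithin_univ,
    ← (𝓡 m).range_eq_univ, map_extChartAt_symm_nhdsWithin_range' h2]

theorem mdifferentiableAt (h : IsC11DiffeoAt m f q) : MDifferentiableAt (𝓡 m) (𝓡 m) f q := by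
  obtain ⟨p, p', h1, h2, h3, -⟩ := h.exists_chart
  have h6 : f =ᶠ[𝓝 q] (extChartAt (𝓡 m) p').symm ∘ chartExpr m p p' f ∘ extChartAt (𝓡 m) p := by
    filter_upwards [(isOpen_extChartAt_source (I := 𝓡 m) p).mem_nhds h1,
      h.continuousAt.eventually ((isOpen_extChartAt_source (I := 𝓡 m) p').mem_nhds h2)] with z hz hz'
    simp only [chartExpr, Function.comp_apply, (extChartAt (𝓡 m) p).left_inv hz,
      (extChartAt (𝓡 m) p').left_inv hz']
  refine MDifferentiableAt.congr_of_eventuallyEq ?_ h6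
  refine MDifferentiableAt.comp (I' := 𝓘(ℝ, EuclideanSpace ℝ (Fin m))) q ?_
    (MDifferentiableAt.comp (I' := 𝓘(ℝ, EuclideanSpace ℝ (Fin m))) q
      (h3.differentiableAt.self_of_nhds.mdifferentiableAt) (mdifferentiableAt_extChartAt' h1))
  rw [Function.comp_apply, chartExpr_extChartAt h1]
  exact (contMDiffAt_extChartAt_symm ((extChartAt (𝓡 m) p').map_source h2)).mdifferentiableAt
    (by simp)

end IsC11DiffeoAt

theorem vderiv_comp_mfderiv {f : M → M} {p p' q : M} (hf : MDifferentiableAt (𝓡 m) (𝓡 m) f q)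
    (hp : q ∈ (extChartAt (𝓡 m) p).source) (hp' : f q ∈ (extChartAt (𝓡 m) p').source) :
    (vderiv m (extChartAt (𝓡 m) p') (f q)).comp (mfderiv (𝓡 m) (𝓡 m) f q) =
      (fderiv ℝ (chartExpr m p p' f) (extChartAt (𝓡 m) p q)).comp
        (vderiv m (extChartAt (𝓡 m) p) q) := by
  have h1 := mdifferentiableAt_extChartAt' hp'
  have h2 := vderiv_eq hp (h1.comp q hf)
  rw [vderiv, mfderiv_comp q h1 hf] at h2
  exact h2

theorem IsC11DiffeoAt.isInvertible_mfderiv {f : M → M} {q : M} (h : IsC11DiffeoAt m f q) :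
    (mfderiv (𝓡 m) (𝓡 m) f q).IsInvertible := by
  obtain ⟨p, p', h1, h2, h3, h4⟩ := h.exists_chart
  have h5 := vderiv_comp_mfderiv h.mdifferentiableAt h1 h2
  have h6 := h4.comp (isInvertible_vderiv_extChartAt h1)
  rw [← h5] at h6
  exact isInvertible_of_comp_left (isInvertible_vderiv_extChartAt h2) h6

/-- The flow runs in both directions of time, and the derivative of the backward map at the image
point is a two-sided inverse. -/
theorem RoughFlow.isInvertible_fderiv {E F : Type*} [NormedAddCommGroup E] [NormedSpace ℝ E]
    [NormedAddCommGroup F] [NormedSpace ℝ F] {a C h : ℝ} {Z : ℝ → F} {V : E → F →L[ℝ] E}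
    {Φ : ℝ → ℝ → E → E} {A : ℝ → ℝ → E → E →L[ℝ] E} (R : RoughFlow a C h Z V Φ A) {s t : ℝ}
    (hst : |t - s| ≤ h) (y : E) : (A t s y).IsInvertible := by
  have hts : |s - t| ≤ h := by rwa [abs_sub_comm]
  have h1 := R.fderiv_comp hts (Φ t s y)
  rw [R.leftInverse hst] at h1
  exact ContinuousLinearMap.IsInvertible.of_inverse h1 (R.fderiv_comp hst y)

theorem FlowBox.isC11DiffeoAt_move {a : ℝ} {Z : ℝ → EuclideanSpace ℝ (Fin d)}
    {X : (x : M) → (EuclideanSpace ℝ (Fin d) →L[ℝ] TangentSpace (𝓡 m) x)} {p : M}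
    (B : FlowBox a Z X p) {s t : ℝ} (hst : |t - s| ≤ B.h) {q : M} (hq : q ∈ B.core) :
    IsC11DiffeoAt m (B.move t s) q := by
  have hball := B.stay hst _ hq.2
  have he : B.Φ t s =ᶠ[𝓝 (extChartAt (𝓡 m) p q)] chartExpr m p p (B.move t s) := by
    filter_upwards [Metric.isOpen_ball.mem_nhds hq.2] with y hy
    have hy' := B.ball_subset (Metric.ball_subset_ball (by linarith [B.r_pos]) hy)
    simp only [chartExpr, Function.comp_apply, FlowBox.move, (extChartAt (𝓡 m) p).right_inv hy',
      (extChartAt (𝓡 m) p).right_inv (B.ball_subset (B.stay hst y hy))]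
  refine ⟨?_, p, p, hq.1, (B.move_mem_dom hball).1, (B.flow.c11At hst _).congr he, ?_⟩
  · exact ContinuousAt.comp (g := (extChartAt (𝓡 m) p).symm)
      (contMDiffAt_extChartAt_symm (B.ball_subset hball)).continuousAt
      (ContinuousAt.comp (B.flow.c11At hst _).continuousAt (continuousAt_extChartAt' hq.1))
  · rw [← he.fderiv_eq, B.flow.fderiv_eq hst]
    exact B.flow.isInvertible_fderiv hst _

end LocalDiffeo

/-! ### The flow is a local diffeomorphism on open domains. -/

section FlowDiffeo

variable {m d : ℕ} {M : Type*} [TopologicalSpace M]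
  [ChartedSpace (EuclideanSpace ℝ (Fin m)) M] [IsManifold (𝓡 m) ∞ M] [T2Space M]
  {α : ℝ≥0} {K T : ℝ} {Z : ℝ → EuclideanSpace ℝ (Fin d)}
  {X : (x : M) → (EuclideanSpace ℝ (Fin d) →L[ℝ] TangentSpace (𝓡 m) x)} {η : ℝ → M → M}
  (hα : 1 / 2 < (α : ℝ)) (hK : 0 ≤ K) (hZ : ∀ s t, ‖Z t - Z s‖ ≤ K * |t - s| ^ (α : ℝ))
  (hX : IsSmoothFields X) (hη : IsSolutionFlow α T Z X η)

include hα hK hZ hX hη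

theorem IsSolutionFlow.eventuallyEq_move {s t : ℝ} (hs : s ∈ Icc 0 T) (ht : t ∈ Icc 0 T) {p : M}
    (B : FlowBox (α : ℝ) Z X p) (hst : |t - s| ≤ B.h) {q : M} (hD : flowDomain α Z X s ∈ 𝓝 q)
    (hcont : ContinuousAt (η s) q) (hcore : η s q ∈ B.core) :
    ∀ᶠ z in 𝓝 q, z ∈ flowDomain α Z X t ∧ η t z = B.move t s (η s z) := by
  filter_upwards [hD, hcont.eventually (B.isOpen_core.mem_nhds hcore)] with z hz hz'
  exact hη.eq_move hα hK hZ hX hs ht B hst hz hz'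

theorem IsSolutionFlow.step {s t : ℝ} (hs : s ∈ Icc 0 T) (ht : t ∈ Icc 0 T) {p : M}
    (B : FlowBox (α : ℝ) Z X p) (hst : |t - s| ≤ B.h) {q : M} (hcore : η s q ∈ B.core)
    (h : flowDomain α Z X s ∈ 𝓝 q ∧ IsC11DiffeoAt m (η s) q) :
    flowDomain α Z X t ∈ 𝓝 q ∧ IsC11DiffeoAt m (η t) q := by
  have h1 := hη.eventuallyEq_move hα hK hZ hX hs ht B hst h.1 h.2.continuousAt hcore
  refine ⟨h1.mono fun _ hz => hz.1, ?_⟩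
  exact ((B.isC11DiffeoAt_move hst hcore).comp h.2).congr (h1.mono fun _ hz => hz.2.symm)

/-- The property holds at time `0`, where `η 0 = id`, and is carried along the orbit of `q` by
`step`. As `step` works in both directions of time, its truth is locally constant. -/
theorem IsSolutionFlow.isC11DiffeoAt {t : ℝ} (ht : t ∈ Icc 0 T) {q : M}
    (hq : q ∈ flowDomain α Z X t) : flowDomain α Z X t ∈ 𝓝 q ∧ IsC11DiffeoAt m (η t) q := by
  have hsol := (hη t ht q hq).1
  have hsub : ∀ {r}, r ∈ Icc 0 t → r ∈ Icc 0 T := fun hr => ⟨hr.1, hr.2.trans ht.2⟩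
  refine (iff_of_locally_const
    (P := fun r => flowDomain α Z X r ∈ 𝓝 q ∧ IsC11DiffeoAt m (η r) q) isPreconnected_Icc
    (fun r hr => ?_) ⟨le_rfl, ht.1⟩ ⟨ht.1, le_rfl⟩).1 ?_
  · obtain ⟨B⟩ := nonempty_flowBox hα hK hZ hX (η r q)
    filter_upwards [(hsol.1.1 r hr).eventually (B.isOpen_core.mem_nhds B.mem_core),
      self_mem_nhdsWithin, mem_nhdsWithin_of_mem_nhds (Metric.closedBall_mem_nhds r B.flow.h_pos)]
      with s h1 h2 h3
    have h3' : |s - r| ≤ B.h := h3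
    exact ⟨fun h => hη.step hα hK hZ hX (hsub h2) (hsub hr) B (by rwa [abs_sub_comm]) h1 h,
      fun h => hη.step hα hK hZ hX (hsub hr) (hsub h2) B h3' B.mem_core h⟩
  · rw [flowDomain_zero hα hK hZ hX]
    refine ⟨univ_mem, ?_⟩
    rw [show η 0 = id from funext fun z => hη.apply_zero hα hK hZ hX (ht.1.trans ht.2) z]
    exact IsC11DiffeoAt.id q

theorem IsSolutionFlow.isOpen_flowDomain {t : ℝ} (ht : t ∈ Icc 0 T) :
    IsOpen (flowDomain α Z X t) :=
  isOpen_iff_mem_nhds.2 fun _ hq => (hη.isC11DiffeoAt hα hK hZ hX ht hq).1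

theorem IsSolutionFlow.isOpen_image {t : ℝ} (ht : t ∈ Icc 0 T) :
    IsOpen (η t '' flowDomain α Z X t) := by
  rw [isOpen_iff_mem_nhds]
  rintro _ ⟨q, hq, rfl⟩
  obtain ⟨h1, h2⟩ := hη.isC11DiffeoAt hα hK hZ hX ht hq
  rw [← h2.map_nhds]
  exact image_mem_map h1

end FlowDiffeo

end YoungFlow

namespace YoungFlow

/-! ### Inverting a flow in a vector space. -/

section InverseExpansion

open Asymptotics

variable {E F G : Type*} [NormedAddCommGroup E] [NormedSpace ℝ E] [NormedAddCommGroup F]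
  [NormedSpace ℝ F] [NormedAddCommGroup G] [NormedSpace ℝ G] {a C h : ℝ} {Z : ℝ → F}
  {V : E → F →L[ℝ] E} {Φ : ℝ → ℝ → E → E} {A : ℝ → ℝ → E → E →L[ℝ] E}

/-- Increments of order `2a > 1` force a zero derivative, and a path with zero derivative on a
convex set is constant. -/
theorem eventually_eq_of_isBigO {u : ℝ → E} {S : Set ℝ} {t₀ : ℝ} (hS : Convex ℝ S) (ht₀ : t₀ ∈ S)
    (ha : 1 / 2 < a) (hu : (fun p : ℝ × ℝ => u p.1 - u p.2) =O[𝓝[S] t₀ ×ˢ 𝓝[S] t₀]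
      fun p => |p.1 - p.2| ^ (2 * a)) : ∀ᶠ t in 𝓝[S] t₀, u t = u t₀ := by
  obtain ⟨C, hC⟩ := hu.bound
  obtain ⟨ε, hε, hb⟩ := eventually_nhdsWithin_prod_self.1 hC
  have hconv : Convex ℝ (Metric.ball t₀ ε ∩ S) := (convex_ball _ _).inter hS
  have hder : ∀ s ∈ Metric.ball t₀ ε ∩ S,
      HasFDerivWithinAt u (0 : ℝ →L[ℝ] E) (Metric.ball t₀ ε ∩ S) s := by
    intro s hs
    rw [hasFDerivWithinAt_iff_isLittleO]
    have h1 : (fun t => u t - u s - (0 : ℝ →L[ℝ] E) (t - s)) =O[𝓝[Metric.ball t₀ ε ∩ S] s]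
        fun t => |t - s| ^ (2 * a) := by
      refine IsBigO.of_bound C ?_
      filter_upwards [self_mem_nhdsWithin] with t ht
      simpa using hb s hs t ht
    refine h1.trans_isLittleO (IsLittleO.mono ?_ nhdsWithin_le_nhds)
    have h2 : ContinuousAt (fun t => |t - s| ^ (2 * a - 1)) s :=
      ContinuousAt.rpow_const (by fun_prop) (Or.inr (by linarith))
    have h3 : Tendsto (fun t => |t - s| ^ (2 * a - 1)) (𝓝 s) (𝓝 0) := by
      have := h2.tendsto
      rwa [sub_self, abs_zero, Real.zero_rpow (by linarith)] at this
    have h4 := ((isLittleO_one_iff ℝ).2 h3).mul_isBigO (isBigO_refl (fun t => |t - s|) (𝓝 s))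
    simp only [one_mul] at h4
    refine (h4.congr_left fun t => ?_).of_abs_right
    rw [← Real.rpow_add_one' (abs_nonneg _) (by linarith)]
    ring_nf
  have h0 : t₀ ∈ Metric.ball t₀ ε ∩ S := ⟨Metric.mem_ball_self hε, ht₀⟩
  filter_upwards [inter_mem_nhdsWithin S (Metric.ball_mem_nhds t₀ hε)] with t ht
  have := hconv.norm_image_sub_le_of_norm_hasFDerivWithin_le (C := 0) hder (by simp) h0 ht.symm
  rw [zero_mul] at this
  exact sub_eq_zero.1 (norm_le_zero_iff.1 this)

/-- Solving `g (z t) = u t` for a local diffeomorphism `g`. -/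
theorem HasExpansion.of_comp [CompleteSpace E] {Z : ℝ → F} {S : Set ℝ} {t₀ : ℝ} {z : ℝ → E}
    {Q : ℝ → F →L[ℝ] G} {g : E → G} (ha : 0 < a) (ht₀ : t₀ ∈ S)
    (hz : ContinuousWithinAt z S t₀) (hg : C11At g (z t₀)) (hinv : (fderiv ℝ g (z t₀)).IsInvertible)
    (h : HasExpansion a Z S t₀ (fun t => g (z t)) Q) :
    HasExpansion a Z S t₀ z fun t => (fderiv ℝ g (z t)).inverse.comp (Q t) := by
  have hz2 : Tendsto (fun p : ℝ × ℝ => (z p.1, z p.2)) (𝓝[S] t₀ ×ˢ 𝓝[S] t₀)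
      (𝓝 (z t₀, z t₀)) := by
    rw [nhds_prod_eq]
    exact hz.tendsto.prodMap hz.tendsto
  -- An invertible strict derivative gives `z p.1 - z p.2 = O(g (z p.1) - g (z p.2))`, so Hölder
  -- regularity of `z` follows from mere continuity of `z` and that of `g ∘ z`.
  have hh : IsHolderNear a S t₀ z := by
    obtain ⟨e, he⟩ := hinv
    have h1 := hg.hasStrictFDerivAt
    rw [← he] at h1
    have h2 := h1.isLittleO.comp_tendsto hz2
    have h3 := e.isBigO_comp_rev (fun p : ℝ × ℝ => z p.1 - z p.2) (𝓝[S] t₀ ×ˢ 𝓝[S] t₀)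
    have h4 := (h2.trans_isBigO h3).right_isBigO_add
    have h5 := h3.trans (h4.congr_right (g₂ := fun p : ℝ × ℝ => g (z p.1) - g (z p.2))
      fun p => by simp)
    exact h5.trans h.holder
  have hd : IsHolderNear a S t₀ fun t => fderiv ℝ g (z t) := hh.comp_of_isBigO ha ht₀ hg.lip
  have hi := hd.inverse ha ht₀ hinv
  refine ⟨hh, hi.clm_comp h.holder' ha ht₀, ?_⟩
  have hev : ∀ᶠ p : ℝ × ℝ in 𝓝[S] t₀ ×ˢ 𝓝[S] t₀, (fderiv ℝ g (z p.2)).IsInvertible := by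
    obtain ⟨e, he⟩ := hinv
    have := (hd.tendsto ha ht₀).comp (tendsto_snd (f := 𝓝[S] t₀))
    refine this.eventually ?_
    rw [← he]
    exact ContinuousLinearEquiv.nhds e
  have b1 := isBigO_clm_apply (hi.isBigO_one_snd ha ht₀) h.expand
  have b2 : (fun p : ℝ × ℝ => g (z p.1) - g (z p.2) - fderiv ℝ g (z p.2) (z p.1 - z p.2))
      =O[𝓝[S] t₀ ×ˢ 𝓝[S] t₀] fun p => |p.1 - p.2| ^ (2 * a) := by
    refine (hg.taylor.comp_tendsto hz2).trans ?_
    rw [rpow_two_mul_eq ha]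
    simp only [← sq]
    exact (IsBigO.norm_left hh).pow 2
  have b3 := isBigO_clm_apply (hi.isBigO_one_snd ha ht₀) b2
  simp only [one_mul] at b1 b3
  refine (b1.sub b3).congr' ?_ EventuallyEq.rfl
  filter_upwards [hev] with p hp
  obtain ⟨e, he⟩ := hp
  simp only [← he, ContinuousLinearMap.inverse_equiv, map_sub, ContinuousLinearEquiv.coe_coe,
    ContinuousLinearEquiv.symm_apply_apply, ContinuousLinearMap.comp_apply]
  abel

namespace RoughFlow

variable (R : RoughFlow a C h Z V Φ A)

include R

theorem taylor {s t : ℝ} (hst : |t - s| ≤ h) (y y' : E) :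
    ‖Φ t s y - Φ t s y' - A t s y' (y - y')‖ ≤ C * ‖y - y'‖ ^ 2 := by
  have := (convex_closedBall y' ‖y - y'‖).norm_image_sub_le_of_norm_hasFDerivWithin_le'
    (f := Φ t s) (f' := A t s) (φ := A t s y') (C := C * ‖y - y'‖) (x := y') (y := y)
    (fun z _ => (R.hasFDerivAt hst z).hasFDerivWithinAt) (fun z hz => ?_)
    (Metric.mem_closedBall_self (norm_nonneg _)) (by simp [dist_eq_norm])
  · linarith
  · refine (R.fderiv_lip hst z y').trans (mul_le_mul_of_nonneg_left ?_ R.C_nonneg)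
    rwa [← dist_eq_norm]

theorem norm_fderiv_le {s t : ℝ} (hst : |t - s| ≤ h) (y : E) : ‖A t s y‖ ≤ 1 + C * h ^ a := by
  have h1 := R.fderiv_near hst y
  have h2 : |t - s| ^ a ≤ h ^ a := Real.rpow_le_rpow (abs_nonneg _) hst R.a_pos.le
  have h3 := mul_le_mul_of_nonneg_left h2 R.C_nonneg
  have h4 : A t s y = (A t s y - ContinuousLinearMap.id ℝ E) + ContinuousLinearMap.id ℝ E := by abel
  rw [h4]
  linarith [norm_add_le (A t s y - ContinuousLinearMap.id ℝ E) (ContinuousLinearMap.id ℝ E),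
    ContinuousLinearMap.norm_id_le (𝕜 := ℝ) (E := E)]

theorem fderiv_comp_flow {s u t : ℝ} (h1 : |t - s| ≤ h) (h2 : |u - s| ≤ h) (h3 : |t - u| ≤ h)
    (y : E) : A t s y = (A t u (Φ u s y)).comp (A u s y) := by
  have h4 := (R.hasFDerivAt h3 (Φ u s y)).comp y (R.hasFDerivAt h2 y)
  have h5 : Φ t u ∘ Φ u s = Φ t s := funext fun z => R.comp h1 h2 h3 z
  rw [h5] at h4
  exact (R.hasFDerivAt h1 y).unique h4

variable {S : Set ℝ} {t₀ : ℝ} {u : ℝ → E}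

omit R in
theorem _root_.YoungFlow.eventually_abs_sub_base (hh : 0 < h) :
    ∀ᶠ p : ℝ × ℝ in 𝓝[S] t₀ ×ˢ 𝓝[S] t₀, |p.1 - t₀| ≤ h ∧ |p.2 - t₀| ≤ h := by
  have h1 : ∀ᶠ t in 𝓝[S] t₀, |t - t₀| ≤ h :=
    mem_nhdsWithin_of_mem_nhds (Metric.closedBall_mem_nhds t₀ hh)
  exact prod_mem_prod h1 h1

theorem isHolderNear_flow (hu : IsHolderNear a S t₀ u) :
    IsHolderNear a S t₀ fun s => Φ s t₀ (u s) := by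
  obtain ⟨D, hD⟩ := IsBigO.bound hu
  refine IsBigO.of_bound (C + C * D) ?_
  filter_upwards [hD, eventually_abs_sub_le R.h_pos, eventually_abs_sub_base R.h_pos]
    with p h1 h2 h3
  have b1 := R.near h2 (Φ p.2 t₀ (u p.1))
  rw [R.comp h3.1 h3.2 h2] at b1
  have b2 := (R.lip h3.2 (u p.1) (u p.2)).trans (mul_le_mul_of_nonneg_left h1 R.C_nonneg)
  have b3 := norm_sub_le_norm_sub_add_norm_sub (Φ p.1 t₀ (u p.1)) (Φ p.2 t₀ (u p.1))
    (Φ p.2 t₀ (u p.2))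
  rw [Real.norm_of_nonneg (by positivity)] at b2 ⊢
  linarith

/-- Regularity of `A t₀ s` in the initial time `s` comes from the cocycle law: `A t₀ p.1` is `A t₀
p.2` composed with `A p.2 p.1`, and the latter is close to the identity by `fderiv_near`. -/
theorem isHolderNear_fderiv {v : ℝ → E} (hv : IsHolderNear a S t₀ v) :
    IsHolderNear a S t₀ fun s => A t₀ s (v s) := by
  obtain ⟨D, hD⟩ := IsBigO.bound hv
  refine IsBigO.of_bound ((1 + C * h ^ a) * C + C * (C + D)) ?_
  filter_upwards [hD, eventually_abs_sub_le R.h_pos, eventually_abs_sub_base R.h_pos]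
    with p h1 h2 h3
  have h2' : |p.2 - p.1| ≤ h := by rwa [abs_sub_comm]
  have h31 : |t₀ - p.1| ≤ h := by rw [abs_sub_comm]; exact h3.1
  have h32 : |t₀ - p.2| ≤ h := by rw [abs_sub_comm]; exact h3.2
  have e : A t₀ p.1 (v p.1) - A t₀ p.2 (v p.2) =
      (A t₀ p.2 (Φ p.2 p.1 (v p.1))).comp (A p.2 p.1 (v p.1) - ContinuousLinearMap.id ℝ E) +
        (A t₀ p.2 (Φ p.2 p.1 (v p.1)) - A t₀ p.2 (v p.2)) := by
    rw [R.fderiv_comp_flow h31 h2' h32, ContinuousLinearMap.comp_sub, ContinuousLinearMap.comp_id]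
    abel
  have n1 := R.near h2' (v p.1)
  have n2 := R.fderiv_near h2' (v p.1)
  rw [abs_sub_comm p.2 p.1] at n1 n2
  have n3 := R.fderiv_lip h32 (Φ p.2 p.1 (v p.1)) (v p.2)
  have n4 := norm_sub_le_norm_sub_add_norm_sub (Φ p.2 p.1 (v p.1)) (v p.1) (v p.2)
  have n5 := R.norm_fderiv_le h32 (Φ p.2 p.1 (v p.1))
  rw [Real.norm_of_nonneg (by positivity)] at h1 ⊢
  have hr : 0 ≤ |p.1 - p.2| ^ a := by positivity
  have n6 : ‖Φ p.2 p.1 (v p.1) - v p.2‖ ≤ (C + D) * |p.1 - p.2| ^ a := by linarith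
  have n7 := mul_le_mul_of_nonneg_left n6 R.C_nonneg
  have n8 := ContinuousLinearMap.opNorm_comp_le (A t₀ p.2 (Φ p.2 p.1 (v p.1)))
    (A p.2 p.1 (v p.1) - ContinuousLinearMap.id ℝ E)
  have n9 := mul_le_mul n5 n2 (norm_nonneg _) ((norm_nonneg _).trans n5)
  rw [e]
  refine (norm_add_le _ _).trans ?_
  linarith

theorem isHolderNear_coeff (hV : ContDiff ℝ ∞ V) (ht₀ : t₀ ∈ S) {v : ℝ → E}
    (hv : IsHolderNear a S t₀ v) : IsHolderNear a S t₀ fun s => -(A t₀ s (v s)).comp (V (v s)) :=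
  ((R.isHolderNear_fderiv hv).clm_comp (hv.comp_contDiffAt R.a_pos ht₀
    (hV.contDiffAt.of_le (by simp))) R.a_pos ht₀).neg

/-- If `u` is driven by the pull back of `-V` by the flow, then the image of `u` by the flow is
constant. -/
theorem eventually_flow_eq (hV : ContDiff ℝ ∞ V) (hS : Convex ℝ S) (ht₀ : t₀ ∈ S)
    (hZ : IsHolderNear a S t₀ Z)
    (hu : HasExpansion a Z S t₀ u fun s => -(A t₀ s (Φ s t₀ (u s))).comp (V (Φ s t₀ (u s)))) :
    ∀ᶠ t in 𝓝[S] t₀, Φ t t₀ (u t) = Φ t₀ t₀ (u t₀) := by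
  have ha := R.a_pos
  have hv := R.isHolderNear_flow hu.holder
  refine eventually_eq_of_isBigO (u := fun t => Φ t t₀ (u t)) hS ht₀ R.half_lt ?_
  have hev := (eventually_abs_sub_le (S := S) (t₀ := t₀) R.h_pos).and
    (eventually_abs_sub_base R.h_pos)
  -- A discrete product rule: `b1` moves the time, `b2` moves the point, `b3` inserts the expansion
  -- of `u`, and `b4` changes the argument of `V`. Since `A p.2 t₀` and `A t₀ p.2` are inverse to
  -- each other, the leading terms `V dZ` and `-V dZ` cancel.
  have b1 : (fun p : ℝ × ℝ => Φ p.1 t₀ (u p.1) - Φ p.2 t₀ (u p.1) -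
      V (Φ p.2 t₀ (u p.1)) (Z p.1 - Z p.2)) =O[𝓝[S] t₀ ×ˢ 𝓝[S] t₀]
      fun p => |p.1 - p.2| ^ (2 * a) := by
    refine IsBigO.of_bound C ?_
    filter_upwards [hev] with p hp
    rw [← R.comp hp.2.1 hp.2.2 hp.1, Real.norm_of_nonneg (by positivity)]
    exact R.davie hp.1 _
  have b2 : (fun p : ℝ × ℝ => Φ p.2 t₀ (u p.1) - Φ p.2 t₀ (u p.2) -
      A p.2 t₀ (u p.2) (u p.1 - u p.2)) =O[𝓝[S] t₀ ×ˢ 𝓝[S] t₀]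
      fun p => |p.1 - p.2| ^ (2 * a) := by
    have : (fun p : ℝ × ℝ => ‖u p.1 - u p.2‖ ^ 2) =O[𝓝[S] t₀ ×ˢ 𝓝[S] t₀]
        fun p => |p.1 - p.2| ^ (2 * a) := by
      rw [rpow_two_mul_eq ha]
      simp only [← sq]
      exact (IsBigO.norm_left hu.holder).pow 2
    refine (IsBigO.of_bound C ?_).trans this
    filter_upwards [hev] with p hp
    rw [Real.norm_of_nonneg (by positivity)]
    exact R.taylor hp.2.2 _ _
  have b3 : (fun p : ℝ × ℝ => A p.2 t₀ (u p.2) (u p.1 - u p.2 -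
      (-(A t₀ p.2 (Φ p.2 t₀ (u p.2))).comp (V (Φ p.2 t₀ (u p.2)))) (Z p.1 - Z p.2)))
      =O[𝓝[S] t₀ ×ˢ 𝓝[S] t₀] fun p => |p.1 - p.2| ^ (2 * a) := by
    refine (IsBigO.of_bound (1 + C * h ^ a) ?_).trans hu.expand
    filter_upwards [hev] with p hp
    exact ContinuousLinearMap.le_of_opNorm_le _ (R.norm_fderiv_le hp.2.2 _) _
  have b4 : (fun p : ℝ × ℝ => (V (Φ p.2 t₀ (u p.1)) - V (Φ p.2 t₀ (u p.2))) (Z p.1 - Z p.2))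
      =O[𝓝[S] t₀ ×ˢ 𝓝[S] t₀] fun p => |p.1 - p.2| ^ (2 * a) := by
    have h1 : (fun p : ℝ × ℝ => Φ p.2 t₀ (u p.1) - Φ p.2 t₀ (u p.2)) =O[𝓝[S] t₀ ×ˢ 𝓝[S] t₀]
        fun p => |p.1 - p.2| ^ a := by
      refine (IsBigO.of_bound C ?_).trans hu.holder
      filter_upwards [hev] with p hp
      exact R.lip hp.2.2 _ _
    have h2 := ((hv.tendsto ha ht₀).comp (tendsto_snd (f := 𝓝[S] t₀)))
    have h3 := (h1.trans_tendsto (tendsto_rpow_abs_sub ha)).add h2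
    simp only [Function.comp_apply, sub_add_cancel, zero_add] at h3
    have h4 := ((hV.contDiffAt (x := Φ t₀ t₀ (u t₀))).hasStrictFDerivAt
      (by simp)).isBigO_sub.comp_tendsto (h3.prodMk_nhds h2)
    rw [rpow_two_mul_eq ha]
    exact isBigO_clm_apply (h4.trans h1) hZ
  refine (((b1.add b2).add b3).add b4).congr' ?_ EventuallyEq.rfl
  filter_upwards [hev] with p hp
  have h32 : |t₀ - p.2| ≤ h := by rw [abs_sub_comm]; exact hp.2.2
  have e := R.fderiv_comp h32 (Φ p.2 t₀ (u p.2))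
  rw [R.leftInverse hp.2.2] at e
  have e' := DFunLike.congr_fun e (V (Φ p.2 t₀ (u p.2)) (Z p.1 - Z p.2))
  simp only [ContinuousLinearMap.comp_apply, ContinuousLinearMap.id_apply] at e'
  generalize Z p.1 - Z p.2 = ζ at e' ⊢
  simp only [map_sub, neg_apply, ContinuousLinearMap.comp_apply, map_neg, e', sub_apply]
  abel

/-- Conversely, a path whose image by the flow is constant is driven by the pull back of `-V`. -/
theorem hasExpansion_of_flow_eq (hV : ContDiff ℝ ∞ V) (ht₀ : t₀ ∈ S) (hZ : IsHolderNear a S t₀ Z)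
    {c : E} (hu : ∀ᶠ t in 𝓝[S] t₀, Φ t t₀ (u t) = c) :
    HasExpansion a Z S t₀ u fun s => -(A t₀ s (Φ s t₀ (u s))).comp (V (Φ s t₀ (u s))) := by
  have ha := R.a_pos
  have hd : ∀ᶠ t in 𝓝[S] t₀, |t - t₀| ≤ h :=
    mem_nhdsWithin_of_mem_nhds (Metric.closedBall_mem_nhds t₀ R.h_pos)
  have hev := (eventually_abs_sub_le (S := S) (t₀ := t₀) R.h_pos).and
    (eventually_abs_sub_base R.h_pos)
  -- Inverting the flow gives `u s = Φ t₀ s c`. Dependence on the initial time is turned into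
  -- dependence on the point by `Φ t₀ p.1 c = Φ t₀ p.2 (Φ p.2 p.1 c)`, to which Davie's estimate and
  -- Taylor's formula apply. The sign comes from `Z p.2 - Z p.1`.
  suffices h : HasExpansion a Z S t₀ (fun s => Φ t₀ s c) fun s => -(A t₀ s c).comp (V c) by
    refine h.congr ?_ ?_
    · filter_upwards [hu, hd] with t h1 h2
      rw [← h1, R.leftInverse h2]
    · filter_upwards [hu] with t h1
      rw [h1]
  have b1 : (fun p : ℝ × ℝ => Φ p.2 p.1 c - c) =O[𝓝[S] t₀ ×ˢ 𝓝[S] t₀]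
      fun p => |p.1 - p.2| ^ a := by
    refine IsBigO.of_bound C ?_
    filter_upwards [hev] with p hp
    rw [Real.norm_of_nonneg (by positivity), abs_sub_comm]
    exact R.near (by rw [abs_sub_comm]; exact hp.1) c
  have b2 : (fun p : ℝ × ℝ => Φ p.2 p.1 c - c - V c (Z p.2 - Z p.1)) =O[𝓝[S] t₀ ×ˢ 𝓝[S] t₀]
      fun p => |p.1 - p.2| ^ (2 * a) := by
    refine IsBigO.of_bound C ?_
    filter_upwards [hev] with p hp
    rw [Real.norm_of_nonneg (by positivity), abs_sub_comm p.1]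
    exact R.davie (by rw [abs_sub_comm]; exact hp.1) c
  have b3 : (fun p : ℝ × ℝ => A t₀ p.2 c (Φ p.2 p.1 c - c - V c (Z p.2 - Z p.1)))
      =O[𝓝[S] t₀ ×ˢ 𝓝[S] t₀] fun p => |p.1 - p.2| ^ (2 * a) := by
    refine (IsBigO.of_bound (1 + C * h ^ a) ?_).trans b2
    filter_upwards [hev] with p hp
    exact ContinuousLinearMap.le_of_opNorm_le _
      (R.norm_fderiv_le (by rw [abs_sub_comm]; exact hp.2.2) _) _
  have b4 : (fun p : ℝ × ℝ => Φ t₀ p.2 (Φ p.2 p.1 c) - Φ t₀ p.2 c -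
      A t₀ p.2 c (Φ p.2 p.1 c - c)) =O[𝓝[S] t₀ ×ˢ 𝓝[S] t₀] fun p => |p.1 - p.2| ^ (2 * a) := by
    have : (fun p : ℝ × ℝ => ‖Φ p.2 p.1 c - c‖ ^ 2) =O[𝓝[S] t₀ ×ˢ 𝓝[S] t₀]
        fun p => |p.1 - p.2| ^ (2 * a) := by
      rw [rpow_two_mul_eq ha]
      simp only [← sq]
      exact (IsBigO.norm_left b1).pow 2
    refine (IsBigO.of_bound C ?_).trans this
    filter_upwards [hev] with p hp
    rw [Real.norm_of_nonneg (by positivity)]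
    exact R.taylor (by rw [abs_sub_comm]; exact hp.2.2) _ _
  have hA := R.isHolderNear_coeff hV ht₀ (IsHolderNear.const (a := a) (S := S) (t₀ := t₀) c)
  have b5 : (fun p : ℝ × ℝ => Φ t₀ p.1 c - Φ t₀ p.2 c - (-(A t₀ p.2 c).comp (V c)) (Z p.1 - Z p.2))
      =O[𝓝[S] t₀ ×ˢ 𝓝[S] t₀] fun p => |p.1 - p.2| ^ (2 * a) := by
    refine (b3.add b4).congr' ?_ EventuallyEq.rfl
    filter_upwards [hev] with p hp
    rw [R.comp (by rw [abs_sub_comm]; exact hp.2.1) (by rw [abs_sub_comm]; exact hp.1)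
      (by rw [abs_sub_comm]; exact hp.2.2)]
    simp only [map_sub, neg_apply, ContinuousLinearMap.comp_apply]
    abel
  have b6 := isBigO_clm_apply (hA.isBigO_one_snd ha ht₀) hZ
  simp only [one_mul] at b6
  refine ⟨((b5.trans (isBigO_rpow_two_mul ha)).add b6).congr_left fun p => ?_, hA, b5⟩
  abel

end RoughFlow

end InverseExpansion

end YoungFlow

namespace YoungFlow

/-! ### The equation of the inverse flow on the manifold. -/

section InverseFlow

variable {m d : ℕ} {M : Type*} [TopologicalSpace M]
  [ChartedSpace (EuclideanSpace ℝ (Fin m)) M] [IsManifold (𝓡 m) ∞ M]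

/-- The coefficient of the equation of the inverse flow, in the chart at `p`. -/
theorem vderiv_comp_inverseField
    {X : (x : M) → (EuclideanSpace ℝ (Fin d) →L[ℝ] TangentSpace (𝓡 m) x)} {η : ℝ → M → M}
    {s : ℝ} {p p' q : M} (h : IsC11DiffeoAt m (η s) q) (hp : q ∈ (extChartAt (𝓡 m) p).source)
    (hp' : η s q ∈ (extChartAt (𝓡 m) p').source) :
    (vderiv m (extChartAt (𝓡 m) p) q).comp (inverseField X η s q) =
      -((fderiv ℝ (chartExpr m p p' (η s)) (extChartAt (𝓡 m) p q)).inverse.comp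
        (chartField X p' (extChartAt (𝓡 m) p' (η s q)))) := by
  have h1 := vderiv_comp_mfderiv h.mdifferentiableAt hp hp'
  rw [chartField_extChartAt X hp', inverseField]
  obtain ⟨e, he⟩ := h.isInvertible_mfderiv
  obtain ⟨D, hD⟩ := (h.chart hp hp').2
  rw [← he, ← hD] at h1 ⊢
  rw [ContinuousLinearMap.inverse_equiv, ContinuousLinearMap.inverse_equiv]
  ext1 v
  have h2 := DFunLike.congr_fun h1 (e.symm (X (η s q) v))
  simp only [ContinuousLinearMap.comp_apply, ContinuousLinearEquiv.coe_coe,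
    ContinuousLinearEquiv.apply_symm_apply] at h2
  simp only [ContinuousLinearMap.comp_apply, neg_apply, map_neg, ContinuousLinearEquiv.coe_coe,
    h2, ContinuousLinearEquiv.symm_apply_apply]

variable [T2Space M]
  {α : ℝ≥0} {K T τ : ℝ} {Z : ℝ → EuclideanSpace ℝ (Fin d)}
  {X : (x : M) → (EuclideanSpace ℝ (Fin d) →L[ℝ] TangentSpace (𝓡 m) x)} {η : ℝ → M → M}
  {z : ℝ → M}
  (hα : 1 / 2 < (α : ℝ)) (hK : 0 ≤ K) (hZ : ∀ s t, ‖Z t - Z s‖ ≤ K * |t - s| ^ (α : ℝ))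
  (hX : IsSmoothFields X) (hη : IsSolutionFlow α T Z X η)

theorem isHolderNear_of_forall_norm_le {a : ℝ} {E : Type*} [NormedAddCommGroup E] {K : ℝ}
    {Z : ℝ → E} (hZ : ∀ s t, ‖Z t - Z s‖ ≤ K * |t - s| ^ a) (S : Set ℝ) (t₀ : ℝ) :
    IsHolderNear a S t₀ Z :=
  Asymptotics.IsBigO.of_bound K (Eventually.of_forall fun p => by
    rw [Real.norm_of_nonneg (by positivity)]; exact hZ p.2 p.1)

include hα hK hZ hX hη

/-- Near a time `t₀`, the flow and the coefficient of the equation of its inverse along a path `z`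
are expressed in charts by means of the flow box at `η t₀ (z t₀)`. -/
theorem IsSolutionFlow.eventually_chart {t₀ : ℝ} (ht₀ : t₀ ∈ Icc 0 τ) (hτ : τ ≤ T)
    (hz : ContinuousWithinAt z (Icc 0 τ) t₀) (hD : z t₀ ∈ flowDomain α Z X t₀)
    (B : FlowBox (α : ℝ) Z X (η t₀ (z t₀))) :
    ∀ᶠ s in 𝓝[Icc 0 τ] t₀,
      η s (z s) ∈ (extChartAt (𝓡 m) (η t₀ (z t₀))).source ∧
      extChartAt (𝓡 m) (η t₀ (z t₀)) (η s (z s)) =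
        B.Φ s t₀ (chartExpr m (z t₀) (η t₀ (z t₀)) (η t₀) (extChartAt (𝓡 m) (z t₀) (z s))) ∧
      (vderiv m (extChartAt (𝓡 m) (z t₀)) (z s)).comp (inverseField X η s (z s)) =
        (fderiv ℝ (chartExpr m (z t₀) (η t₀ (z t₀)) (η t₀))
          (extChartAt (𝓡 m) (z t₀) (z s))).inverse.comp
        (-(B.A t₀ s (extChartAt (𝓡 m) (η t₀ (z t₀)) (η s (z s)))).comp
          (B.V (extChartAt (𝓡 m) (η t₀ (z t₀)) (η s (z s))))) := by
  have hsub : ∀ {r}, r ∈ Icc 0 τ → r ∈ Icc 0 T := fun hr => ⟨hr.1, hr.2.trans hτ⟩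
  obtain ⟨n1, n2⟩ := hη.isC11DiffeoAt hα hK hZ hX (hsub ht₀) hD
  filter_upwards [self_mem_nhdsWithin,
    mem_nhdsWithin_of_mem_nhds (Metric.closedBall_mem_nhds t₀ B.flow.h_pos),
    hz.eventually ((isOpen_extChartAt_source (I := 𝓡 m) (z t₀)).mem_nhds (mem_extChartAt_source _)),
    hz.eventually n1,
    hz.eventually (n2.continuousAt.eventually (B.isOpen_core.mem_nhds B.mem_core))]
    with s hs hst hsrc hDs hcore
  have hst' : |s - t₀| ≤ B.h := hst
  have hst'' : |t₀ - s| ≤ B.h := by rwa [abs_sub_comm]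
  obtain ⟨hDs', n3⟩ := hη.isC11DiffeoAt hα hK hZ hX (hsub ht₀) hDs
  have hev := hη.eventuallyEq_move hα hK hZ hX (hsub ht₀) (hsub hs) B hst' hDs' n3.continuousAt hcore
  obtain ⟨hDss, heq⟩ := hev.self_of_nhds
  have n4 := (hη.isC11DiffeoAt hα hK hZ hX (hsub hs) hDss).2
  have hball := B.stay hst' _ hcore.2
  have hdom : η s (z s) ∈ B.dom := by rw [heq]; exact B.move_mem_dom hball
  have hu : chartExpr m (z t₀) (η t₀ (z t₀)) (η t₀) (extChartAt (𝓡 m) (z t₀) (z s)) =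
      extChartAt (𝓡 m) (η t₀ (z t₀)) (η t₀ (z s)) := chartExpr_extChartAt hsrc
  have hv : extChartAt (𝓡 m) (η t₀ (z t₀)) (η s (z s)) =
      B.Φ s t₀ (chartExpr m (z t₀) (η t₀ (z t₀)) (η t₀) (extChartAt (𝓡 m) (z t₀) (z s))) := by
    rw [heq, B.extChartAt_move hball, hu]
  refine ⟨hdom.1, hv, ?_⟩
  obtain ⟨c1, c2⟩ := n3.chart hsrc hcore.1
  -- The factorisation of `η s` through `η t₀` holds on a neighbourhood of `z s` with `s` fixed, so
  -- it may be differentiated in space.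
  have he : chartExpr m (z t₀) (η t₀ (z t₀)) (η s) =ᶠ[𝓝 (extChartAt (𝓡 m) (z t₀) (z s))]
      B.Φ s t₀ ∘ chartExpr m (z t₀) (η t₀ (z t₀)) (η t₀) := by
    filter_upwards [eventually_symm_of_eventually hsrc hev, eventually_symm_of_eventually hsrc
      (n3.continuousAt.eventually (B.isOpen_core.mem_nhds hcore))] with y h1 h2
    simp only [chartExpr, Function.comp_apply, h1.2]
    exact B.extChartAt_move (B.stay hst' _ h2.2)
  have hfd : fderiv ℝ (chartExpr m (z t₀) (η t₀ (z t₀)) (η s)) (extChartAt (𝓡 m) (z t₀) (z s)) =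
      (B.A s t₀ (chartExpr m (z t₀) (η t₀ (z t₀)) (η t₀) (extChartAt (𝓡 m) (z t₀) (z s)))).comp
        (fderiv ℝ (chartExpr m (z t₀) (η t₀ (z t₀)) (η t₀)) (extChartAt (𝓡 m) (z t₀) (z s))) := by
    rw [he.fderiv_eq, fderiv_comp _ (B.flow.c11At hst' _).differentiableAt.self_of_nhds
      c1.differentiableAt.self_of_nhds, B.flow.fderiv_eq hst']
  have hA : (B.A s t₀ (chartExpr m (z t₀) (η t₀ (z t₀)) (η t₀)
      (extChartAt (𝓡 m) (z t₀) (z s)))).inverse =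
      B.A t₀ s (extChartAt (𝓡 m) (η t₀ (z t₀)) (η s (z s))) := by
    have h1 := B.flow.fderiv_comp hst' (chartExpr m (z t₀) (η t₀ (z t₀)) (η t₀)
      (extChartAt (𝓡 m) (z t₀) (z s)))
    have h2 := B.flow.fderiv_comp hst'' (extChartAt (𝓡 m) (η t₀ (z t₀)) (η s (z s)))
    rw [← hv] at h1
    have h3 := B.flow.leftInverse hst' (chartExpr m (z t₀) (η t₀ (z t₀)) (η t₀)
      (extChartAt (𝓡 m) (z t₀) (z s)))
    rw [← hv] at h3
    rw [h3] at h2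
    exact ContinuousLinearMap.inverse_eq h2 h1
  rw [vderiv_comp_inverseField n4 hsrc hdom.1, hfd, c2.inverse_comp_of_right, hA,
    B.eq_chartField _ hdom.2, ContinuousLinearMap.comp_neg, ContinuousLinearMap.comp_assoc]

/-- Composing `z` with the chart expression of `η t₀` removes the factor `(Dη_{t₀})⁻¹` from the
coefficient and leaves the pulled back equation of the flow box, to which `eventually_flow_eq`
applies. Thus `η s (z s)` is locally constant in `s`. -/
theorem IsSolutionFlow.eq_of_isYoungSolution_inverseField (hτ : τ ∈ Icc 0 T)
    (hD : ∀ s ∈ Icc 0 τ, z s ∈ flowDomain α Z X s)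
    (hz : IsYoungSolution α Z (inverseField X η) τ z) {s : ℝ} (hs : s ∈ Icc 0 τ) :
    η s (z s) = z 0 := by
  have ha : 0 < (α : ℝ) := by linarith
  refine (iff_of_locally_const (P := fun r => η r (z r) = z 0) isPreconnected_Icc
    (fun t₀ ht₀ => ?_) ⟨le_rfl, hτ.1⟩ hs).1 (hη.apply_zero hα hK hZ hX (hτ.1.trans hτ.2) _)
  obtain ⟨B⟩ := nonempty_flowBox hα hK hZ hX (η t₀ (z t₀))
  have hcont := hz.1.1 t₀ ht₀
  have hC := (hη.isC11DiffeoAt hα hK hZ hX ⟨ht₀.1, ht₀.2.trans hτ.2⟩ (hD t₀ ht₀)).2.chart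
    (mem_extChartAt_source (I := 𝓡 m) (z t₀)) (mem_extChartAt_source (I := 𝓡 m) (η t₀ (z t₀)))
  have hev := hη.eventually_chart hα hK hZ hX ht₀ hτ.2 hcont (hD t₀ ht₀) B
  have hzh : IsHolderNear (α : ℝ) (Icc 0 τ) t₀ fun s => extChartAt (𝓡 m) (z t₀) (z s) :=
    isHolderNear_iff.2 (hz.1.2 t₀ ht₀)
  have huh := hzh.comp_of_isBigO ha ht₀ hC.1.hasStrictFDerivAt.isBigO_sub
  have hdh := hzh.comp_of_isBigO ha ht₀ hC.1.lip
  have hvh := (B.flow.isHolderNear_flow huh).congr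
    (hev.mono fun s hs => hs.2.1.symm)
  -- The integral equation yields an expansion only once its coefficient is known to be Hölder in
  -- time; the chart formula for `inverseField` shows this from the Hölder continuity of `z` alone.
  have hW := ((hdh.inverse ha ht₀ hC.2).clm_comp (B.flow.isHolderNear_coeff B.smooth ht₀ hvh)
    ha ht₀).congr (hev.mono fun s hs => hs.2.2.symm)
  have hexp := (hz.hasExpansion hα hK hZ ht₀ hW).comp_c11At ha ht₀ hC.1
  have hinv : ∀ᶠ s in 𝓝[Icc 0 τ] t₀, (fderiv ℝ (chartExpr m (z t₀) (η t₀ (z t₀)) (η t₀))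
      (extChartAt (𝓡 m) (z t₀) (z s))).IsInvertible := by
    obtain ⟨e, he⟩ := hC.2
    refine (hdh.tendsto ha ht₀).eventually ?_
    rw [← he]
    exact ContinuousLinearEquiv.nhds e
  have hconst := B.flow.eventually_flow_eq B.smooth (convex_Icc 0 τ) ht₀
    (isHolderNear_of_forall_norm_le hZ _ _) (hexp.congr EventuallyEq.rfl (by
      filter_upwards [hev, hinv] with s h1 h2
      obtain ⟨e, he⟩ := h2
      rw [h1.2.2, ← h1.2.1, ← he, ContinuousLinearMap.inverse_equiv]
      ext1 v
      simp only [ContinuousLinearMap.comp_apply, ContinuousLinearEquiv.coe_coe,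
        ContinuousLinearEquiv.apply_symm_apply]))
  filter_upwards [hev, hconst] with s h1 h2
  have h3 := hev.self_of_nhdsWithin ht₀
  rw [← h1.2.1, ← h3.2.1] at h2
  rw [(extChartAt (𝓡 m) (η t₀ (z t₀))).injOn h1.1 h3.1 h2]

/-- For a neighbourhood `N` of `z t₀`, the image of its part in the domain under `η t₀` is a
neighbourhood of `x`. It contains `η t₀ (z s) = B.move t₀ s x` for `s` near `t₀`, and injectivity of
`η t₀` puts `z s` in `N`. -/
theorem IsSolutionFlow.continuousOn_inverse {x : M} (hτ : τ ≤ T)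
    (hD : ∀ s ∈ Icc 0 τ, z s ∈ flowDomain α Z X s) (hz : ∀ s ∈ Icc 0 τ, η s (z s) = x) :
    ContinuousOn z (Icc 0 τ) := by
  intro t₀ ht₀ N hN
  have hsub : ∀ {r}, r ∈ Icc 0 τ → r ∈ Icc 0 T := fun hr => ⟨hr.1, hr.2.trans hτ⟩
  obtain ⟨n1, n2⟩ := hη.isC11DiffeoAt hα hK hZ hX (hsub ht₀) (hD t₀ ht₀)
  obtain ⟨B⟩ := nonempty_flowBox hα hK hZ hX x
  have h1 : η t₀ '' (N ∩ flowDomain α Z X t₀) ∈ 𝓝 x := by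
    rw [← hz t₀ ht₀, ← n2.map_nhds]
    exact image_mem_map (inter_mem hN n1)
  have h2 : Tendsto (fun s => B.move t₀ s x) (𝓝[Icc 0 τ] t₀) (𝓝 x) := by
    have h3 : Tendsto (fun s => B.Φ t₀ s (extChartAt (𝓡 m) x x)) (𝓝[Icc 0 τ] t₀)
        (𝓝 (extChartAt (𝓡 m) x x)) := by
      rw [tendsto_iff_norm_sub_tendsto_zero]
      have ha := B.flow.a_pos
      have h4 : Tendsto (fun s => B.C * |t₀ - s| ^ (α : ℝ)) (𝓝[Icc 0 τ] t₀) (𝓝 0) := by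
        have : ContinuousAt (fun s : ℝ => B.C * |t₀ - s| ^ (α : ℝ)) t₀ :=
          continuousAt_const.mul (ContinuousAt.rpow_const (by fun_prop) (Or.inr ha.le))
        have := this.tendsto
        simp only [sub_self, abs_zero, Real.zero_rpow ha.ne', mul_zero] at this
        exact this.mono_left nhdsWithin_le_nhds
      refine squeeze_zero' (Eventually.of_forall fun _ => norm_nonneg _) ?_ h4
      filter_upwards [mem_nhdsWithin_of_mem_nhds (Metric.closedBall_mem_nhds t₀ B.flow.h_pos)]
        with s hs
      have hs' : |s - t₀| ≤ B.h := hs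
      exact B.flow.near (by rwa [abs_sub_comm]) _
    have h5 := (contMDiffAt_extChartAt_symm (p := x)
      (mem_extChartAt_target (I := 𝓡 m) x)).continuousAt.tendsto.comp h3
    rwa [extChartAt_to_inv] at h5
  rw [mem_map]
  filter_upwards [h2.eventually h1, self_mem_nhdsWithin,
    mem_nhdsWithin_of_mem_nhds (Metric.closedBall_mem_nhds t₀ B.flow.h_pos)] with s h3 hs hst
  have hst' : |s - t₀| ≤ B.h := hst
  have hcore : η s (z s) ∈ B.core := by rw [hz s hs]; exact B.mem_core
  obtain ⟨h4, h5⟩ := hη.eq_move hα hK hZ hX (hsub hs) (hsub ht₀) B (by rwa [abs_sub_comm])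
    (hD s hs) hcore
  obtain ⟨w, ⟨hw, hw'⟩, hwe⟩ := h3
  rw [hz s hs, ← hwe] at h5
  have := hη.injOn hα hK hZ hX (hsub ht₀) h4 hw' h5
  rw [mem_preimage, this]
  exact hw

/-- The image of `z` under the chart expression of `η t₀` is carried by the box flow to a constant,
so `hasExpansion_of_flow_eq` expands it; `HasExpansion.of_comp` then undoes `η t₀` and restores the
factor `(Dη_{t₀})⁻¹`. -/
theorem IsSolutionFlow.isYoungSolution_inverseField {x : M} (hτ : τ ≤ T)
    (hD : ∀ s ∈ Icc 0 τ, z s ∈ flowDomain α Z X s) (hz : ∀ s ∈ Icc 0 τ, η s (z s) = x) :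
    IsYoungSolution α Z (inverseField X η) τ z := by
  have ha : 0 < (α : ℝ) := by linarith
  have hcz := hη.continuousOn_inverse hα hK hZ hX hτ hD hz
  refine isYoungSolution_of_hasExpansion hα hK hZ fun t₀ ht₀ =>
    ⟨hcz t₀ ht₀, z t₀, mem_extChartAt_source _, ?_⟩
  obtain ⟨B⟩ := nonempty_flowBox hα hK hZ hX (η t₀ (z t₀))
  have hC := (hη.isC11DiffeoAt hα hK hZ hX ⟨ht₀.1, ht₀.2.trans hτ⟩ (hD t₀ ht₀)).2.chart
    (mem_extChartAt_source (I := 𝓡 m) (z t₀)) (mem_extChartAt_source (I := 𝓡 m) (η t₀ (z t₀)))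
  have hev := hη.eventually_chart hα hK hZ hX ht₀ hτ (hcz t₀ ht₀) (hD t₀ ht₀) B
  have hcont : ContinuousWithinAt (fun s => extChartAt (𝓡 m) (z t₀) (z s)) (Icc 0 τ) t₀ :=
    (continuousAt_extChartAt (I := 𝓡 m) (z t₀)).comp_continuousWithinAt (hcz t₀ ht₀)
  have hflow := B.flow.hasExpansion_of_flow_eq B.smooth ht₀ (isHolderNear_of_forall_norm_le hZ _ _)
    (u := fun s => chartExpr m (z t₀) (η t₀ (z t₀)) (η t₀) (extChartAt (𝓡 m) (z t₀) (z s)))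
    (c := extChartAt (𝓡 m) (η t₀ (z t₀)) x) (by
      filter_upwards [hev, self_mem_nhdsWithin] with s h1 hs
      rw [← h1.2.1, hz s hs])
  refine (HasExpansion.of_comp ha ht₀ hcont hC.1 hC.2 hflow).congr EventuallyEq.rfl ?_
  filter_upwards [hev] with s h1
  rw [h1.2.2, h1.2.1]

end InverseFlow

/-! ### Only the values of the driving path on the time interval matter. -/

section Congr

variable {m d : ℕ} {M : Type*} [TopologicalSpace M]
  [ChartedSpace (EuclideanSpace ℝ (Fin m)) M] {α : ℝ≥0} {T : ℝ}
  {Z Z' : ℝ → EuclideanSpace ℝ (Fin d)}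
  {X : (x : M) → (EuclideanSpace ℝ (Fin d) →L[ℝ] TangentSpace (𝓡 m) x)} {η : ℝ → M → M}

theorem HasYoungIntegral.congr {Y : ℝ → (EuclideanSpace ℝ (Fin d) →L[ℝ] ℝ)} {a b J : ℝ}
    (h : HasYoungIntegral Y Z a b J) (hZ : EqOn Z Z' (Icc a b)) : HasYoungIntegral Y Z' a b J := by
  intro ε hε
  obtain ⟨δ, hδ, hb⟩ := h ε hε
  refine ⟨δ, hδ, fun n t ξ h0 hn ht => ?_⟩
  have hmem : ∀ i ≤ n, t i ∈ Icc a b := fun i hi =>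
    ⟨h0 ▸ partition_le ht (Nat.zero_le i) hi, hn ▸ partition_le ht hi le_rfl⟩
  have := hb n t ξ h0 hn ht
  rwa [Finset.sum_congr rfl fun i hi => by
    rw [hZ (hmem i (Finset.mem_range.1 hi).le), hZ (hmem (i + 1) (Finset.mem_range.1 hi))]] at this

theorem IsYoungSolution.congr
    {W : ℝ → (x : M) → (EuclideanSpace ℝ (Fin d) →L[ℝ] TangentSpace (𝓡 m) x)} {τ : ℝ} {x : ℝ → M}
    (h : IsYoungSolution α Z W τ x) (hZ : EqOn Z Z' (Icc 0 τ)) : IsYoungSolution α Z' W τ x :=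
  ⟨h.1, fun f hf t ht => (h.2 f hf t ht).congr (hZ.mono (Icc_subset_Icc_right ht.2))⟩

theorem flowDomain_congr {t : ℝ} (hZ : EqOn Z Z' (Icc 0 t)) :
    flowDomain α Z X t = flowDomain α Z' X t :=
  Subset.antisymm (fun _ ⟨y, hy, h0⟩ => ⟨y, hy.congr hZ, h0⟩)
    fun _ ⟨y, hy, h0⟩ => ⟨y, hy.congr hZ.symm, h0⟩

theorem IsSolutionFlow.congr (h : IsSolutionFlow α T Z X η) (hZ : EqOn Z Z' (Icc 0 T)) :
    IsSolutionFlow α T Z' X η := by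
  intro t ht q hq
  have hZt : EqOn Z Z' (Icc 0 t) := hZ.mono (Icc_subset_Icc_right ht.2)
  rw [← flowDomain_congr hZt] at hq
  obtain ⟨h1, h2⟩ := h t ht q hq
  exact ⟨h1.congr hZt, h2⟩

/-- Freezing `Z` outside `[0, T]` keeps the Hölder constant, since the projection onto an interval
is `1`-Lipschitz. The flow boxes above are built from a Hölder bound at all real times. -/
theorem exists_holder_extension (hα : 0 < (α : ℝ)) (hT : 0 ≤ T) {C : ℝ≥0}
    (hZ : HolderOnWith C α Z (Icc 0 T)) : ∃ Z', EqOn Z Z' (Icc 0 T) ∧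
      ∀ s t, ‖Z' t - Z' s‖ ≤ C * |t - s| ^ (α : ℝ) := by
  refine ⟨fun t => Z (projIcc 0 T hT t), fun t ht => ?_, fun s t => ?_⟩
  · simp only [projIcc_of_mem hT ht]
  · rw [← dist_eq_norm]
    refine (hZ.dist_le (projIcc 0 T hT t).2 (projIcc 0 T hT s).2).trans ?_
    gcongr
    rw [← Real.dist_eq]
    exact (LipschitzWith.projIcc hT).dist_le_mul t s |>.trans (by simp)

end Congr

end YoungFlow
theorem mainTheorem5 {m d : ℕ} {M : Type*} [TopologicalSpace M] [T2Space M]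
    [SecondCountableTopology M] [ChartedSpace (EuclideanSpace ℝ (Fin m)) M]
    [IsManifold (𝓡 m) ∞ M]
    (α : ℝ≥0) (hα : 1 / 2 < α) (hα_le : α ≤ 1) (T : ℝ) (hT : 0 ≤ T)
    (Z : ℝ → EuclideanSpace ℝ (Fin d)) (hZ : ∃ C : ℝ≥0, HolderOnWith C α Z (Icc 0 T))
    (X : (x : M) → (EuclideanSpace ℝ (Fin d) →L[ℝ] TangentSpace (𝓡 m) x))
    (hX : YoungFlow.IsSmoothFields X)
    (η : ℝ → M → M) (hη : YoungFlow.IsSolutionFlow α T Z X η) :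
    -- `η_t` is invertible from its open domain onto its open range, with invertible derivative
    (∀ t ∈ Icc 0 T,
      IsOpen (YoungFlow.flowDomain α Z X t) ∧
      IsOpen (η t '' YoungFlow.flowDomain α Z X t) ∧
      InjOn (η t) (YoungFlow.flowDomain α Z X t) ∧
      ∀ x ∈ YoungFlow.flowDomain α Z X t,
        MDifferentiableAt (𝓡 m) (𝓡 m) (η t) x ∧
        (mfderiv (𝓡 m) (𝓡 m) (η t) x).IsInvertible) ∧
    -- `η_t⁻¹(x)` is defined for all small times, and for all times if `M` is compact
    (∀ x : M, ∀ᶠ t in 𝓝[Icc 0 T] 0, x ∈ η t '' YoungFlow.flowDomain α Z X t) ∧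
    (CompactSpace M → ∀ t ∈ Icc 0 T,
      YoungFlow.flowDomain α Z X t = univ ∧ Function.Bijective (η t)) ∧
    -- `z_s = η_s⁻¹(x)` is the solution of `dz_s = -(Dη_s(z_s))⁻¹ X(η_s(z_s)) dZ_s`, `z_0 = x`
    (∀ τ ∈ Icc 0 T, ∀ (x : M) (z : ℝ → M),
      (∀ s ∈ Icc 0 τ, z s ∈ YoungFlow.flowDomain α Z X s) →
      ((∀ s ∈ Icc 0 τ, η s (z s) = x) ↔
        YoungFlow.IsYoungSolution α Z (YoungFlow.inverseField X η) τ z ∧ z 0 = x)) := by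
  have hα' : 1 / 2 < (α : ℝ) := by exact_mod_cast hα
  obtain ⟨C, hC⟩ := hZ
  obtain ⟨Z', hZZ', hZ'⟩ := YoungFlow.exists_holder_extension (by linarith) hT hC
  have hK : (0 : ℝ) ≤ C := C.2
  have hη' := hη.congr hZZ'
  have hD : ∀ t ∈ Icc 0 T,
      YoungFlow.flowDomain α Z X t = YoungFlow.flowDomain α Z' X t := fun t ht =>
    YoungFlow.flowDomain_congr (hZZ'.mono (Icc_subset_Icc_right ht.2))
  refine ⟨fun t ht => ?_, fun x => ?_, fun hM t ht => ?_, fun τ hτ x z hz => ?_⟩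
  · rw [hD t ht]
    refine ⟨hη'.isOpen_flowDomain hα' hK hZ' hX ht, hη'.isOpen_image hα' hK hZ' hX ht,
      hη'.injOn hα' hK hZ' hX ht, fun x hx => ?_⟩
    have h := (hη'.isC11DiffeoAt hα' hK hZ' hX ht hx).2
    exact ⟨h.mdifferentiableAt, h.isInvertible_mfderiv⟩
  · filter_upwards [hη'.eventually_mem_image hα' hK hZ' hX x, self_mem_nhdsWithin] with t h ht
    rwa [hD t ht]
  · rw [hD t ht]
    exact ⟨hη'.flowDomain_eq_univ hα' hK hZ' hX ht, hη'.bijective hα' hK hZ' hX ht⟩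
  · have hz' : ∀ s ∈ Icc 0 τ, z s ∈ YoungFlow.flowDomain α Z' X s := fun s hs => by
      rw [← hD s ⟨hs.1, hs.2.trans hτ.2⟩]
      exact hz s hs
    have hZτ := hZZ'.mono (Icc_subset_Icc_right hτ.2)
    constructor
    · intro h
      refine ⟨(hη'.isYoungSolution_inverseField hα' hK hZ' hX hτ.2 hz' h).congr hZτ.symm, ?_⟩
      rw [← h 0 ⟨le_rfl, hτ.1⟩, hη'.apply_zero hα' hK hZ' hX hT]
    · rintro ⟨h, h0⟩ s hs
      rw [← h0]
      exact hη'.eq_of_isYoungSolution_inverseField hα' hK hZ' hX hτ hz' (h.congr hZτ) hs
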